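/- **Theorem (Bicategorical Pasting).** Let $\mathcal B$ be a bicategory. Every pasting diagram in $\mathcal B$ has a composite 2-cell, and that composite is unique. Precisely: let $G$ be a bracketed graph whose underlying anchored graph admits a pasting scheme presentation, and let $\phi$ be a $G$-diagram in $\mathcal B$. Then (1) $G$ admits a composition scheme extension, so that $\phi$ has a composite $|\phi|:\phi_{\mathrm{dom}_G}\to\phi_{\mathrm{codom}_G}$ with respect to it; and (2) the composites of $\phi$ with respect to any two composition scheme extensions of $G$ are equal. The terms are as follows. *Graphs.* A graph has a finite set of at least two vertices and a finite set of at least two directed edges, each with a tail and a head. A plane graph is a graph with a topological embedding of its geometric realization into $\mathbb C$; all plane graphs here are connected. Its interior faces are the bounded components, and its exterior face the unbounded component, of the complement. A directed path $v_0e_1v_1\cdots e_nv_n$ has distinct vertices, and $e_i$ goes from $v_{i-1}$ to $v_i$. $P^*$ is the reverse of a path $P$. *Anchored graphs.* A connected plane graph $G$ is anchored if every interior face $F$ is equipped with distinct vertices $s_F,t_F$ and directed paths $\mathrm{dom}_F,\mathrm{codom}_F$ from $s_F$ to $t_F$ such that the boundary of $F$, traversed with $F$ always on the right, is $\mathrm{dom}_F\,\mathrm{codom}_F^*$;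 and the exterior face is equipped with distinct vertices $s_G,t_G$ and directed paths $\mathrm{dom}_G,\mathrm{codom}_G$ from $s_G$ to $t_G$ such that its boundary, traversed with the exterior face always on the right, is $\mathrm{codom}_G\,\mathrm{dom}_G^*$. For each interior face $F$ we require that the boundary is a cycle: $\mathrm{dom}_F$ and $\mathrm{codom}_F$ have no common edge, and no common vertex except $s_F$ and $t_F$. $G$ is atomic if it has exactly one interior face. If $\mathrm{codom}_G$ and $\mathrm{dom}_H$ have the same length, the vertical composite $HG$ is obtained from $G\sqcup H$ by identifying $\mathrm{codom}_G$ with $\mathrm{dom}_H$; its interior faces are those of $G$ and $H$, $\mathrm{dom}_{HG}=\mathrm{dom}_G$ and $\mathrm{codom}_{HG}=\mathrm{codom}_H$. Anchored graphs are considered up to isomorphism (bijections of vertices, edges and interior faces that preserve tails, heads, domains and codomains). A pasting scheme presentation of $G$ is a decomposition $G=G_n\cdots G_1$ into a vertical composite of $n\ge 1$ atomic graphs. *Bracketed graphs.* A bracketing of length $n\ge1$ is a full parenthesization of $n$ dashes into binary products; a bracketing $b$ for a directed path $P=(e_1,\dots,e_n)$ gives the bracketed path $(P)=b(e_1,\dots,e_n)$.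 A bracketed graph is an anchored graph with bracketings for $\mathrm{dom}_G$, $\mathrm{codom}_G$, and $\mathrm{dom}_F$, $\mathrm{codom}_F$ for every interior face $F$. The vertical composite $HG$ of bracketed graphs requires $(\mathrm{codom}_G)=(\mathrm{dom}_H)$ as bracketed paths and inherits its bracketings. A consistent graph is a bracketed atomic graph such that, for some bracketing $b$, $(\mathrm{dom}_G)=b(e_1,\dots,e_m,(\mathrm{dom}_F),e'_1,\dots,e'_n)$ and $(\mathrm{codom}_G)=b(e_1,\dots,e_m,(\mathrm{codom}_F),e'_1,\dots,e'_n)$, where $F$ is the interior face, $(e_1,\dots,e_m)$ is the path from $s_G$ to $s_F$ and $(e'_1,\dots,e'_n)$ the path from $t_F$ to $t_G$. It is an associativity graph if $(\mathrm{dom}_F)=(E_1E_2)E_3$ and $(\mathrm{codom}_F)=E'_1(E'_2E'_3)$, or $(\mathrm{dom}_F)=E_1(E_2E_3)$ and $(\mathrm{codom}_F)=(E'_1E'_2)E'_3$, with $E_i,E_i'$ non-trivial bracketed paths of the same bracketing. *Composition schemes.* A composition scheme is a bracketed graph $H$ with a decomposition $H=H_n\cdots H_1$ into a vertical composite of $n\geq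 1$ consistent graphs. A composition scheme extension of a bracketed graph $G$ is a composition scheme $H=H_n\cdots H_1$ with a proper subsequence $A_1,\dots,A_j$ of associativity graphs among $H_1,\dots,H_n$ such that $G$ is obtained from $H$ by collapsing $A_1,\dots,A_j$: in each $A_k$, corresponding edges of $E_i$ and $E'_i$, with their tails and heads, are identified; the remaining interior faces are those of $G$; and they and the graph keep their bracketed domains and codomains. *Diagrams and composites.* A $G$-diagram $\phi$ in $\mathcal B$ assigns an object $\phi_v$ to each vertex, a 1-cell $\phi_e:\phi_u\to\phi_v$ to each edge $e$ from $u$ to $v$, and a 2-cell $\phi_F:\phi_{\mathrm{dom}_F}\to\phi_{\mathrm{codom}_F}$ to each interior face $F$; here $\phi_P$ is the horizontal composite, bracketed as $(P)$, of the 1-cells of the edges of $P$. If $H=H_n\cdots H_1$ is a composition scheme, the composite of an $H$-diagram $\phi$ is the vertical composite $\phi_{H_n}\cdots\phi_{H_1}$, where $\phi_{H_i}=b_i(1,\dots,1,\phi_{F_i},1,\dots,1)$ is the horizontal composite, bracketed by the bracketing $b_i$ of the consistent graph $H_i$, of the 2-cell of its interior face $F_i$ with the identity 2-cells of the other edges.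 If $H$ is a composition scheme extension of $G$ and $\phi$ is a $G$-diagram, then $\phi_H$ is the $H$-diagram with the values of $\phi$ on the images of the vertices and edges in $G$ and on the interior faces of $G$, and with the component of the associator or of its inverse that has the required domain and codomain on the face of each $A_k$. The composite of $\phi$ with respect to $H$ is the composite of $\phi_H$ with respect to $H_n\cdots H_1$. -/

import Mathlib

open CategoryTheory Topology

namespace BicatPasting

/-! ## Graphs and directed paths -/

universe v₁ u₁ v₂ u₂

/-- A graph: a finite set of vertices with at least two elements and a finite set of directed
edges with at least two elements.  The edges with tail `u` and head `v` form the type `u ⟶ v`;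
the set of all edges is `Quiver.Total V`. -/
structure Graph where
  V : Type
  [quiver : Quiver.{0} V]
  finite_V : Finite V
  finite_E : Finite (Quiver.Total V)
  two_le_V : 2 ≤ Nat.card V
  two_le_E : 2 ≤ Nat.card (Quiver.Total V)

attribute [instance] Graph.quiver

section Paths

variable {V : Type u₁} [Quiver.{v₁} V] {W : Type u₂} [Quiver.{v₂} W]

/-- The list of edges of a directed walk, in order. -/
def pathEdges {u : V} : ∀ {v : V}, Quiver.Path u v → List (Quiver.Total V)
  | _, .nil => []
  | _, .cons p e => pathEdges p ++ [⟨_, _, e⟩]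

/-- A directed path is a directed walk whose vertices are distinct. -/
def IsDirectedPath {u v : V} (p : Quiver.Path u v) : Prop := p.vertices.Nodup

/-- The action of a morphism of graphs on the set of all edges. -/
def mapEdge (π : V ⥤q W) (e : Quiver.Total V) : Quiver.Total W :=
  ⟨π.obj e.left, π.obj e.right, π.map e.hom⟩

/-- A bracketing of length at least one: a dash, or `(b b')`. -/
inductive Bracketing : Type
  | dash : Bracketing
  | app : Bracketing → Bracketing → Bracketing

/-- Bracketed non-trivial directed walks `b(e₁, …, eₙ)`: the dashes of a bracketing `b` of length
`n ≥ 1` are replaced by consecutive edges. -/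
inductive BPath {V : Type u₁} [Quiver.{v₁} V] : V → V → Type max u₁ v₁
  | edge {u v : V} (e : u ⟶ v) : BPath u v
  | comp {u v w : V} (p : BPath u v) (q : BPath v w) : BPath u w

namespace BPath

/-- The underlying directed walk: forget the brackets. -/
def toPath : ∀ {u v : V}, BPath u v → Quiver.Path u v
  | _, _, edge e => e.toPath
  | _, _, comp p q => p.toPath.comp q.toPath

/-- The bracketing: forget the edges. -/
def bracketing : ∀ {u v : V}, BPath u v → Bracketing
  | _, _, edge _ => .dash
  | _, _, comp p q => .app p.bracketing q.bracketing

/-- The image of a bracketed walk under a morphism of graphs. -/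
def map (π : V ⥤q W) : ∀ {u v : V}, BPath u v → BPath (π.obj u) (π.obj v)
  | _, _, edge e => edge (π.map e)
  | _, _, comp p q => comp (p.map π) (q.map π)

end BPath

/-- A bracketing for a directed path `P`: a bracketed walk `b(P)` with underlying walk `P`. -/
def BracketingFor {u v : V} (P : Quiver.Path u v) : Type _ := {b : BPath u v // b.toPath = P}

/-- A source, a sink, and two parallel walks (a domain and a codomain) from source to sink. -/
structure ParPath (V : Type u₁) [Quiver.{v₁} V] where
  src : V
  snk : V
  dom : Quiver.Path src snk
  codom : Quiver.Path src snk

/-- A source, a sink, and two parallel bracketed walks from source to sink. -/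
structure ParBPath (V : Type u₁) [Quiver.{v₁} V] where
  src : V
  snk : V
  dom : BPath src snk
  codom : BPath src snk

/-- The image of a parallel pair under a morphism of graphs. -/
def ParPath.map (c : ParPath V) (π : V ⥤q W) : ParPath W :=
  ⟨π.obj c.src, π.obj c.snk, π.mapPath c.dom, π.mapPath c.codom⟩

/-- The image of a bracketed parallel pair under a morphism of graphs. -/
def ParBPath.map (c : ParBPath V) (π : V ⥤q W) : ParBPath W :=
  ⟨π.obj c.src, π.obj c.snk, c.dom.map π, c.codom.map π⟩

/-- A bracketing of positive length with one distinguished dash, which is left open as a hole that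
accepts a bracketed walk from `s` to `t`, and with all other dashes replaced by edges so that the
whole runs from `u` to `v`: the data `b(e₁, …, eₘ, -, e'₁, …, e'ₙ)`. -/
inductive Context {V : Type u₁} [Quiver.{v₁} V] (s t : V) :
    V → V → Type max u₁ v₁
  | hole : Context s t s t
  | left {u v w : V} (p : BPath u v) (c : Context s t v w) : Context s t u w
  | right {u v w : V} (c : Context s t u v) (p : BPath v w) : Context s t u w

/-- Substitute a bracketed walk for the open dash: `b(e₁, …, eₘ, (P), e'₁, …, e'ₙ)`. -/
def Context.fill {s t : V} (P : BPath s t) : ∀ {u v : V}, Context s t u v → BPath u v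
  | _, _, hole => P
  | _, _, left p c => .comp p (c.fill P)
  | _, _, right c p => .comp (c.fill P) p

/-- The shape of the interior face of an associativity graph: domain and codomain are
`(E₁E₂)E₃` and `E₁'(E₂'E₃')`, or `E₁(E₂E₃)` and `(E₁'E₂')E₃'`, where `Eᵢ` and `Eᵢ'` are
non-trivial and have the same bracketing (in particular the same length). -/
inductive IsAssociativity : ParBPath V → Prop
  | fwd {s t a b a' b' : V} (E₁ : BPath s a) (E₂ : BPath a b) (E₃ : BPath b t)
      (E₁' : BPath s a') (E₂' : BPath a' b') (E₃' : BPath b' t)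
      (h₁ : E₁.bracketing = E₁'.bracketing) (h₂ : E₂.bracketing = E₂'.bracketing)
      (h₃ : E₃.bracketing = E₃'.bracketing) :
      IsAssociativity ⟨s, t, (E₁.comp E₂).comp E₃, E₁'.comp (E₂'.comp E₃')⟩
  | bwd {s t a b a' b' : V} (E₁ : BPath s a) (E₂ : BPath a b) (E₃ : BPath b t)
      (E₁' : BPath s a') (E₂' : BPath a' b') (E₃' : BPath b' t)
      (h₁ : E₁.bracketing = E₁'.bracketing) (h₂ : E₂.bracketing = E₂'.bracketing)
      (h₃ : E₃.bracketing = E₃'.bracketing) :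
      IsAssociativity ⟨s, t, E₁.comp (E₂.comp E₃), (E₁'.comp E₂').comp E₃'⟩

/-- What an associativity pair becomes once `Eᵢ` and `Eᵢ'` are identified: one step of
rebracketing of a single walk, `(E₁E₂)E₃ ⇒ E₁(E₂E₃)` or the reverse. -/
inductive Rebracket : ParBPath V → Type max u₁ v₁
  | assoc {s a b t : V} (E₁ : BPath s a) (E₂ : BPath a b) (E₃ : BPath b t) :
      Rebracket ⟨s, t, (E₁.comp E₂).comp E₃, E₁.comp (E₂.comp E₃)⟩
  | assocInv {s a b t : V} (E₁ : BPath s a) (E₂ : BPath a b) (E₃ : BPath b t) :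
      Rebracket ⟨s, t, E₁.comp (E₂.comp E₃), (E₁.comp E₂).comp E₃⟩

theorem pathEdges_comp {u v w : V} (p : Quiver.Path u v) (q : Quiver.Path v w) :
    pathEdges (p.comp q) = pathEdges p ++ pathEdges q := by
  induction q with
  | nil => simp [pathEdges]
  | cons q e ih => simp [pathEdges, Quiver.Path.comp_cons, ih]

theorem BPath.length_eq {u v : V} (p : BPath u v) :
    ∀ {u' v' : V} (q : BPath u' v'), p.bracketing = q.bracketing →
      (pathEdges p.toPath).length = (pathEdges q.toPath).length := by
  induction p with
  | edge e =>
    intro u' v' q h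
    cases q with
    | edge f => rfl
    | comp q₁ q₂ => simp [BPath.bracketing] at h
  | comp p₁ p₂ h₁ h₂ =>
    intro u' v' q h
    cases q with
    | edge f => simp [BPath.bracketing] at h
    | comp q₁ q₂ =>
      simp only [BPath.bracketing, Bracketing.app.injEq] at h
      simp [BPath.toPath, pathEdges_comp, h₁ q₁ h.1, h₂ q₂ h.2]

/-- If two bracketed walks have the same bracketing and a morphism of graphs identifies their
corresponding edges, then it identifies the bracketed walks. -/
theorem BPath.map_eq_map (π : V ⥤q W) {u v : V} (p : BPath u v) :
    ∀ {u' v' : V} (q : BPath u' v'), p.bracketing = q.bracketing →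
      (pathEdges p.toPath).map (mapEdge π) = (pathEdges q.toPath).map (mapEdge π) →
      (⟨_, _, p.map π⟩ : Σ x y : W, BPath x y) = ⟨_, _, q.map π⟩ := by
  induction p with
  | edge e =>
    intro u' v' q h he
    cases q with
    | edge f =>
      have : mapEdge π ⟨_, _, e⟩ = mapEdge π ⟨_, _, f⟩ := by
        simpa [BPath.toPath, Quiver.Hom.toPath, pathEdges] using he
      exact congrArg (fun x : Quiver.Total W => (⟨x.left, x.right, .edge x.hom⟩ : Σ x y : W, BPath x y))
        this
    | comp q₁ q₂ => simp [BPath.bracketing] at h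
  | comp p₁ p₂ h₁ h₂ =>
    intro u' v' q h he
    cases q with
    | edge f => simp [BPath.bracketing] at h
    | comp q₁ q₂ =>
      simp only [BPath.bracketing, Bracketing.app.injEq] at h
      simp only [BPath.toPath, pathEdges_comp, List.map_append] at he
      obtain ⟨he₁, he₂⟩ := List.append_inj he (by simpa using p₁.length_eq q₁ h.1)
      have k₁ := h₁ q₁ h.1 he₁
      have k₂ := h₂ q₂ h.2 he₂
      simp only [BPath.map]
      revert k₁ k₂
      generalize p₁.map π = a₁
      generalize p₂.map π = a₂
      generalize q₁.map π = b₁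
      generalize q₂.map π = b₂
      revert a₁ a₂ b₁ b₂
      generalize π.obj _ = x₁
      generalize π.obj _ = x₂
      generalize π.obj _ = x₃
      generalize π.obj _ = y₁
      generalize π.obj _ = y₂
      generalize π.obj _ = y₃
      intro a₁ a₂ b₁ b₂ k₁ k₂
      cases k₁
      cases k₂
      rfl

theorem nonempty_rebracket {c : ParBPath V} (hc : IsAssociativity c) (π : V ⥤q W)
    (hπ : ∀ (k : ℕ) (e e' : Quiver.Total V), (pathEdges c.dom.toPath)[k]? = some e →
      (pathEdges c.codom.toPath)[k]? = some e' → mapEdge π e = mapEdge π e') :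
    Nonempty (Rebracket (c.map π)) := by
  have key : ∀ {l l' : List (Quiver.Total V)}, l.length = l'.length →
      (∀ (k : ℕ) (e e' : Quiver.Total V), l[k]? = some e → l'[k]? = some e' →
        mapEdge π e = mapEdge π e') → l.map (mapEdge π) = l'.map (mapEdge π) := by
    intro l l' hl h
    apply List.ext_getElem (by simpa using hl)
    intro k h₁ h₂
    simp only [List.getElem_map]
    exact h k _ _ (by simp) (by simp)
  cases hc with
  | fwd E₁ E₂ E₃ E₁' E₂' E₃' h₁ h₂ h₃ =>
    have l₁ := E₁.length_eq E₁' h₁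
    have l₂ := E₂.length_eq E₂' h₂
    have l₃ := E₃.length_eq E₃' h₃
    have H := key (by simp [BPath.toPath, pathEdges_comp, l₁, l₂, l₃]) hπ
    simp only [BPath.toPath, pathEdges_comp, List.map_append, List.append_assoc] at H
    obtain ⟨H₁, H⟩ := List.append_inj H (by simpa using l₁)
    obtain ⟨H₂, H₃⟩ := List.append_inj H (by simpa using l₂)
    have k₁ := E₁.map_eq_map π E₁' h₁ H₁
    have k₂ := E₂.map_eq_map π E₂' h₂ H₂
    have k₃ := E₃.map_eq_map π E₃' h₃ H₃
    simp only [ParBPath.map, BPath.map]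
    revert k₁ k₂ k₃
    generalize E₁.map π = a₁
    generalize E₂.map π = a₂
    generalize E₃.map π = a₃
    generalize E₁'.map π = b₁
    generalize E₂'.map π = b₂
    generalize E₃'.map π = b₃
    revert a₁ a₂ a₃ b₁ b₂ b₃
    generalize π.obj _ = x₁
    generalize π.obj _ = x₂
    generalize π.obj _ = x₃
    generalize π.obj _ = x₄
    generalize π.obj _ = x₅
    generalize π.obj _ = x₆
    intro a₁ a₂ a₃ b₁ b₂ b₃ k₁ k₂ k₃
    cases k₁
    cases k₂
    cases k₃
    exact ⟨.assoc _ _ _⟩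
  | bwd E₁ E₂ E₃ E₁' E₂' E₃' h₁ h₂ h₃ =>
    have l₁ := E₁.length_eq E₁' h₁
    have l₂ := E₂.length_eq E₂' h₂
    have l₃ := E₃.length_eq E₃' h₃
    have H := key (by simp [BPath.toPath, pathEdges_comp, l₁, l₂, l₃]) hπ
    simp only [BPath.toPath, pathEdges_comp, List.map_append, List.append_assoc] at H
    obtain ⟨H₁, H⟩ := List.append_inj H (by simpa using l₁)
    obtain ⟨H₂, H₃⟩ := List.append_inj H (by simpa using l₂)
    have k₁ := E₁.map_eq_map π E₁' h₁ H₁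
    have k₂ := E₂.map_eq_map π E₂' h₂ H₂
    have k₃ := E₃.map_eq_map π E₃' h₃ H₃
    simp only [ParBPath.map, BPath.map]
    revert k₁ k₂ k₃
    generalize E₁.map π = a₁
    generalize E₂.map π = a₂
    generalize E₃.map π = a₃
    generalize E₁'.map π = b₁
    generalize E₂'.map π = b₂
    generalize E₃'.map π = b₃
    revert a₁ a₂ a₃ b₁ b₂ b₃
    generalize π.obj _ = x₁
    generalize π.obj _ = x₂
    generalize π.obj _ = x₃
    generalize π.obj _ = x₄
    generalize π.obj _ = x₅
    generalize π.obj _ = x₆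
    intro a₁ a₂ a₃ b₁ b₂ b₃ k₁ k₂ k₃
    cases k₁
    cases k₂
    cases k₃
    exact ⟨.assocInv _ _ _⟩

/-- The number of edges in the left factor. -/
def BPath.leftLength : ∀ {u v : V}, BPath u v → ℕ
  | _, _, edge _ => 0
  | _, _, comp p _ => (pathEdges p.toPath).length

theorem BPath.length_pos {u v : V} (p : BPath u v) : 0 < (pathEdges p.toPath).length := by
  induction p with
  | edge e => simp [toPath, Quiver.Hom.toPath, pathEdges]
  | comp p q h _ => simp [toPath, pathEdges_comp]; omega

theorem Rebracket.heq {c c' : ParBPath V} (r : Rebracket c) (r' : Rebracket c') (h : c = c') :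
    r ≍ r' := by
  have hl := congrArg (fun c : ParBPath V => c.dom.leftLength) h
  have hr := congrArg (fun c : ParBPath V => c.codom.leftLength) h
  cases r with
  | assoc E₁ E₂ E₃ =>
    cases r' with
    | assoc => cases h; rfl
    | assocInv E₁' E₂' E₃' =>
      have := E₂.length_pos
      have := E₂'.length_pos
      simp [BPath.leftLength, BPath.toPath, pathEdges_comp] at hl hr
      omega
  | assocInv E₁ E₂ E₃ =>
    cases r' with
    | assocInv => cases h; rfl
    | assoc E₁' E₂' E₃' =>
      have := E₂.length_pos
      have := E₂'.length_pos
      simp [BPath.leftLength, BPath.toPath, pathEdges_comp] at hl hr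
      omega

/-- A pair is a step of rebracketing in at most one way. -/
instance Rebracket.instSubsingleton (c : ParBPath V) : Subsingleton (Rebracket c) := ⟨fun r r' => eq_of_heq (r.heq r' rfl)⟩

end Paths

/-! ## Plane graphs -/

namespace Graph

variable (G : Graph)

/-- The disjoint union of one point for each vertex and one unit interval for each edge. -/
abbrev Cells : Type := (Σ _ : G.V, Unit) ⊕ (Σ _ : Quiver.Total G.V, unitInterval)

/-- The identifications `tail e ∼ 0 ∈ [0,1]_e` and `1 ∈ [0,1]_e ∼ head e`. -/
inductive Glue : G.Cells → G.Cells → Prop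
  | tail (e : Quiver.Total G.V) : Glue (.inl ⟨e.left, ()⟩) (.inr ⟨e, 0⟩)
  | head (e : Quiver.Total G.V) : Glue (.inr ⟨e, 1⟩) (.inl ⟨e.right, ()⟩)

/-- The geometric realization, with the quotient topology. -/
abbrev Realization : Type := Quot G.Glue

/-- Each pair of vertices is joined by an undirected walk. -/
def Connected : Prop := ∀ u v : G.V, Relation.EqvGen (fun a b : G.V => Nonempty (a ⟶ b)) u v

end Graph

/-- A connected plane graph: a connected graph with a topological embedding of its geometric
realization into the complex plane. -/
structure PlaneGraph extends Graph where
  connected : toGraph.Connected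
  emb : toGraph.Realization → ℂ
  isEmbedding : IsEmbedding emb

/-- A self-homeomorphism of the plane preserves the orientation if it is isotopic to the
identity. -/
def IsOrientationPreserving (h : ℂ ≃ₜ ℂ) : Prop :=
  ∃ Φ : unitInterval → (ℂ ≃ₜ ℂ), Continuous (fun p : unitInterval × ℂ => Φ p.1 p.2) ∧
    Φ 0 = Homeomorph.refl ℂ ∧ Φ 1 = h

namespace PlaneGraph

variable (G : PlaneGraph)

/-- The parametrized arc in the plane that draws the edge `e`, from its tail to its head. -/
def arc (e : Quiver.Total G.V) (t : unitInterval) : ℂ := G.emb (Quot.mk _ (.inr ⟨e, t⟩))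

/-- The complement of the graph in the plane. -/
def complement : Set ℂ := (Set.range G.emb)ᶜ

/-- The (open) interior faces: the bounded connected components of the complement. -/
def InteriorFace : Type :=
  {F : Set ℂ // (∃ z ∈ G.complement, F = connectedComponentIn G.complement z) ∧
    Bornology.IsBounded F}

/-- The (open) exterior face: the unbounded connected component of the complement. -/
def exterior : Set ℂ :=
  {z | z ∈ G.complement ∧ ¬ Bornology.IsBounded (connectedComponentIn G.complement z)}

/-- All faces: `none` is the exterior face. -/
abbrev Face : Type := Option G.InteriorFace

/-- The open subset of the plane that is occupied by a face. -/
def region : G.Face → Set ℂ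
  | none => G.exterior
  | some F => F.1

/-- The region `R` lies on the right-hand side of the edge `e`, traversed from tail to head: after
an orientation preserving homeomorphism of the plane that carries the edge to the real
segment from `0` to `1`, the points just below its midpoint belong to `R`. -/
def OnRight (e : Quiver.Total G.V) (R : Set ℂ) : Prop :=
  ∃ h : ℂ ≃ₜ ℂ, IsOrientationPreserving h ∧ (∀ t : unitInterval, h (G.arc e t) = ((t : ℝ) : ℂ)) ∧
    ∀ᶠ ε : ℝ in 𝓝[>] 0, h.symm (1 / 2 - ε * Complex.I) ∈ R

/-- The region `R` lies on the left-hand side of the edge `e`, traversed from tail to head; that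
is, on the right-hand side when `e` is traversed backwards. -/
def OnLeft (e : Quiver.Total G.V) (R : Set ℂ) : Prop :=
  ∃ h : ℂ ≃ₜ ℂ, IsOrientationPreserving h ∧ (∀ t : unitInterval, h (G.arc e t) = ((t : ℝ) : ℂ)) ∧
    ∀ᶠ ε : ℝ in 𝓝[>] 0, h.symm (1 / 2 + ε * Complex.I) ∈ R

end PlaneGraph

/-! ## Anchored graphs -/

/-- A connected plane graph with a source, a sink, a domain and a codomain for each face.
`ext` is the anchor of the exterior face, that is, of the graph itself. -/
structure PreAnchoredGraph extends PlaneGraph where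
  ext : ParPath V
  face : toPlaneGraph.InteriorFace → ParPath V

namespace PreAnchoredGraph

variable (G : PreAnchoredGraph)

/-- The anchor of a face. -/
def anchor : G.Face → ParPath G.V
  | none => G.ext
  | some F => G.face F

/-- The edges that the boundary walk of a face traverses from tail to head.  The boundary of an
interior face `F` is `dom_F codom_F^*`, that of the exterior face is `codom_G dom_G^*`. -/
def forwardEdges : G.Face → List (Quiver.Total G.V)
  | none => pathEdges G.ext.codom
  | some F => pathEdges (G.face F).dom

/-- The edges that the boundary walk of a face traverses from head to tail. -/
def backwardEdges : G.Face → List (Quiver.Total G.V)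
  | none => pathEdges G.ext.dom
  | some F => pathEdges (G.face F).codom

end PreAnchoredGraph

/-- An anchored graph.  Each face has distinct source and sink, its domain and codomain are
directed paths, and they make up the boundary walk of the face, with the face always on the
right-hand side.  Every edge has exactly one face on each of its two sides; so the walks are the
full boundaries precisely when each edge is traversed exactly once in each direction.
The boundary of an interior face is a cycle: it repeats no edge, and its domain and codomain have
only the source and the sink of the face in common. -/
structure AnchoredGraph extends PreAnchoredGraph where
  src_ne_snk : ∀ F, (toPreAnchoredGraph.anchor F).src ≠ (toPreAnchoredGraph.anchor F).snk
  isPath_dom : ∀ F, IsDirectedPath (toPreAnchoredGraph.anchor F).dom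
  isPath_codom : ∀ F, IsDirectedPath (toPreAnchoredGraph.anchor F).codom
  onRight : ∀ F, ∀ e ∈ toPreAnchoredGraph.forwardEdges F,
    toPlaneGraph.OnRight e (toPlaneGraph.region F)
  onLeft : ∀ F, ∀ e ∈ toPreAnchoredGraph.backwardEdges F,
    toPlaneGraph.OnLeft e (toPlaneGraph.region F)
  forward_once : ∀ e, ∃! F, e ∈ toPreAnchoredGraph.forwardEdges F
  backward_once : ∀ e, ∃! F, e ∈ toPreAnchoredGraph.backwardEdges F
  edge_disjoint : ∀ F, ∀ e ∈ pathEdges (face F).dom, e ∉ pathEdges (face F).codom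
  vertex_disjoint : ∀ F, ∀ v ∈ (face F).dom.vertices, v ∈ (face F).codom.vertices →
    v = (face F).src ∨ v = (face F).snk

/-- An atomic graph is an anchored graph with exactly one interior face. -/
def AnchoredGraph.IsAtomic (G : AnchoredGraph) : Prop := ∃! _F : G.InteriorFace, True

/-- The data that exhibit the anchored graph `K` as the vertical composite `HG`: the graph `K` is
obtained from the disjoint union of `G` and `H` by identifying `codom_G` with `dom_H`
(both become the path `mid`), its interior faces are those of `G` and `H`, and its
exterior face has domain `dom_G` and codomain `codom_H`. -/
structure VComp (G H K : AnchoredGraph) where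
  inl : G.V ⥤q K.V
  inr : H.V ⥤q K.V
  inl_obj_injective : Function.Injective inl.obj
  inr_obj_injective : Function.Injective inr.obj
  inl_edge_injective : Function.Injective (mapEdge inl)
  inr_edge_injective : Function.Injective (mapEdge inr)
  obj_cover : ∀ v, v ∈ Set.range inl.obj ∨ v ∈ Set.range inr.obj
  edge_cover : ∀ e, e ∈ Set.range (mapEdge inl) ∨ e ∈ Set.range (mapEdge inr)
  mid : Quiver.Path K.ext.src K.ext.snk
  ext_left : G.ext.map inl = ⟨K.ext.src, K.ext.snk, K.ext.dom, mid⟩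
  ext_right : H.ext.map inr = ⟨K.ext.src, K.ext.snk, mid, K.ext.codom⟩
  obj_glue : ∀ u v, inl.obj u = inr.obj v → u ∈ G.ext.codom.vertices
  edge_glue : ∀ e f, mapEdge inl e = mapEdge inr f → e ∈ pathEdges G.ext.codom
  faces : G.InteriorFace ⊕ H.InteriorFace ≃ K.InteriorFace
  face_left : ∀ F, K.face (faces (.inl F)) = (G.face F).map inl
  face_right : ∀ F, K.face (faces (.inr F)) = (H.face F).map inr

/-- The anchored graph admits a pasting scheme presentation `Gₙ ⋯ G₁`, with `n ≥ 1` and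
all `Gᵢ` atomic. -/
inductive HasPastingSchemePresentation : AnchoredGraph → Prop
  | atomic {G : AnchoredGraph} (hG : G.IsAtomic) : HasPastingSchemePresentation G
  | vcomp {G H K : AnchoredGraph} (hG : HasPastingSchemePresentation G) (hH : H.IsAtomic)
      (c : VComp G H K) : HasPastingSchemePresentation K

/-! ## Bracketed graphs and composition schemes -/

/-- An anchored graph with a bracketing for the domain and the codomain of each face. -/
structure BracketedGraph extends AnchoredGraph where
  extDom : BracketingFor ext.dom
  extCodom : BracketingFor ext.codom
  faceDom : ∀ F, BracketingFor (face F).dom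
  faceCodom : ∀ F, BracketingFor (face F).codom

namespace BracketedGraph

variable (G : BracketedGraph)

/-- The bracketed domain and codomain of the graph. -/
def bext : ParBPath G.V := ⟨G.ext.src, G.ext.snk, G.extDom.1, G.extCodom.1⟩

/-- The bracketed domain and codomain of an interior face. -/
def bface (F : G.InteriorFace) : ParBPath G.V :=
  ⟨(G.face F).src, (G.face F).snk, (G.faceDom F).1, (G.faceCodom F).1⟩

end BracketedGraph

/-- The data that exhibit the bracketed graph `K` as the vertical composite `HG` of bracketed
graphs; in particular `(codom_G) = (dom_H)` as bracketed paths. -/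
structure BVComp (G H K : BracketedGraph) extends
    VComp G.toAnchoredGraph H.toAnchoredGraph K.toAnchoredGraph where
  bmid : BPath K.ext.src K.ext.snk
  bext_left : G.bext.map inl = ⟨K.ext.src, K.ext.snk, K.extDom.1, bmid⟩
  bext_right : H.bext.map inr = ⟨K.ext.src, K.ext.snk, bmid, K.extCodom.1⟩
  bface_left : ∀ F, K.bface (faces (.inl F)) = (G.bface F).map inl
  bface_right : ∀ F, K.bface (faces (.inr F)) = (H.bface F).map inr

/-- A consistent graph: an atomic graph with interior face `F`, bracketed so that
`(dom_G) = b(e₁, …, eₘ, (dom_F), e'₁, …, e'ₙ)` and `(codom_G) = b(e₁, …, eₘ, (codom_F), e'₁, …, e'ₙ)`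
for one bracketing `b`. -/
structure Consistent (G : BracketedGraph) where
  F : G.InteriorFace
  unique : ∀ F', F' = F
  ctx : Context (G.face F).src (G.face F).snk G.ext.src G.ext.snk
  dom_eq : G.extDom.1 = ctx.fill (G.faceDom F).1
  codom_eq : G.extCodom.1 = ctx.fill (G.faceCodom F).1

/-- A composition scheme presentation `Gₙ ⋯ G₁` of a bracketed graph, with `n ≥ 1` and
all `Gᵢ` consistent. -/
inductive CompositionScheme : BracketedGraph → Type 1
  | single {G : BracketedGraph} (c : Consistent G) : CompositionScheme G
  | vcomp {G H K : BracketedGraph} (S : CompositionScheme G) (c : Consistent H)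
      (v : BVComp G H K) : CompositionScheme K

/-- Corresponding vertices of the domain and the codomain of a face that belongs to `A`. -/
def CollapseVertex (H : BracketedGraph) (A : Set H.InteriorFace) (v v' : H.V) : Prop :=
  ∃ F ∈ A, ∃ k : ℕ, (H.face F).dom.vertices[k]? = some v ∧ (H.face F).codom.vertices[k]? = some v'

/-- Corresponding edges of the domain and the codomain of a face that belongs to `A`. -/
def CollapseEdge (H : BracketedGraph) (A : Set H.InteriorFace) (e e' : Quiver.Total H.V) : Prop :=
  ∃ F ∈ A, ∃ k : ℕ, (pathEdges (H.face F).dom)[k]? = some e ∧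
    (pathEdges (H.face F).codom)[k]? = some e'

/-- A composition scheme extension of the bracketed graph `G`: a composition scheme
`H = Hₙ ⋯ H₁` and a proper subset `A` of its interior faces (that is, of the constituents `Hᵢ`, each
of which contains exactly one of them) whose constituents are associativity graphs, such that `G` is
obtained from `H` by collapsing these.  That is, `π` presents the graph `G` as the quotient of
`H` by the identification of corresponding vertices and edges; the interior faces of `G` are
those of `H` outside `A`, and they and the exterior face keep their bracketed domains and
codomains. -/
structure CompositionSchemeExtension (G : BracketedGraph) where
  H : BracketedGraph
  scheme : CompositionScheme H
  A : Set H.InteriorFace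
  proper : A ≠ Set.univ
  isAssociativity : ∀ F ∈ A, IsAssociativity (H.bface F)
  π : H.V ⥤q G.V
  obj_surjective : Function.Surjective π.obj
  edge_surjective : Function.Surjective (mapEdge π)
  obj_eq_iff : ∀ v v', π.obj v = π.obj v' ↔ Relation.EqvGen (CollapseVertex H A) v v'
  edge_eq_iff : ∀ e e', mapEdge π e = mapEdge π e' ↔ Relation.EqvGen (CollapseEdge H A) e e'
  faces : {F : H.InteriorFace // F ∉ A} ≃ G.InteriorFace
  bface_eq : ∀ F, (H.bface F.1).map π = G.bface (faces F)
  bext_eq : H.bext.map π = G.bext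

/-! ## Diagrams in a bicategory -/

section Diagrams

universe w v u

variable {B : Type u} [Bicategory.{w, v} B] {V : Type} [Quiver.{0} V]
  {W : Type} [Quiver.{0} W]

/-- The `1`-cell `φ_P` for a bracketed walk `P`.  (Compositions are written in diagrammatic order,
so that `f ≫ g` is `g f`.) -/
def eval (φ : V ⥤q B) : ∀ {x y : V}, BPath x y → (φ.obj x ⟶ φ.obj y)
  | _, _, .edge e => φ.map e
  | _, _, .comp p q => eval φ p ≫ eval φ q

/-- The type of `2`-cells `φ_dom → φ_codom` for a parallel pair of bracketed walks. -/
abbrev Cell (φ : V ⥤q B) (c : ParBPath V) : Type w := eval φ c.dom ⟶ eval φ c.codom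

theorem eval_comp (π : W ⥤q V) (φ : V ⥤q B) {x y : W} (p : BPath x y) :
    eval (π ⋙q φ) p = eval φ (p.map π) := by
  induction p with
  | edge e => rfl
  | comp p q hp hq => simp only [eval, BPath.map, hp, hq]; rfl

theorem cell_comp (π : W ⥤q V) (φ : V ⥤q B) (c : ParBPath W) :
    Cell (π ⋙q φ) c = Cell φ (c.map π) := by
  unfold Cell
  rw [eval_comp, eval_comp]
  rfl

/-- The `2`-cell `b(1, …, 1, α, 1, …, 1)`: the iterated horizontal composite of `α` with the identity
`2`-cells of the other edges.  (Whiskering with `f` is horizontal composition with `1_f`, and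
the horizontal composite of identity `2`-cells is an identity `2`-cell.) -/
def whisker (φ : V ⥤q B) {s t : V} {P Q : BPath s t} (α : eval φ P ⟶ eval φ Q) :
    ∀ {x y : V} (c : Context s t x y), eval φ (c.fill P) ⟶ eval φ (c.fill Q)
  | _, _, .hole => α
  | _, _, .left p c => Bicategory.whiskerLeft (eval φ p) (whisker φ α c)
  | _, _, .right c p => Bicategory.whiskerRight (whisker φ α c) (eval φ p)

/-- The component of the associator, or of its inverse, that rebrackets a composite. -/
def Rebracket.cell (φ : V ⥤q B) : ∀ {c : ParBPath V}, Rebracket c → Cell φ c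
  | _, .assoc E₁ E₂ E₃ => (Bicategory.associator (eval φ E₁) (eval φ E₂) (eval φ E₃)).hom
  | _, .assocInv E₁ E₂ E₃ => (Bicategory.associator (eval φ E₁) (eval φ E₂) (eval φ E₃)).inv

/-- A `G`-diagram in `B`: objects for the vertices, `1`-cells for the edges, and a
`2`-cell `φ_F : φ_{dom_F} → φ_{codom_F}` for each interior face `F`. -/
structure Diagram (G : BracketedGraph) (B : Type u) [Bicategory.{w, v} B] where
  skeleton : G.V ⥤q B
  cell : ∀ F, Cell skeleton (G.bface F)

/-- The constituent `2`-cell of a diagram on a consistent graph. -/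
def Consistent.cell {G : BracketedGraph} (c : Consistent G) (φ : Diagram G B) :
    Cell φ.skeleton G.bext :=
  cast (by simp only [Cell, BracketedGraph.bext, c.dom_eq, c.codom_eq]; rfl)
    (whisker φ.skeleton (φ.cell c.F) c.ctx)

/-- The restriction of a diagram along a morphism of graphs, given a compatible map of
interior faces.  The `2`-cells are unchanged; `cast` only rewrites their boundaries. -/
def Diagram.restrict {G K : BracketedGraph} (φ : Diagram K B) (i : G.V ⥤q K.V)
    (f : G.InteriorFace → K.InteriorFace) (hf : ∀ F, K.bface (f F) = (G.bface F).map i) :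
    Diagram G B where
  skeleton := i ⋙q φ.skeleton
  cell F := cast (by rw [cell_comp, hf]) (φ.cell (f F))

/-- The composite `φ_{Gₙ} ⋯ φ_{G₁}` of a composition diagram with respect to a composition scheme
presentation `Gₙ ⋯ G₁`. -/
def CompositionScheme.composite :
    ∀ {K : BracketedGraph}, CompositionScheme K → ∀ φ : Diagram K B, Cell φ.skeleton K.bext
  | _, .single c, φ => c.cell φ
  | K, .vcomp S c v, φ =>
    let α : Cell φ.skeleton ⟨K.ext.src, K.ext.snk, K.extDom.1, v.bmid⟩ :=
      cast ((cell_comp _ _ _).trans (congrArg _ v.bext_left))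
        (S.composite (φ.restrict v.inl (fun F => v.faces (.inl F)) v.bface_left))
    let β : Cell φ.skeleton ⟨K.ext.src, K.ext.snk, v.bmid, K.extCodom.1⟩ :=
      cast ((cell_comp _ _ _).trans (congrArg _ v.bext_right))
        (c.cell (φ.restrict v.inr (fun F => v.faces (.inr F)) v.bface_right))
    α ≫ β

namespace CompositionSchemeExtension

variable {G : BracketedGraph} (X : CompositionSchemeExtension G)

/-- Collapsing turns the two sides of the interior face of an associativity graph in `X.A`
into the two sides of one step of rebracketing. -/
theorem nonempty_rebracket {F : X.H.InteriorFace} (hF : F ∈ X.A) :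
    Nonempty (Rebracket ((X.H.bface F).map X.π)) := by
  refine BicatPasting.nonempty_rebracket (X.isAssociativity F hF) X.π fun k e e' he he' => ?_
  refine (X.edge_eq_iff e e').2 (.rel _ _ ⟨F, hF, k, ?_, ?_⟩)
  · simpa [BracketedGraph.bface, (X.H.faceDom F).2] using he
  · simpa [BracketedGraph.bface, (X.H.faceCodom F).2] using he'

open Classical in
/-- The composition diagram `φ_H` on a composition scheme extension `H` of `G` that is determined
by a `G`-diagram `φ`.  Vertices and edges take the values of `φ` on their images under the collapse;
an interior face of `G` keeps its `2`-cell; and the face of an inserted associativity graph is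
sent to a component of the associator or of its inverse. -/
noncomputable def extend (φ : Diagram G B) : Diagram X.H B where
  skeleton := X.π ⋙q φ.skeleton
  cell F :=
    if hF : F ∈ X.A then
      cast (cell_comp _ _ _).symm ((X.nonempty_rebracket hF).some.cell φ.skeleton)
    else
      cast (by rw [cell_comp, X.bface_eq ⟨F, hF⟩]) (φ.cell (X.faces ⟨F, hF⟩))

/-- The composite `|φ| : φ_{dom_G} → φ_{codom_G}` of a pasting diagram `φ` of shape `G` with respect
to a composition scheme extension of `G`. -/
noncomputable def composite (φ : Diagram G B) : Cell φ.skeleton G.bext :=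
  cast ((cell_comp _ _ _).trans (congrArg _ X.bext_eq)) (X.scheme.composite (X.extend φ))

end CompositionSchemeExtension

end Diagrams

end BicatPasting

/-!
Every pasting diagram in a bicategory has exactly one composite.

*Uniqueness.* By the coherence theorem for bicategories (the local thinness of the free
bicategory), there is exactly one coherence cell between any two bracketings of a composite of
`1`-cells. Hence the composite with respect to a composition scheme extension is a vertical
composite of whiskered face cells, glued by coherence cells, and it uses each interior face of `G`
exactly once (`CompositionSchemeExtension.isCompositeCell`); the associators on the collapsed
faces have been absorbed by the coherence cells. If two faces can be applied to the same walk,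
then their domains have no common edge, so that the two segments do not overlap and the
interchange law applies (`whisk_interchange`). This allows any face whose domain is part of the
first walk to be moved to the front (`CellFamily.IsComposite.exists_front`), and by induction
composites of the same faces in two different orders are equal (`CellFamily.IsComposite.unique`).

*Existence.* A pasting scheme presentation lists the interior faces in an order in which they
sweep the graph: the domain of `G` is transformed into its codomain by successively replacing the
domain of a face by its codomain (`HasPastingSchemePresentation.exists_sweep`). Since any two
bracketings of a walk are related by elementary steps of rebracketing (`reflTransGen_rebrackets`),
the sweep can be refined to a sequence of bracketed walks, in which consecutive walks differ
either by a face of `G` or by one associator, inside a context (`Sweep.exists_bracketedSweep`).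

It remains to realize this sequence as a composition scheme, that is, as a plane graph. The
vertices and edges that each step produces are replaced by fresh copies
(`BracketedSweep.exists_rowSequence`). A sweep also provides a real function on the vertices that
increases along each edge (`Sweep.exists_increasing`). With this function as horizontal
coordinate, each walk is drawn as the graph of a continuous function; the walk after a step is
drawn below the walk before it over the interior of the replaced segment, and agrees with it
elsewhere (`Layout.height`). Therefore the bounded components of the complement are the regions
between consecutive walks (`Layout.complement_eq`), which correspond to the steps, and the drawing
is a bracketed graph (`Layout.toBracketedGraph`). Sequences with a single step give consistent
graphs, and the concatenation of sequences gives vertical composites, so that the whole sequence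
gives a composition scheme (`RowSequence.exists_compositionScheme`). Forgetting which copy a
vertex or an edge is amounts to collapsing the associativity faces, and returns `G`
(`BracketedSweep.exists_extension`).
-/

namespace BicatPasting

/-! ### Coherence cells -/

section Coherence

universe w v u
open Bicategory
open FreeBicategory (Hom₂ normalizeAux inclusionPathAux)

variable {B : Type u} [Bicategory.{w, v} B] {V : Type} [Quiver.{0} V]

/-- A formal composite of edges: a bracketed walk that may also contain identities. -/
def Word (a b : V) : Type := FreeBicategory.Hom a b

namespace Word

/-- A single edge as a formal composite. -/
def edge {a b : V} (e : a ⟶ b) : Word a b := FreeBicategory.Hom.of e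

/-- The empty formal composite. -/
def id (a : V) : Word a a := FreeBicategory.Hom.id a

/-- Formal composition. -/
def comp {a b c : V} (X : Word a b) (Y : Word b c) : Word a c := FreeBicategory.Hom.comp X Y

/-- The directed walk that underlies a formal composite of edges. -/
def path {a b : V} (X : Word a b) : Quiver.Path a b := normalizeAux .nil X

/-- A directed walk as a formal composite. -/
def ofPath {a b : V} (p : Quiver.Path a b) : Word a b := inclusionPathAux p

/-- The value of a formal composite in a bicategory. -/
def ev (φ : V ⥤q B) {a b : V} (X : Word a b) : φ.obj a ⟶ φ.obj b := FreeBicategory.liftHom φ X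

@[simp] theorem path_comp {a b c : V} (X : Word a b) (Y : Word b c) :
    (X.comp Y).path = X.path.comp Y.path := FreeBicategory.normalizeAux_nil_comp X Y

@[simp] theorem path_id (a : V) : (id a).path = .nil := rfl

@[simp] theorem path_edge {a b : V} (e : a ⟶ b) : (edge e).path = e.toPath :=
  rfl

@[simp] theorem path_ofPath {a b : V} (p : Quiver.Path a b) : (ofPath p).path = p := by
  induction p with
  | nil => rfl
  | cons p e ih =>
    change ((normalizeAux .nil (inclusionPathAux p)).cons e) = _
    exact congrArg (fun q => Quiver.Path.cons q e) ih

end Word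

open Word

variable {a b c d : V}

/-- Both formal composites normalize to the same walk, so that there is a formal coherence cell
between them. -/
theorem nonempty_coherence (X Y : Word a b) (h : X.path = Y.path) :
    Nonempty (Hom₂ X Y) := by
  let I := FreeBicategory.homCategory (B := V) a b
  have f : I.Hom X Y := (FreeBicategory.normalizeEquiv a b).functor.preimage
    (eqToHom (Discrete.ext h))
  exact ⟨(Quot.exists_rep f).choose⟩

/-- The coherence `2`-cell between the values of two formal composites with the same underlying
walk. -/
noncomputable def coh (φ : V ⥤q B) (X Y : Word a b) (h : X.path = Y.path) :
    X.ev φ ⟶ Y.ev φ :=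
  FreeBicategory.liftHom₂ φ (nonempty_coherence X Y h).some

/-- By the coherence theorem, each formal coherence `2`-cell evaluates to the canonical one. -/
theorem coh_eq (φ : V ⥤q B) {X Y : Word a b} (h : X.path = Y.path) (η : Hom₂ X Y) :
    coh φ X Y h = FreeBicategory.liftHom₂ φ η :=
  congrArg ((FreeBicategory.lift φ).map₂ (f := X) (g := Y))
    ((FreeBicategory.locally_thin (B := V) (a := a) (b := b) X Y).elim
      (Hom₂.mk (nonempty_coherence X Y h).some) (Hom₂.mk η))

@[simp] theorem coh_self (φ : V ⥤q B) (X : Word a b) (h : X.path = X.path) :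
    coh φ X X h = 𝟙 _ :=
  coh_eq φ h (.id X)

@[simp] theorem coh_comp (φ : V ⥤q B) (X Y Z : Word a b) (h : X.path = Y.path)
    (h' : Y.path = Z.path) : coh φ X Y h ≫ coh φ Y Z h' = coh φ X Z (h.trans h') :=
  (coh_eq φ (h.trans h')
    (.vcomp (nonempty_coherence X Y h).some (nonempty_coherence Y Z h').some)).symm

@[simp] theorem coh_comp_assoc (φ : V ⥤q B) (X Y Z : Word a b) (h : X.path = Y.path)
    (h' : Y.path = Z.path) {f : φ.obj a ⟶ φ.obj b} (α : Z.ev φ ⟶ f) :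
    coh φ X Y h ≫ coh φ Y Z h' ≫ α = coh φ X Z (h.trans h') ≫ α := by
  rw [← Category.assoc, coh_comp]

/-! ### Whiskered cells and interchange -/

/-- The `2`-cell `α`, whiskered on both sides by formal composites. -/
noncomputable def whisk (φ : V ⥤q B) {s t : V} (l : Word s a) (r : Word b t)
    {D E : Word a b} (α : D.ev φ ⟶ E.ev φ) :
    (l.comp (D.comp r)).ev φ ⟶ (l.comp (E.comp r)).ev φ :=
  l.ev φ ◁ (α ▷ r.ev φ)

theorem whiskerLeft_whiskerRight_conj {x y z t : B} {l l' : x ⟶ y} {D E : y ⟶ z} {r r' : z ⟶ t}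
    (u : l ⟶ l') (u' : l' ⟶ l) (v : r ⟶ r') (v' : r' ⟶ r) (hu : u ≫ u' = 𝟙 _) (hv : v ≫ v' = 𝟙 _)
    (α : D ⟶ E) : l ◁ (α ▷ r) =
      (u ▷ (D ≫ r) ≫ l' ◁ D ◁ v) ≫ l' ◁ (α ▷ r') ≫ (l' ◁ E ◁ v' ≫ u' ▷ (E ≫ r)) := by
  have h : D ◁ v ≫ α ▷ r' ≫ E ◁ v' = α ▷ r := by
    rw [whisker_exchange_assoc, ← whiskerLeft_comp, hv, whiskerLeft_id, Category.comp_id]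
  simp only [Category.assoc]
  rw [← whiskerLeft_comp_assoc, ← whiskerLeft_comp_assoc, Category.assoc, h,
    whisker_exchange, ← comp_whiskerRight_assoc, hu]
  simp

/-- Whiskering only depends on the walks that underlie the two sides. -/
theorem whisk_congr (φ : V ⥤q B) {s t : V} {l l' : Word s a} {r r' : Word b t}
    (hl : l.path = l'.path) (hr : r.path = r'.path)
    {D E : Word a b} (α : D.ev φ ⟶ E.ev φ) :
    whisk φ l r α = coh φ _ (l'.comp (D.comp r')) (by simp [hl, hr]) ≫ whisk φ l' r' α ≫
      coh φ _ _ (by simp [hl, hr]) := by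
  have e₁ := coh_eq φ (X := l.comp (D.comp r)) (Y := l'.comp (D.comp r')) (by simp [hl, hr])
    (.vcomp (.whisker_right _ (nonempty_coherence l l' hl).some)
      (.whisker_left _ (.whisker_left _ (nonempty_coherence r r' hr).some)))
  have e₂ := coh_eq φ (X := l'.comp (E.comp r')) (Y := l.comp (E.comp r)) (by simp [hl, hr])
    (.vcomp (.whisker_left _ (.whisker_left _ (nonempty_coherence r' r hr.symm).some))
      (.whisker_right _ (nonempty_coherence l' l hl.symm).some))
  rw [e₁, e₂]
  exact whiskerLeft_whiskerRight_conj (coh φ l l' hl) (coh φ l' l hl.symm) (coh φ r r' hr)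
    (coh φ r' r hr.symm) (by simp) (by simp) α

/-- The interchange law with the associators that `whisk_interchange` needs spelled out. -/
theorem whiskerRight_interchange {s x y z w t : B} (l : s ⟶ x) {D E : x ⟶ y} (m : y ⟶ z)
    {D' E' : z ⟶ w} (r : w ⟶ t) (α : D ⟶ E) (β : D' ⟶ E') :
    l ◁ (α ▷ (m ≫ D' ≫ r)) ≫ (l ◁ (α_ _ _ _).inv ≫ (α_ _ _ _).inv) ≫
        (l ≫ E ≫ m) ◁ (β ▷ r) =
      (l ◁ (α_ _ _ _).inv ≫ (α_ _ _ _).inv) ≫ (l ≫ D ≫ m) ◁ (β ▷ r) ≫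
        ((α_ _ _ _).hom ≫ l ◁ (α_ _ _ _).hom) ≫ l ◁ (α ▷ (m ≫ E' ≫ r)) ≫
        (l ◁ (α_ _ _ _).inv ≫ (α_ _ _ _).inv) := by
  have key : α ▷ (m ≫ D' ≫ r) ≫ E ◁ (m ◁ (β ▷ r)) = D ◁ (m ◁ (β ▷ r)) ≫ α ▷ (m ≫ E' ≫ r) :=
    (whisker_exchange _ _).symm
  have hc : ∀ X : x ⟶ y, (l ≫ X ≫ m) ◁ (β ▷ r) = ((α_ _ _ _).hom ≫ l ◁ (α_ _ _ _).hom) ≫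
      l ◁ (X ◁ (m ◁ (β ▷ r))) ≫ (l ◁ (α_ _ _ _).inv ≫ (α_ _ _ _).inv) := fun X => by
    simp only [comp_whiskerLeft, whiskerLeft_comp, Category.assoc]
  rw [hc, hc]
  simp only [Category.assoc, Iso.inv_hom_id_assoc, whiskerLeft_inv_hom_assoc]
  rw [← whiskerLeft_comp_assoc, key, whiskerLeft_comp_assoc]

/-- The interchange law for two cells that apply to disjoint segments of a walk, up to coherence
cells. -/
theorem whisk_interchange (φ : V ⥤q B) {s t : V} (l : Word s a) (m : Word b c) (r : Word d t)
    {D E : Word a b} {D' E' : Word c d} (α : D.ev φ ⟶ E.ev φ) (β : D'.ev φ ⟶ E'.ev φ) :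
    whisk φ l (m.comp (D'.comp r)) α ≫ coh φ _ ((l.comp (E.comp m)).comp (D'.comp r)) (by simp) ≫
      whisk φ (l.comp (E.comp m)) r β =
    coh φ _ ((l.comp (D.comp m)).comp (D'.comp r)) (by simp) ≫ whisk φ (l.comp (D.comp m)) r β ≫
      coh φ _ (l.comp (D.comp (m.comp (E'.comp r)))) (by simp) ≫
      whisk φ l (m.comp (E'.comp r)) α ≫ coh φ _ _ (by simp) := by
  rw [coh_eq φ (X := l.comp (E.comp (m.comp (D'.comp r))))
      (Y := (l.comp (E.comp m)).comp (D'.comp r))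
      (by simp) (.vcomp (.whisker_left _ (.associator_inv _ _ _)) (.associator_inv _ _ _)),
    coh_eq φ (X := l.comp (D.comp (m.comp (D'.comp r)))) (Y := (l.comp (D.comp m)).comp (D'.comp r))
      (by simp) (.vcomp (.whisker_left _ (.associator_inv _ _ _)) (.associator_inv _ _ _)),
    coh_eq φ (X := l.comp (E.comp (m.comp (E'.comp r)))) (Y := (l.comp (E.comp m)).comp (E'.comp r))
      (by simp) (.vcomp (.whisker_left _ (.associator_inv _ _ _)) (.associator_inv _ _ _)),
    coh_eq φ (Y := l.comp (D.comp (m.comp (E'.comp r)))) (X := (l.comp (D.comp m)).comp (E'.comp r))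
      (by simp) (.vcomp (.associator _ _ _) (.whisker_left _ (.associator _ _ _)))]
  exact whiskerRight_interchange (l.ev φ) (m.ev φ) (r.ev φ) α β

end Coherence

/-! ### Segments of directed walks -/

section Paths

universe v u
variable {V : Type u} [Quiver.{v} V]

@[simp] theorem pathEdges_nil (a : V) : pathEdges (.nil : Quiver.Path a a) = [] := rfl

@[simp] theorem length_pathEdges {a b : V} (p : Quiver.Path a b) :
    (pathEdges p).length = p.length := by
  induction p with
  | nil => rfl
  | cons p e ih => simp [pathEdges, ih]

theorem pathEdges_ne_nil {a b : V} {p : Quiver.Path a b} (h : 0 < p.length) : pathEdges p ≠ [] := by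
  rw [← List.length_pos_iff, length_pathEdges]; exact h

/-- Two factorizations of the same walk: the shorter first factor is an initial segment of the
longer one. -/
theorem exists_eq_comp_of_comp_eq_comp {s t a a' : V} (l : Quiver.Path s a) (l' : Quiver.Path s a')
    (x : Quiver.Path a t) (y : Quiver.Path a' t) (h : l.comp x = l'.comp y)
    (hl : l.length ≤ l'.length) : ∃ m : Quiver.Path a a', l' = l.comp m ∧ x = m.comp y := by
  induction y with
  | nil => exact ⟨x, h.symm, rfl⟩
  | cons y e ih =>
    cases x with
    | nil =>
      have := congrArg Quiver.Path.length h
      simp at this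
      omega
    | cons x e' =>
      simp only [Quiver.Path.comp_cons] at h
      obtain rfl := Quiver.Path.obj_eq_of_cons_eq_cons h
      obtain ⟨m, h₁, h₂⟩ := ih x (eq_of_heq (Quiver.Path.heq_of_cons_eq_cons h))
      refine ⟨m, h₁, ?_⟩
      rw [h₂, eq_of_heq (Quiver.Path.hom_heq_of_cons_eq_cons h)]
      rfl

/-- Segments of a walk that have no common edge do not overlap: one lies before the other. -/
theorem comp_eq_comp_cases {s t a b a' b' : V} {l : Quiver.Path s a} {d : Quiver.Path a b}
    {r : Quiver.Path b t} {l' : Quiver.Path s a'} {d' : Quiver.Path a' b'} {r' : Quiver.Path b' t}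
    (h : l.comp (d.comp r) = l'.comp (d'.comp r')) (hd : 0 < d.length) (hd' : 0 < d'.length)
    (hdis : ∀ e ∈ pathEdges d, e ∉ pathEdges d') :
    (∃ m : Quiver.Path b a', l' = l.comp (d.comp m) ∧ r = m.comp (d'.comp r')) ∨
      (∃ m : Quiver.Path b' a, l = l'.comp (d'.comp m) ∧ r' = m.comp (d.comp r)) := by
  have key : ∀ {s t a b a' b' : V} {l : Quiver.Path s a} {d : Quiver.Path a b}
      {r : Quiver.Path b t} {l' : Quiver.Path s a'} {d' : Quiver.Path a' b'} {r' : Quiver.Path b' t}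
      (_ : l.comp (d.comp r) = l'.comp (d'.comp r')) (_ : 0 < d'.length)
      (_ : ∀ e ∈ pathEdges d, e ∉ pathEdges d') (_ : l.length ≤ l'.length),
      (∃ m : Quiver.Path b a', l' = l.comp (d.comp m) ∧ r = m.comp (d'.comp r')) := by
    intro s t a b a' b' l d r l' d' r' h hd' hdis hl
    obtain ⟨m, rfl, hm⟩ := exists_eq_comp_of_comp_eq_comp _ _ _ _ h hl
    rcases le_or_gt d.length m.length with hlen | hlen
    · obtain ⟨m', rfl, hm'⟩ := exists_eq_comp_of_comp_eq_comp _ _ _ _ hm hlen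
      exact ⟨m', rfl, hm'⟩
    · exfalso
      obtain ⟨k, rfl, hk⟩ := exists_eq_comp_of_comp_eq_comp _ _ _ _ hm.symm hlen.le
      have hk0 : pathEdges k ≠ [] := pathEdges_ne_nil (by
        rw [Quiver.Path.length_comp] at hlen; omega)
      have h1 := congrArg pathEdges hk
      rw [pathEdges_comp, pathEdges_comp] at h1
      obtain ⟨e, E, hE⟩ := List.exists_cons_of_ne_nil hk0
      obtain ⟨e', E', hE'⟩ := List.exists_cons_of_ne_nil (pathEdges_ne_nil hd')
      rw [hE, hE'] at h1
      simp only [List.cons_append, List.cons.injEq] at h1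
      refine hdis e ?_ ?_
      · rw [pathEdges_comp, hE]; simp
      · rw [hE', ← h1.1]; simp
  rcases le_total l.length l'.length with hl | hl
  · exact Or.inl (key h hd' hdis hl)
  · exact Or.inr (key h.symm hd (fun e he he' => hdis e he' he) hl)

/-- A non-trivial segment of a walk without repeated edges occurs only once in it. -/
theorem comp_eq_comp_unique {s t a b : V} {l l' : Quiver.Path s a} {d : Quiver.Path a b}
    {r r' : Quiver.Path b t} (h : l.comp (d.comp r) = l'.comp (d.comp r')) (hd : 0 < d.length)
    (hn : (pathEdges (l.comp (d.comp r))).Nodup) : l = l' ∧ r = r' := by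
  have key : ∀ {l l' : Quiver.Path s a} {r r' : Quiver.Path b t}
      (_ : l.comp (d.comp r) = l'.comp (d.comp r')) (_ : (pathEdges (l.comp (d.comp r))).Nodup)
      (_ : l.length ≤ l'.length), l'.length ≤ l.length := by
    intro l l' r r' h hn hl
    obtain ⟨m, rfl, hm⟩ := exists_eq_comp_of_comp_eq_comp _ _ _ _ h hl
    by_contra hlt
    have hm0 : pathEdges m ≠ [] := pathEdges_ne_nil (by
      rw [Quiver.Path.length_comp] at hlt; omega)
    obtain ⟨e', E', hE'⟩ := List.exists_cons_of_ne_nil (pathEdges_ne_nil hd)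
    obtain ⟨e, E, hE⟩ := List.exists_cons_of_ne_nil hm0
    have h1 := congrArg pathEdges hm
    simp only [pathEdges_comp, hE, hE', List.cons_append, List.cons.injEq] at h1
    rw [h] at hn
    simp only [pathEdges_comp, hE, hE', h1.1] at hn
    simp only [List.nodup_append, List.cons_append] at hn
    exact hn.2.2 e (by simp) e (by simp) rfl
  have hlen : l.length = l'.length := by
    rcases le_total l.length l'.length with hl | hl
    · exact le_antisymm hl (key h hn hl)
    · exact le_antisymm (key h.symm (h ▸ hn) hl) hl
  have h' := (Quiver.Path.comp_inj' hlen).1 h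
  exact ⟨h'.1, ((Quiver.Path.comp_inj' rfl).1 h'.2).2⟩

end Paths

/-! ### Composites of whiskered cells -/

section Uniqueness

universe w v u
open Bicategory

variable {B : Type u} [Bicategory.{w, v} B] {V : Type} [Quiver.{0} V] {I : Type*}

/-- A family of `2`-cells between values of formal composites. -/
structure CellFamily (φ : V ⥤q B) (I : Type*) where
  src : I → V
  snk : I → V
  dom : ∀ i, Word (src i) (snk i)
  cod : ∀ i, Word (src i) (snk i)
  cell : ∀ i, (dom i).ev φ ⟶ (cod i).ev φ

/-- `C.IsComposite L X Y α`: the `2`-cell `α` is a vertical composite of whiskered members of the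
family, in the order of the list `L`, and of coherence cells between them. -/
inductive CellFamily.IsComposite {φ : V ⥤q B} (C : CellFamily φ I) {s t : V} :
    List I → ∀ X Y : Word s t, (X.ev φ ⟶ Y.ev φ) → Prop
  | nil (X Y : Word s t) (h : X.path = Y.path) : IsComposite C [] X Y (coh φ X Y h)
  | cons (i : I) (L : List I) (X Y : Word s t) (l : Word s (C.src i)) (r : Word (C.snk i) t)
      (h : X.path = (l.comp ((C.dom i).comp r)).path) (β) :
      IsComposite C L (l.comp ((C.cod i).comp r)) Y β →
      IsComposite C (i :: L) X Y (coh φ X _ h ≫ whisk φ l r (C.cell i) ≫ β)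

namespace CellFamily

variable {φ : V ⥤q B} {C : CellFamily φ I} {s t : V}

theorem IsComposite.coh_comp {L : List I} {X Y : Word s t} {α} (h : C.IsComposite L X Y α)
    (X' : Word s t) (hX : X'.path = X.path) : C.IsComposite L X' Y (coh φ X' X hX ≫ α) := by
  cases h with
  | nil _ _ h => rw [BicatPasting.coh_comp]; exact .nil _ _ _
  | cons i L _ _ l r h β hβ => rw [coh_comp_assoc]; exact .cons i L _ _ l r _ β hβ

theorem IsComposite.trans {L L' : List I} {X Y Z : Word s t} {α β} (h : C.IsComposite L X Y α)
    (h' : C.IsComposite L' Y Z β) : C.IsComposite (L ++ L') X Z (α ≫ β) := by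
  induction h with
  | nil _ _ h => exact h'.coh_comp _ _
  | cons i L _ _ l r h γ _ ih =>
    simp only [Category.assoc]
    exact .cons i _ _ _ l r h _ (ih h')

/-- The members of the list `L` may be applied to the walk `p`, each at most once, and no edge is
ever produced twice. -/
structure Compatible (C : CellFamily φ I) (L : List I) (p : Quiver.Path s t) : Prop where
  nodup : (pathEdges p).Nodup
  list_nodup : L.Nodup
  cod_nodup : ∀ i ∈ L, (pathEdges (C.cod i).path).Nodup
  cod_disjoint : ∀ i ∈ L, ∀ e ∈ pathEdges (C.cod i).path, e ∉ pathEdges p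
  cod_cod : ∀ i ∈ L, ∀ j ∈ L, i ≠ j → ∀ e ∈ pathEdges (C.cod i).path, e ∉ pathEdges (C.cod j).path

/-- After a member has been applied to the walk, the other members are still compatible. -/
theorem Compatible.erase {L : List I} [DecidableEq I] {p : Quiver.Path s t} {i : I} (hi : i ∈ L)
    {l : Quiver.Path s (C.src i)} {r : Quiver.Path (C.snk i) t}
    (h : C.Compatible L p) (hp : p = l.comp ((C.dom i).path.comp r)) :
    C.Compatible (L.erase i) (l.comp ((C.cod i).path.comp r)) := by
  have hmem : ∀ {j}, j ∈ L.erase i → j ≠ i ∧ j ∈ L := fun {j} hj =>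
    (h.list_nodup.mem_erase_iff).1 hj
  refine ⟨?_, h.list_nodup.erase i, fun j hj => h.cod_nodup j (hmem hj).2, fun j hj e he he' => ?_,
    fun j hj k hk => h.cod_cod j (hmem hj).2 k (hmem hk).2⟩
  · have h₁ := h.nodup
    have h₂ := h.cod_nodup i hi
    have h₃ := h.cod_disjoint i hi
    subst hp
    simp only [pathEdges_comp, List.nodup_append, List.mem_append] at h₁ h₃ ⊢
    grind
  · have h₁ := h.cod_disjoint j (hmem hj).2 e he
    have h₂ := h.cod_cod j (hmem hj).2 i hi (hmem hj).1 e he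
    subst hp
    simp only [pathEdges_comp, List.mem_append] at h₁ he'
    grind

/-- If the first boundary contains the domain of a member `i` of the list, then `i` can be moved to
the front. -/
theorem IsComposite.exists_front [DecidableEq I] (hpos : ∀ i, 0 < (C.dom i).path.length)
    (hdis : ∀ i j, i ≠ j → ∀ e ∈ pathEdges (C.dom i).path, e ∉ pathEdges (C.dom j).path)
    {L : List I} {X Y : Word s t} {α} (h : C.IsComposite L X Y α) (hc : C.Compatible L X.path)
    {i : I} (hi : i ∈ L) (l : Word s (C.src i)) (r : Word (C.snk i) t)
    (hX : X.path = (l.comp ((C.dom i).comp r)).path) :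
    ∃ β, C.IsComposite (L.erase i) (l.comp ((C.cod i).comp r)) Y β ∧
      α = coh φ X _ hX ≫ whisk φ l r (C.cell i) ≫ β := by
  induction h generalizing l r with
  | nil => simp at hi
  | cons j L X Y l' r' h γ hγ ih =>
    have h' := h
    rw [hX] at h
    simp only [Word.path_comp] at h hX h'
    by_cases hij : j = i
    · subst hij
      obtain ⟨hl, hr⟩ := comp_eq_comp_unique h (hpos j) (hX ▸ hc.nodup)
      refine ⟨coh φ _ _ (by simp [hl, hr]) ≫ γ, ?_, ?_⟩
      · simpa using hγ.coh_comp _ _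
      · rw [whisk_congr φ hl.symm hr.symm]
        simp
    · have hmem : i ∈ L := by simpa [Ne.symm hij] using hi
      have hc' := hc.erase (i := j) (by simp) h'
      simp only [List.erase_cons_head] at hc'
      have her : (j :: L).erase i = j :: L.erase i := by simp [hij]
      rw [her]
      rcases comp_eq_comp_cases h (hpos i) (hpos j) (hdis i j (Ne.symm hij)) with
        ⟨m, h₁, h₂⟩ | ⟨m, h₁, h₂⟩
      · -- `i` lies to the left of `j`
        obtain ⟨β, hβ, rfl⟩ := ih (by simpa using hc') hmem l
          ((Word.ofPath m).comp ((C.cod j).comp r')) (by simp [h₁])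
        have hI := whisk_interchange φ l (Word.ofPath m) r' (C.cell i) (C.cell j)
        refine ⟨_, .cons j _ _ _ (l.comp ((C.cod i).comp (Word.ofPath m))) r' (by simp [h₂])
          (coh φ _ _ (by simp) ≫ β) (hβ.coh_comp _ _), ?_⟩
        rw [whisk_congr φ (l := l') (l' := l.comp ((C.dom i).comp (Word.ofPath m))) (by simp [h₁])
          (rfl : r'.path = r'.path),
          whisk_congr φ (l := l) (l' := l) (r := r) (r' := (Word.ofPath m).comp ((C.dom j).comp r'))
          rfl (by simp [h₂])]
        simp only [Category.assoc, coh_comp_assoc]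
        have hI' := congrArg (fun x => coh φ X _ (by simp [hX, h₂]) ≫ x ≫
          coh φ _ (l.comp ((C.cod i).comp ((Word.ofPath m).comp ((C.cod j).comp r'))))
            (by simp) ≫ β) hI
        simp only [Category.assoc, coh_comp_assoc, coh_self, Category.id_comp] at hI'
        exact hI'.symm
      · -- `i` lies to the right of `j`
        obtain ⟨β, hβ, rfl⟩ := ih (by simpa using hc') hmem
          (l'.comp ((C.cod j).comp (Word.ofPath m))) r (by simp [h₂])
        have hI := whisk_interchange φ l' (Word.ofPath m) r (C.cell j) (C.cell i)
        refine ⟨_, .cons j _ _ _ l' ((Word.ofPath m).comp ((C.cod i).comp r)) (by simp [h₁])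
          (coh φ _ _ (by simp) ≫ β) (hβ.coh_comp _ _), ?_⟩
        rw [whisk_congr φ (l := l) (l' := l'.comp ((C.dom j).comp (Word.ofPath m))) (by simp [h₁])
          (rfl : r.path = r.path),
          whisk_congr φ (l := l') (l' := l') (r := r')
          (r' := (Word.ofPath m).comp ((C.dom i).comp r)) rfl (by simp [h₂])]
        simp only [Category.assoc, coh_comp_assoc]
        have hI' := congrArg (fun x => coh φ X _ (by simp [h', h₂]) ≫ x ≫ β) hI
        simp only [Category.assoc, coh_comp_assoc] at hI'
        exact hI'

/-- Composites of the same members in different orders are equal. -/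
theorem IsComposite.unique (hpos : ∀ i, 0 < (C.dom i).path.length)
    (hdis : ∀ i j, i ≠ j → ∀ e ∈ pathEdges (C.dom i).path, e ∉ pathEdges (C.dom j).path)
    {L L' : List I} {X Y : Word s t} {α α'} (h : C.IsComposite L X Y α)
    (h' : C.IsComposite L' X Y α') (hc : C.Compatible L X.path) (hL : L.Perm L') : α = α' := by
  classical
  induction h generalizing L' with
  | nil =>
    obtain rfl := hL.nil_eq
    cases h'
    rfl
  | cons i L X Y l r hX β hβ ih =>
    have hi : i ∈ L' := hL.subset (by simp)
    have hc' : C.Compatible L' X.path := by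
      have := fun j => hL.mem_iff (a := j)
      exact ⟨hc.nodup, hL.nodup_iff.1 hc.list_nodup, fun j hj => hc.cod_nodup j ((this j).2 hj),
        fun j hj => hc.cod_disjoint j ((this j).2 hj),
        fun j hj k hk => hc.cod_cod j ((this j).2 hj) k ((this k).2 hk)⟩
    obtain ⟨β', hβ', rfl⟩ := h'.exists_front hpos hdis hc' hi l r hX
    have hc₁ := hc.erase (i := i) (by simp) (by simpa using hX)
    simp only [List.erase_cons_head] at hc₁
    rw [ih hβ' (by simpa using hc₁) (by simpa using hL.erase i)]

end CellFamily
end Uniqueness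

/-! ### Contexts under morphisms of graphs -/

section Maps

variable {V : Type*} [Quiver V] {W : Type*} [Quiver W]

/-- The directed walk to the left of the hole. -/
def Context.leftPath {s t : V} : ∀ {u v : V}, Context s t u v → Quiver.Path u s
  | _, _, hole => .nil
  | _, _, left p c => p.toPath.comp c.leftPath
  | _, _, right c _ => c.leftPath

/-- The directed walk to the right of the hole. -/
def Context.rightPath {s t : V} : ∀ {u v : V}, Context s t u v → Quiver.Path t v
  | _, _, hole => .nil
  | _, _, left _ c => c.rightPath
  | _, _, right c p => c.rightPath.comp p.toPath

theorem Context.toPath_fill {s t : V} (P : BPath s t) {u v : V} (c : Context s t u v) :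
    (c.fill P).toPath = c.leftPath.comp (P.toPath.comp c.rightPath) := by
  induction c with
  | hole => simp [fill, leftPath, rightPath]
  | left p c ih => simp [fill, leftPath, rightPath, BPath.toPath, ih]
  | right c p ih => simp [fill, leftPath, rightPath, BPath.toPath, ih]

/-- The image of a bracketed walk with a hole under a morphism of graphs. -/
def Context.map (π : V ⥤q W) {s t : V} : ∀ {u v : V}, Context s t u v →
    Context (π.obj s) (π.obj t) (π.obj u) (π.obj v)
  | _, _, hole => hole
  | _, _, left p c => left (p.map π) (c.map π)
  | _, _, right c p => right (c.map π) (p.map π)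

theorem Context.map_fill (π : V ⥤q W) {s t : V} (P : BPath s t) {u v : V} (c : Context s t u v) :
    (c.fill P).map π = (c.map π).fill (P.map π) := by
  induction c with
  | hole => rfl
  | left p c ih => simp [fill, map, BPath.map, ih]
  | right c p ih => simp [fill, map, BPath.map, ih]

theorem BPath.map_comp {U : Type*} [Quiver U] (π : V ⥤q W) (ρ : W ⥤q U) {u v : V}
    (p : BPath u v) : p.map (π ⋙q ρ) = (p.map π).map ρ := by
  induction p with
  | edge e => rfl
  | comp p q hp hq => simp only [BPath.map, hp, hq]; rfl

theorem ParBPath.map_comp {U : Type*} [Quiver U] (π : V ⥤q W) (ρ : W ⥤q U) (c : ParBPath V) :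
    c.map (π ⋙q ρ) = (c.map π).map ρ := by
  simp only [ParBPath.map, BPath.map_comp]; rfl

theorem BPath.toPath_map (π : V ⥤q W) {u v : V} (p : BPath u v) :
    (p.map π).toPath = π.mapPath p.toPath := by
  induction p with
  | edge e => rfl
  | comp p q hp hq => simp [BPath.map, BPath.toPath, hp, hq]

end Maps

/-! ### Cells with bracketed boundaries -/

section Composites

universe w v u
open Bicategory
open FreeBicategory (Hom₂)

variable {B : Type u} [Bicategory.{w, v} B] {V : Type} [Quiver.{0} V] {I : Type*}

/-- A bracketed walk as a formal composite. -/
def BPath.toWord : ∀ {a b : V}, BPath a b → Word a b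
  | _, _, edge e => .edge e
  | _, _, comp p q => p.toWord.comp q.toWord

@[simp] theorem BPath.path_toWord {a b : V} (p : BPath a b) : p.toWord.path = p.toPath := by
  induction p with
  | edge e => rfl
  | comp p q hp hq => simp [toWord, toPath, hp, hq]

theorem BPath.ev_toWord (φ : V ⥤q B) {a b : V} (p : BPath a b) :
    p.toWord.ev φ = eval φ p := by
  induction p with
  | edge e => rfl
  | comp p q hp hq => rw [eval, ← hp, ← hq]; rfl

/-- A `2`-cell between values of bracketed walks as a `2`-cell between values of formal
composites. -/
def evCell {φ : V ⥤q B} {a b : V} {p q : BPath a b} (α : eval φ p ⟶ eval φ q) :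
    p.toWord.ev φ ⟶ q.toWord.ev φ :=
  eqToHom (p.ev_toWord φ) ≫ α ≫ eqToHom (q.ev_toWord φ).symm

theorem evCell_injective {φ : V ⥤q B} {a b : V} {p q : BPath a b} {α β : eval φ p ⟶ eval φ q}
    (h : evCell α = evCell β) : α = β := by
  unfold evCell at h
  rwa [cancel_epi, cancel_mono] at h

theorem evCell_comp {φ : V ⥤q B} {a b : V} {p q r : BPath a b} (α : eval φ p ⟶ eval φ q)
    (β : eval φ q ⟶ eval φ r) : evCell (α ≫ β) = evCell α ≫ evCell β := by
  simp [evCell]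

theorem evCell_whiskerLeft {φ : V ⥤q B} {a b c : V} (x : BPath a b) {p q : BPath b c}
    (α : eval φ p ⟶ eval φ q) :
    evCell (p := x.comp p) (q := x.comp q) (eval φ x ◁ α) = x.toWord.ev φ ◁ evCell α := by
  have : ∀ {f f' : φ.obj a ⟶ φ.obj b} {g g' h h' : φ.obj b ⟶ φ.obj c} (hf : f' = f) (hg : g' = g)
      (hh : h' = h) (α : g ⟶ h) (h₁ : f' ≫ g' = f ≫ g) (h₂ : f ≫ h = f' ≫ h'),
      eqToHom h₁ ≫ f ◁ α ≫ eqToHom h₂ = f' ◁ (eqToHom hg ≫ α ≫ eqToHom hh.symm) := by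
    rintro f _ g _ h _ rfl rfl rfl α h₁ h₂
    simp
  exact this (x.ev_toWord φ) (p.ev_toWord φ) (q.ev_toWord φ) α _ _

theorem evCell_whiskerRight {φ : V ⥤q B} {a b c : V} {p q : BPath a b}
    (α : eval φ p ⟶ eval φ q) (x : BPath b c) :
    evCell (p := p.comp x) (q := q.comp x) (α ▷ eval φ x) = evCell α ▷ x.toWord.ev φ := by
  have : ∀ {f f' : φ.obj b ⟶ φ.obj c} {g g' h h' : φ.obj a ⟶ φ.obj b} (hf : f' = f) (hg : g' = g)
      (hh : h' = h) (α : g ⟶ h) (h₁ : g' ≫ f' = g ≫ f) (h₂ : h ≫ f = h' ≫ f'),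
      eqToHom h₁ ≫ α ▷ f ≫ eqToHom h₂ = (eqToHom hg ≫ α ≫ eqToHom hh.symm) ▷ f' := by
    rintro f _ g _ h _ rfl rfl rfl α h₁ h₂
    simp
  exact this (x.ev_toWord φ) (p.ev_toWord φ) (q.ev_toWord φ) α _ _

theorem whisk_coh (φ : V ⥤q B) {s t a b : V} (l : Word s a) (r : Word b t) (D E : Word a b)
    (h : D.path = E.path) :
    whisk φ l r (coh φ D E h) = coh φ (l.comp (D.comp r)) (l.comp (E.comp r)) (by simp [h]) :=
  (coh_eq φ (X := l.comp (D.comp r)) (Y := l.comp (E.comp r)) (by simp [h])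
    (.whisker_left _ (.whisker_right _ (nonempty_coherence D E h).some))).symm

theorem whiskerLeft_whisk (φ : V ⥤q B) {s t a b x : V} (X : Word x s) (l : Word s a) (r : Word b t)
    {D E : Word a b} (α : D.ev φ ⟶ E.ev φ) (Y Z : Word s t)
    (hY : Y.path = (l.comp (D.comp r)).path) (hZ : (l.comp (E.comp r)).path = Z.path) :
    X.ev φ ◁ (coh φ _ _ hY ≫ whisk φ l r α ≫ coh φ _ _ hZ) =
      coh φ (X.comp Y) ((X.comp l).comp (D.comp r)) (by simp [hY]) ≫
        whisk φ (X.comp l) r α ≫ coh φ _ (X.comp Z) (by simp [← hZ]) := by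
  rw [coh_eq φ (X := X.comp Y) (Y := (X.comp l).comp (D.comp r)) (by simp [hY])
      (.vcomp (.whisker_left _ (nonempty_coherence _ _ hY).some) (.associator_inv _ _ _)),
    coh_eq φ (Y := X.comp Z) (X := (X.comp l).comp (E.comp r)) (by simp [← hZ])
      (.vcomp (.associator _ _ _) (.whisker_left _ (nonempty_coherence _ _ hZ).some))]
  have : ∀ {x s a b t : B} (f : x ⟶ s) (l : s ⟶ a) (r : b ⟶ t) {D E : a ⟶ b} (α : D ⟶ E)
      {y z : s ⟶ t} (η : y ⟶ l ≫ D ≫ r) (θ : l ≫ E ≫ r ⟶ z),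
      f ◁ (η ≫ l ◁ (α ▷ r) ≫ θ) = (f ◁ η ≫ (α_ f l (D ≫ r)).inv) ≫ (f ≫ l) ◁ (α ▷ r) ≫
        ((α_ f l (E ≫ r)).hom ≫ f ◁ θ) := by
    intros; simp
  exact this (X.ev φ) (l.ev φ) (r.ev φ) α (coh φ _ _ hY) (coh φ _ _ hZ)

theorem whisk_whiskerRight (φ : V ⥤q B) {s t a b x : V} (l : Word s a) (r : Word b t)
    {D E : Word a b} (α : D.ev φ ⟶ E.ev φ) (X : Word t x) (Y Z : Word s t)
    (hY : Y.path = (l.comp (D.comp r)).path) (hZ : (l.comp (E.comp r)).path = Z.path) :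
    (coh φ _ _ hY ≫ whisk φ l r α ≫ coh φ _ _ hZ) ▷ X.ev φ =
      coh φ (Y.comp X) (l.comp (D.comp (r.comp X))) (by simp [hY]) ≫
        whisk φ l (r.comp X) α ≫ coh φ _ (Z.comp X) (by simp [← hZ]) := by
  rw [coh_eq φ (X := Y.comp X) (Y := l.comp (D.comp (r.comp X))) (by simp [hY])
      (.vcomp (.whisker_right _ (nonempty_coherence _ _ hY).some)
        (.vcomp (.associator _ _ _) (.whisker_left _ (.associator _ _ _)))),
    coh_eq φ (Y := Z.comp X) (X := l.comp (E.comp (r.comp X))) (by simp [← hZ])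
      (.vcomp (.vcomp (.whisker_left _ (.associator_inv _ _ _)) (.associator_inv _ _ _))
        (.whisker_right _ (nonempty_coherence _ _ hZ).some))]
  have : ∀ {x s a b t : B} (f : t ⟶ x) (l : s ⟶ a) (r : b ⟶ t) {D E : a ⟶ b} (α : D ⟶ E)
      {y z : s ⟶ t} (η : y ⟶ l ≫ D ≫ r) (θ : l ≫ E ≫ r ⟶ z),
      (η ≫ l ◁ (α ▷ r) ≫ θ) ▷ f = (η ▷ f ≫ ((α_ _ _ _).hom ≫ l ◁ (α_ _ _ _).hom)) ≫
        l ◁ (α ▷ (r ≫ f)) ≫ ((l ◁ (α_ _ _ _).inv ≫ (α_ _ _ _).inv) ≫ θ ▷ f) := by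
    intros; simp
  exact this (X.ev φ) (l.ev φ) (r.ev φ) α (coh φ _ _ hY) (coh φ _ _ hZ)

theorem whisk_id (φ : V ⥤q B) {s t : V} {D E : Word s t} (α : D.ev φ ⟶ E.ev φ) :
    whisk φ (Word.id s) (Word.id t) α = coh φ _ D (by simp) ≫ α ≫ coh φ E _ (by simp) := by
  rw [coh_eq φ (X := (Word.id s).comp (D.comp (Word.id t))) (Y := D)
      (by simp) (.vcomp (.left_unitor _) (.right_unitor _)),
    coh_eq φ (Y := (Word.id s).comp (E.comp (Word.id t))) (X := E)
      (by simp) (.vcomp (.right_unitor_inv _) (.left_unitor_inv _))]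
  have : ∀ {a b : B} {D E : a ⟶ b} (α : D ⟶ E),
      𝟙 a ◁ (α ▷ 𝟙 b) = ((λ_ _).hom ≫ (ρ_ _).hom) ≫ α ≫ ((ρ_ _).inv ≫ (λ_ _).inv) := by
    intros; simp only [id_whiskerLeft, whiskerRight_id, Category.assoc]
  exact this α

/-- The constituent `b(1, …, 1, α, 1, …, 1)` is `α` whiskered by the walks on both sides, up to
coherence. -/
theorem evCell_whisker (φ : V ⥤q B) {s t : V} {P Q : BPath s t} (α : eval φ P ⟶ eval φ Q) {x y : V}
    (c : Context s t x y) : evCell (whisker φ α c) =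
      coh φ _ _ (by simp [Context.toPath_fill]) ≫
        whisk φ (Word.ofPath c.leftPath) (Word.ofPath c.rightPath) (evCell α) ≫
          coh φ _ _ (by simp [Context.toPath_fill]) := by
  induction c with
  | hole =>
    change evCell α = coh φ P.toWord ((Word.ofPath .nil).comp (P.toWord.comp (Word.ofPath .nil)))
      (by simp) ≫ whisk φ (Word.ofPath .nil) (Word.ofPath .nil) (evCell α) ≫
        coh φ _ Q.toWord (by simp)
    rw [whisk_congr φ (l' := Word.id s) (r' := Word.id t) (by simp) (by simp), whisk_id]
    simp
  | left p c ih =>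
    rw [whisk_congr φ (l' := p.toWord.comp (Word.ofPath c.leftPath)) (r' := Word.ofPath c.rightPath)
      (by simp [Context.leftPath]) (by simp [Context.rightPath])]
    refine (evCell_whiskerLeft p (whisker φ α c)).trans ?_
    rw [ih, whiskerLeft_whisk]
    simp only [Category.assoc, coh_comp_assoc, coh_comp]
    rfl
  | right c p ih =>
    rw [whisk_congr φ (l' := Word.ofPath c.leftPath) (r' := (Word.ofPath c.rightPath).comp p.toWord)
      (by simp [Context.leftPath]) (by simp [Context.rightPath])]
    refine (evCell_whiskerRight (whisker φ α c) p).trans ?_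
    rw [ih, whisk_whiskerRight]
    simp only [Category.assoc, coh_comp_assoc, coh_comp]
    rfl

/-- The family of formal cells that is given by a family of `2`-cells with bracketed
boundaries. -/
def cellFamily (φ : V ⥤q B) (bf : I → ParBPath V) (cell : ∀ i, Cell φ (bf i)) : CellFamily φ I where
  src i := (bf i).src
  snk i := (bf i).snk
  dom i := (bf i).dom.toWord
  cod i := (bf i).codom.toWord
  cell i := evCell (cell i)

/-- The `2`-cell `α` is a vertical composite of whiskered members of the family, in the order of
the list `L`, and of coherence cells. -/
def IsCompositeCell {φ : V ⥤q B} {bf : I → ParBPath V} (cell : ∀ i, Cell φ (bf i)) (L : List I)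
    (c : ParBPath V) (α : Cell φ c) : Prop :=
  (cellFamily φ bf cell).IsComposite L c.dom.toWord c.codom.toWord (evCell α)

theorem IsCompositeCell.of_heq {φ : V ⥤q B} {bf : I → ParBPath V} {cell : ∀ i, Cell φ (bf i)}
    {L : List I} {c c' : ParBPath V} {α : Cell φ c} {α' : Cell φ c'}
    (h : IsCompositeCell cell L c α) (hc : c = c') (hα : HEq α' α) :
    IsCompositeCell cell L c' α' := by
  subst hc; cases hα; exact h

theorem CellFamily.IsComposite.whisker {φ : V ⥤q B} {C : CellFamily φ I} {L : List I} {s t x y : V}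
    {P Q : BPath s t} {α : eval φ P ⟶ eval φ Q} {c : Context s t x y}
    (h : C.IsComposite L (c.fill P).toWord (c.fill Q).toWord
      (coh φ _ _ (by simp [Context.toPath_fill]) ≫
        whisk φ (Word.ofPath c.leftPath) (Word.ofPath c.rightPath) (evCell α) ≫
          coh φ _ _ (by simp [Context.toPath_fill]))) :
    C.IsComposite L (c.fill P).toWord (c.fill Q).toWord (evCell (BicatPasting.whisker φ α c)) := by
  rw [evCell_whisker]; exact h

theorem isCompositeCell_whisker {φ : V ⥤q B} {bf : I → ParBPath V} (cell : ∀ i, Cell φ (bf i))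
    (i : I) {c : ParBPath V} (γ : Cell φ c) (hc : c = bf i) (hγ : HEq γ (cell i)) {x y : V}
    (ctx : Context c.src c.snk x y) :
    IsCompositeCell cell [i] ⟨x, y, ctx.fill c.dom, ctx.fill c.codom⟩ (whisker φ γ ctx) := by
  subst hc
  cases hγ
  exact .whisker (.cons (C := cellFamily φ bf cell) i [] _ _ _ _ _ _ (.nil _ _ _))

theorem isCompositeCell_rebracket {φ : V ⥤q B} {bf : I → ParBPath V} (cell : ∀ i, Cell φ (bf i))
    {c : ParBPath V} (r : Rebracket c) {x y : V} (ctx : Context c.src c.snk x y) :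
    IsCompositeCell cell [] ⟨x, y, ctx.fill c.dom, ctx.fill c.codom⟩
      (whisker φ (r.cell φ) ctx) := by
  have h : ∃ h, evCell (r.cell φ) = coh φ c.dom.toWord c.codom.toWord h := by
    cases r with
    | assoc E₁ E₂ E₃ =>
      refine ⟨by simp [BPath.toPath], ?_⟩
      have h₁ := coh_eq φ (X := (E₁.toWord.comp E₂.toWord).comp E₃.toWord)
        (Y := E₁.toWord.comp (E₂.toWord.comp E₃.toWord)) (by simp) (.associator _ _ _)
      refine Eq.trans ?_ h₁.symm
      have : ∀ {x y z w : B} {f f' : x ⟶ y} {g g' : y ⟶ z} {h h' : z ⟶ w} (_ : f' = f)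
          (_ : g' = g) (_ : h' = h) (h₁ : (f' ≫ g') ≫ h' = (f ≫ g) ≫ h)
          (h₂ : f ≫ g ≫ h = f' ≫ g' ≫ h'),
          eqToHom h₁ ≫ (α_ f g h).hom ≫ eqToHom h₂ = (α_ f' g' h').hom := by
        rintro x y z w f _ g _ h _ rfl rfl rfl h₁ h₂
        simp
      exact this (E₁.ev_toWord φ) (E₂.ev_toWord φ) (E₃.ev_toWord φ) _ _
    | assocInv E₁ E₂ E₃ =>
      refine ⟨by simp [BPath.toPath], ?_⟩
      have h₁ := coh_eq φ (Y := (E₁.toWord.comp E₂.toWord).comp E₃.toWord)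
        (X := E₁.toWord.comp (E₂.toWord.comp E₃.toWord)) (by simp) (.associator_inv _ _ _)
      refine Eq.trans ?_ h₁.symm
      have : ∀ {x y z w : B} {f f' : x ⟶ y} {g g' : y ⟶ z} {h h' : z ⟶ w} (_ : f' = f)
          (_ : g' = g) (_ : h' = h) (h₂ : (f ≫ g) ≫ h = (f' ≫ g') ≫ h')
          (h₁ : f' ≫ g' ≫ h' = f ≫ g ≫ h),
          eqToHom h₁ ≫ (α_ f g h).inv ≫ eqToHom h₂ = (α_ f' g' h').inv := by
        rintro x y z w f _ g _ h _ rfl rfl rfl h₁ h₂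
        simp
      exact this (E₁.ev_toWord φ) (E₂.ev_toWord φ) (E₃.ev_toWord φ) _ _
  obtain ⟨h, e⟩ := h
  refine .whisker ?_
  have h₁ : whisk φ (Word.ofPath ctx.leftPath) (Word.ofPath ctx.rightPath) (evCell (r.cell φ)) =
      coh φ _ _ (by simp at h; simp [h]) := by
    rw [e, whisk_coh]
  rw [h₁]
  simp only [coh_comp]
  exact .nil _ _ _

theorem whisker_comp_heq {W : Type} [Quiver.{0} W] (ρ : W ⥤q V) (φ : V ⥤q B) {s t : W}
    {P Q : BPath s t} (α : eval (ρ ⋙q φ) P ⟶ eval (ρ ⋙q φ) Q)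
    (α' : eval φ (P.map ρ) ⟶ eval φ (Q.map ρ)) (h : HEq α α') {x y : W} (c : Context s t x y) :
    HEq (whisker (ρ ⋙q φ) α c) (whisker φ α' (c.map ρ)) := by
  induction c with
  | hole => exact h
  | left p c ih =>
    have e₀ := eval_comp ρ φ p
    have e₁ := eval_comp ρ φ (c.fill P)
    have e₂ := eval_comp ρ φ (c.fill Q)
    rw [Context.map_fill] at e₁ e₂
    have : ∀ {a b c : B} {f f' : a ⟶ b} {g g' h h' : b ⟶ c} {α : g ⟶ h} {α' : g' ⟶ h'}
        (_ : f = f') (_ : g = g') (_ : h = h') (_ : HEq α α'), HEq (f ◁ α) (f' ◁ α') := by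
      rintro a b c f _ g _ h _ α _ rfl rfl rfl ⟨⟩; rfl
    exact this e₀ e₁ e₂ ih
  | right c p ih =>
    have e₀ := eval_comp ρ φ p
    have e₁ := eval_comp ρ φ (c.fill P)
    have e₂ := eval_comp ρ φ (c.fill Q)
    rw [Context.map_fill] at e₁ e₂
    have : ∀ {a b c : B} {f f' : b ⟶ c} {g g' h h' : a ⟶ b} {α : g ⟶ h} {α' : g' ⟶ h'}
        (_ : f = f') (_ : g = g') (_ : h = h') (_ : HEq α α'), HEq (α ▷ f) (α' ▷ f') := by
      rintro a b c f _ g _ h _ α _ rfl rfl rfl ⟨⟩; rfl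
    exact this e₀ e₁ e₂ ih

end Composites

/-! ### Composites with respect to composition schemes -/

section SchemeComposite

universe w v u
open Bicategory

variable {B : Type u} [Bicategory.{w, v} B] {V : Type} [Quiver.{0} V] {I : Type*}

theorem IsCompositeCell.trans {φ : V ⥤q B} {bf : I → ParBPath V} {cell : ∀ i, Cell φ (bf i)}
    {L L' : List I} {s t : V} {p q r : BPath s t} {α : eval φ p ⟶ eval φ q}
    {β : eval φ q ⟶ eval φ r} (h : IsCompositeCell cell L ⟨s, t, p, q⟩ α)
    (h' : IsCompositeCell cell L' ⟨s, t, q, r⟩ β) :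
    IsCompositeCell cell (L ++ L') ⟨s, t, p, r⟩ (α ≫ β) := by
  unfold IsCompositeCell
  have := CellFamily.IsComposite.trans h h'
  rw [← evCell_comp] at this
  exact this

/-- How the faces of a composition scheme are interpreted: a face of kind `some i` carries the
`i`-th given cell, and a face of kind `none` carries a component of the associator or of its
inverse. -/
def Interprets {K : BracketedGraph} (ρ : K.V ⥤q V) (φ : V ⥤q B) (bf : I → ParBPath V)
    (cell : ∀ i, Cell φ (bf i)) (kind : K.InteriorFace → Option I)
    (c : ∀ F, Cell (ρ ⋙q φ) (K.bface F)) : Prop :=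
  (∀ F i, kind F = some i → (K.bface F).map ρ = bf i ∧ HEq (c F) (cell i)) ∧
    ∀ F, kind F = none → ∃ r : Rebracket ((K.bface F).map ρ), HEq (c F) (r.cell φ)

/-- The cell of a consistent graph is a whiskered face cell, or a coherence cell if the face is an
associativity face. -/
theorem Consistent.isCompositeCell {K : BracketedGraph} (cs : Consistent K) (ρ : K.V ⥤q V)
    (φ : V ⥤q B) (bf : I → ParBPath V) (cell : ∀ i, Cell φ (bf i))
    (kind : K.InteriorFace → Option I) (c : ∀ F, Cell (ρ ⋙q φ) (K.bface F))
    (h : Interprets ρ φ bf cell kind c) (α : Cell φ (K.bext.map ρ))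
    (hα : HEq α (cs.cell (⟨ρ ⋙q φ, c⟩ : Diagram K B))) :
    IsCompositeCell cell (kind cs.F).toList (K.bext.map ρ) α := by
  set f := (K.bface cs.F).map ρ with hf
  have hb : (⟨ρ.obj K.ext.src, ρ.obj K.ext.snk, (cs.ctx.map ρ).fill f.dom,
      (cs.ctx.map ρ).fill f.codom⟩ : ParBPath V) = K.bext.map ρ := by
    simp only [BracketedGraph.bext, ParBPath.map, cs.dom_eq, cs.codom_eq, Context.map_fill]
    rfl
  have hγ : ∃ γ : Cell φ f, HEq γ (c cs.F) := ⟨cast (cell_comp ρ φ _) (c cs.F), cast_heq _ _⟩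
  obtain ⟨γ, hγ⟩ := hγ
  have hw : HEq α (whisker φ γ (cs.ctx.map ρ)) :=
    (hα.trans (cast_heq _ _)).trans (whisker_comp_heq ρ φ (c cs.F) γ hγ.symm cs.ctx)
  cases hk : kind cs.F with
  | none =>
    obtain ⟨r, hr⟩ := h.2 _ hk
    obtain rfl : γ = r.cell φ := eq_of_heq (hγ.trans hr)
    exact (isCompositeCell_rebracket cell r (cs.ctx.map ρ)).of_heq hb hw
  | some i =>
    obtain ⟨h₁, h₂⟩ := h.1 _ i hk
    exact (isCompositeCell_whisker cell i γ h₁ (hγ.trans h₂) (cs.ctx.map ρ)).of_heq hb hw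

theorem comp_heq_comp {W : Type} [Quiver.{0} W] (ρ : W ⥤q V) (φ : V ⥤q B) {s t : W}
    {p q r : BPath s t} (α : eval (ρ ⋙q φ) p ⟶ eval (ρ ⋙q φ) q)
    (β : eval (ρ ⋙q φ) q ⟶ eval (ρ ⋙q φ) r)
    (α' : eval φ (p.map ρ) ⟶ eval φ (q.map ρ)) (β' : eval φ (q.map ρ) ⟶ eval φ (r.map ρ))
    (hα : HEq α α') (hβ : HEq β β') : HEq (α ≫ β) (α' ≫ β') := by
  have e₀ := eval_comp ρ φ p
  have e₁ := eval_comp ρ φ q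
  have e₂ := eval_comp ρ φ r
  have : ∀ {a b : B} {f f' g g' h h' : a ⟶ b} {α : f ⟶ g} {α' : f' ⟶ g'} {β : g ⟶ h}
      {β' : g' ⟶ h'} (_ : f = f') (_ : g = g') (_ : h = h') (_ : HEq α α') (_ : HEq β β'),
      HEq (α ≫ β) (α' ≫ β') := by
    rintro a b f _ g _ h _ α _ β _ rfl rfl rfl ⟨⟩ ⟨⟩; rfl
  exact this e₀ e₁ e₂ hα hβ

/-- The composite with respect to a composition scheme is a composite of its cells, each of which
is used exactly once. -/
theorem CompositionScheme.isCompositeCell {K : BracketedGraph} (S : CompositionScheme K) :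
    ∀ (ρ : K.V ⥤q V) (φ : V ⥤q B) (bf : I → ParBPath V) (cell : ∀ i, Cell φ (bf i))
      (kind : K.InteriorFace → Option I) (c : ∀ F, Cell (ρ ⋙q φ) (K.bface F))
      (_ : Interprets ρ φ bf cell kind c), ∃ LF : List K.InteriorFace, LF.Nodup ∧ (∀ F, F ∈ LF) ∧
      ∀ (α : Cell φ (K.bext.map ρ)), HEq α (S.composite (⟨ρ ⋙q φ, c⟩ : Diagram K B)) →
        IsCompositeCell cell (LF.filterMap kind) (K.bext.map ρ) α := by
  induction S with
  | single cs =>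
    intro ρ φ bf cell kind c h
    refine ⟨[cs.F], by simp, fun F => by simp [cs.unique F], fun α hα => ?_⟩
    have := cs.isCompositeCell ρ φ bf cell kind c h α hα
    cases hk : kind cs.F <;> simpa [hk] using this
  | @vcomp G H K S cs v ih =>
    intro ρ φ bf cell kind c h
    let ψ : Diagram K B := ⟨ρ ⋙q φ, c⟩
    obtain ⟨LF, hn, hm, hLF⟩ := ih (v.inl ⋙q ρ) φ bf cell (fun F => kind (v.faces (.inl F)))
      (ψ.restrict v.inl (fun F => v.faces (.inl F)) v.bface_left).cell (by
        refine ⟨fun F i hi => ?_, fun F hF => ?_⟩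
        · obtain ⟨h₁, h₂⟩ := h.1 _ i hi
          refine ⟨?_, (cast_heq _ _).trans h₂⟩
          rw [ParBPath.map_comp, ← v.bface_left, h₁]
        · obtain ⟨r, hr⟩ := h.2 _ hF
          rw [ParBPath.map_comp, ← v.bface_left]
          exact ⟨r, (cast_heq _ _).trans hr⟩)
    have hR := cs.isCompositeCell (v.inr ⋙q ρ) φ bf cell (fun F => kind (v.faces (.inr F)))
      (ψ.restrict v.inr (fun F => v.faces (.inr F)) v.bface_right).cell (by
        refine ⟨fun F i hi => ?_, fun F hF => ?_⟩
        · obtain ⟨h₁, h₂⟩ := h.1 _ i hi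
          refine ⟨?_, (cast_heq _ _).trans h₂⟩
          rw [ParBPath.map_comp, ← v.bface_right, h₁]
        · obtain ⟨r, hr⟩ := h.2 _ hF
          rw [ParBPath.map_comp, ← v.bface_right]
          exact ⟨r, (cast_heq _ _).trans hr⟩)
    refine ⟨LF.map (fun F => v.faces (.inl F)) ++ [v.faces (.inr cs.F)], ?_, ?_, fun α hα => ?_⟩
    · rw [List.nodup_append]
      refine ⟨hn.map (v.faces.injective.comp Sum.inl_injective), by simp, ?_⟩
      simp only [List.mem_map, List.mem_singleton]
      rintro _ ⟨F, -, rfl⟩ _ rfl heq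
      simpa using v.faces.injective heq
    · intro F
      obtain ⟨F | F, rfl⟩ := v.faces.surjective F
      · simp [hm]
      · simp [cs.unique F]
    · -- the two factors of the composite, as cells over `V`
      have hbl : G.bext.map (v.inl ⋙q ρ) =
          ParBPath.map ⟨K.ext.src, K.ext.snk, K.extDom.1, v.bmid⟩ ρ := by
        rw [ParBPath.map_comp, v.bext_left]
      have hbr : H.bext.map (v.inr ⋙q ρ) =
          ParBPath.map ⟨K.ext.src, K.ext.snk, v.bmid, K.extCodom.1⟩ ρ := by
        rw [ParBPath.map_comp, v.bext_right]
      let σ := S.composite (ψ.restrict v.inl (fun F => v.faces (.inl F)) v.bface_left)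
      let τ := cs.cell (ψ.restrict v.inr (fun F => v.faces (.inr F)) v.bface_right)
      let σ' : Cell φ (G.bext.map (v.inl ⋙q ρ)) := cast (cell_comp (v.inl ⋙q ρ) φ _) σ
      let τ' : Cell φ (H.bext.map (v.inr ⋙q ρ)) := cast (cell_comp (v.inr ⋙q ρ) φ _) τ
      have hσ : HEq σ' σ := cast_heq _ _
      have hτ : HEq τ' τ := cast_heq _ _
      have h₁ := hLF σ' hσ
      have h₂ := hR τ' hτ
      let σ'' : Cell φ (ParBPath.map ⟨K.ext.src, K.ext.snk, K.extDom.1, v.bmid⟩ ρ) :=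
        cast (congrArg _ hbl) σ'
      let τ'' : Cell φ (ParBPath.map ⟨K.ext.src, K.ext.snk, v.bmid, K.extCodom.1⟩ ρ) :=
        cast (congrArg _ hbr) τ'
      have h₁' : IsCompositeCell cell _ _ σ'' := h₁.of_heq hbl (cast_heq _ _)
      have h₂' : IsCompositeCell cell _ _ τ'' := h₂.of_heq hbr (cast_heq _ _)
      have h₃ := IsCompositeCell.trans h₁' h₂'
      have hα' : HEq α (σ'' ≫ τ'') := by
        refine hα.trans ?_
        refine comp_heq_comp ρ φ _ _ σ'' τ'' ?_ ?_
        · exact (cast_heq _ _).trans (hσ.symm.trans (cast_heq _ _).symm)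
        · exact (cast_heq _ _).trans (hτ.symm.trans (cast_heq _ _).symm)
      have hl : (LF.map (fun F => v.faces (.inl F)) ++ [v.faces (.inr cs.F)]).filterMap kind =
          LF.filterMap (fun F => kind (v.faces (.inl F))) ++
            (kind (v.faces (.inr cs.F))).toList := by
        rw [List.filterMap_append, List.filterMap_map]
        cases hk : kind (v.faces (.inr cs.F)) <;> simp [hk]
      rw [hl]
      exact h₃.of_heq rfl hα'

end SchemeComposite

/-! ### Uniqueness of the composite -/

section AnchoredEdges

theorem nodup_pathEdges {V : Type*} [Quiver V] {u v : V} {p : Quiver.Path u v}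
    (h : IsDirectedPath p) : (pathEdges p).Nodup := by
  unfold IsDirectedPath at h
  induction p with
  | nil => simp
  | @cons b c p e ih =>
    simp only [Quiver.Path.vertices_cons, List.concat_eq_append, List.nodup_append] at h
    have hr : ∀ {w : V} (q : Quiver.Path u w), ∀ e ∈ pathEdges q, e.right ∈ q.vertices := by
      intro w q
      induction q with
      | nil => simp
      | cons q e ih =>
        intro e' he
        simp only [pathEdges, List.mem_append, List.mem_singleton] at he
        rcases he with he | rfl
        · simp [ih e' he]
        · simp
    simp only [pathEdges, List.nodup_append]
    refine ⟨ih h.1, by simp, ?_⟩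
    rintro x hx y hy rfl
    simp only [List.mem_singleton] at hy
    subst hy
    exact h.2.2 _ (hr p _ hx) c (by simp) rfl

variable (G : AnchoredGraph)

theorem AnchoredGraph.dom_disjoint {F F' : G.InteriorFace} (h : F ≠ F') :
    ∀ e ∈ pathEdges (G.face F).dom, e ∉ pathEdges (G.face F').dom := fun e he he' =>
  h (Option.some_injective _ ((G.forward_once e).unique (y₁ := some F) (y₂ := some F') he he'))

theorem AnchoredGraph.codom_disjoint {F F' : G.InteriorFace} (h : F ≠ F') :
    ∀ e ∈ pathEdges (G.face F).codom, e ∉ pathEdges (G.face F').codom := fun e he he' =>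
  h (Option.some_injective _ ((G.backward_once e).unique (y₁ := some F) (y₂ := some F') he he'))

theorem AnchoredGraph.codom_disjoint_ext {F : G.InteriorFace} :
    ∀ e ∈ pathEdges (G.face F).codom, e ∉ pathEdges G.ext.dom := fun e he he' => by
  simpa using (G.backward_once e).unique (y₁ := some F) (y₂ := none) he he'

end AnchoredEdges

section

universe w v u
variable {B : Type u} [Bicategory.{w, v} B] {G : BracketedGraph}

/-- The composite of a diagram is a composite of the cells of the faces of `G`, each of which is
used exactly once: the cells of the collapsed faces are absorbed by the coherence cells. -/
theorem CompositionSchemeExtension.isCompositeCell (X : CompositionSchemeExtension G)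
    (φ : Diagram G B) : ∃ L : List G.InteriorFace, L.Nodup ∧ (∀ F, F ∈ L) ∧
      IsCompositeCell φ.cell L G.bext (X.composite φ) := by
  classical
  let kind : X.H.InteriorFace → Option G.InteriorFace := fun F =>
    if hF : F ∈ X.A then none else some (X.faces ⟨F, hF⟩)
  obtain ⟨LF, hn, hm, hLF⟩ := X.scheme.isCompositeCell X.π φ.skeleton G.bface φ.cell kind
    (X.extend φ).cell (by
      refine ⟨fun F i hi => ?_, fun F hF => ?_⟩
      · by_cases hA : F ∈ X.A
        · simp [kind, hA] at hi
        · obtain rfl : X.faces ⟨F, hA⟩ = i := by simpa [kind, hA] using hi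
          refine ⟨X.bface_eq ⟨F, hA⟩, ?_⟩
          simp only [extend, hA, dif_neg, not_false_iff]
          exact cast_heq _ _
      · by_cases hA : F ∈ X.A
        · refine ⟨(X.nonempty_rebracket hA).some, ?_⟩
          simp only [extend, hA, dif_pos]
          exact cast_heq _ _
        · simp [kind, hA] at hF)
  refine ⟨LF.filterMap kind, ?_, fun F => ?_, ?_⟩
  · refine hn.filterMap fun F F' i hi hi' => ?_
    simp only [Option.mem_def] at hi hi'
    by_cases hA : F ∈ X.A
    · simp [kind, hA] at hi
    by_cases hA' : F' ∈ X.A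
    · simp [kind, hA'] at hi'
    have h₁ : X.faces ⟨F, hA⟩ = X.faces ⟨F', hA'⟩ := by
      simp only [kind, hA, hA', dif_neg, not_false_iff, Option.some.injEq] at hi hi'
      rw [hi, hi']
    exact congrArg Subtype.val (X.faces.injective h₁)
  · refine List.mem_filterMap.2 ⟨(X.faces.symm F).1, hm _, ?_⟩
    simp [kind, (X.faces.symm F).2]
  · have := hLF (cast ((cell_comp _ _ _)) (X.scheme.composite (X.extend φ))) (cast_heq _ _)
    exact this.of_heq X.bext_eq ((cast_heq _ _).trans (cast_heq _ _).symm)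

/-- Composites with respect to any two composition scheme extensions agree. -/
theorem CompositionSchemeExtension.composite_unique (X X' : CompositionSchemeExtension G)
    (φ : Diagram G B) : X.composite φ = X'.composite φ := by
  obtain ⟨L, hn, hm, h⟩ := X.isCompositeCell φ
  obtain ⟨L', hn', hm', h'⟩ := X'.isCompositeCell φ
  have hd : ∀ F, (G.faceDom F).1.toWord.path = (G.face F).dom := fun F => by
    rw [BPath.path_toWord, (G.faceDom F).2]
  have hc : ∀ F, (G.faceCodom F).1.toWord.path = (G.face F).codom := fun F => by
    rw [BPath.path_toWord, (G.faceCodom F).2]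
  have he : G.extDom.1.toWord.path = G.ext.dom := by rw [BPath.path_toWord, G.extDom.2]
  refine evCell_injective (CellFamily.IsComposite.unique ?_ ?_ h h' ?_ ?_)
  · intro F
    have := (G.faceDom F).1.length_pos
    rwa [length_pathEdges, ← BPath.path_toWord] at this
  · intro F F' hF
    change ∀ e ∈ pathEdges (G.faceDom F).1.toWord.path, e ∉ pathEdges (G.faceDom F').1.toWord.path
    rw [hd, hd]
    exact G.dom_disjoint hF
  · refine ⟨?_, hn, fun F _ => ?_, fun F _ => ?_, fun F _ F' _ hF => ?_⟩
    · change (pathEdges G.extDom.1.toWord.path).Nodup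
      rw [he]; exact nodup_pathEdges (G.isPath_dom none)
    · change (pathEdges (G.faceCodom F).1.toWord.path).Nodup
      rw [hc]; exact nodup_pathEdges (G.isPath_codom (some F))
    · change ∀ e ∈ pathEdges (G.faceCodom F).1.toWord.path, e ∉ pathEdges G.extDom.1.toWord.path
      rw [hc, he]; exact G.codom_disjoint_ext
    · change ∀ e ∈ pathEdges (G.faceCodom F).1.toWord.path,
        e ∉ pathEdges (G.faceCodom F').1.toWord.path
      rw [hc, hc]; exact G.codom_disjoint hF
  · exact (List.perm_ext_iff_of_nodup hn hn').2 fun F => by simp [hm, hm']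

end

/-! ### Directed paths -/

section DirectedPaths

universe v u
variable {V : Type u} [Quiver.{v} V]

theorem mem_vertices_comp {a b c : V} {p : Quiver.Path a b} {q : Quiver.Path b c} {x : V} :
    x ∈ (p.comp q).vertices ↔ x ∈ p.vertices ∨ x ∈ q.vertices := by
  induction q with
  | nil =>
    simp only [Quiver.Path.comp_nil, Quiver.Path.vertices_nil, List.mem_singleton]
    exact ⟨Or.inl, fun h => h.elim id fun h => h ▸ p.end_mem_vertices⟩
  | cons q e ih =>
    rw [Quiver.Path.comp_cons, Quiver.Path.mem_vertices_cons, Quiver.Path.mem_vertices_cons, ih,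
      or_assoc]

theorem left_mem_vertices {a b : V} {p : Quiver.Path a b} {e : Quiver.Total V}
    (h : e ∈ pathEdges p) : e.left ∈ p.vertices := by
  induction p with
  | nil => simp at h
  | cons p e' ih =>
    simp only [pathEdges, List.mem_append, List.mem_singleton] at h
    rcases h with h | rfl
    · simp [ih h]
    · simp [p.end_mem_vertices]

theorem right_mem_vertices {a b : V} {p : Quiver.Path a b} {e : Quiver.Total V}
    (h : e ∈ pathEdges p) : e.right ∈ p.vertices := by
  induction p with
  | nil => simp at h
  | cons p e' ih =>
    simp only [pathEdges, List.mem_append, List.mem_singleton] at h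
    rcases h with h | rfl
    · simp [ih h]
    · simp

theorem IsDirectedPath.of_cons {a b c : V} {p : Quiver.Path a b} {e : b ⟶ c}
    (h : IsDirectedPath (p.cons e)) : IsDirectedPath p ∧ c ∉ p.vertices := by
  unfold IsDirectedPath at h ⊢
  simp only [Quiver.Path.vertices_cons, List.concat_eq_append, List.nodup_append,
    List.mem_singleton] at h
  exact ⟨h.1, fun hc => h.2.2 _ hc c rfl rfl⟩

theorem IsDirectedPath.of_comp {a b c : V} {p : Quiver.Path a b} {q : Quiver.Path b c}
    (h : IsDirectedPath (p.comp q)) :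
    IsDirectedPath p ∧ IsDirectedPath q ∧ ∀ x ∈ p.vertices, x ∈ q.vertices → x = b := by
  induction q with
  | nil => exact ⟨h, by simp [IsDirectedPath], by simp⟩
  | cons q e ih =>
    obtain ⟨h₁, h₂⟩ := IsDirectedPath.of_cons (p := p.comp q) h
    obtain ⟨h₃, h₄, h₅⟩ := ih h₁
    rw [mem_vertices_comp, not_or] at h₂
    refine ⟨h₃, ?_, fun x hx hx' => ?_⟩
    · unfold IsDirectedPath at h₄ ⊢
      simp only [Quiver.Path.vertices_cons, List.concat_eq_append, List.nodup_append, h₄,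
        List.mem_singleton]
      exact ⟨trivial, by simp, fun x hx y hy hxy => h₂.2 (hy ▸ hxy ▸ hx)⟩
    · rw [Quiver.Path.mem_vertices_cons] at hx'
      rcases hx' with hx' | rfl
      · exact h₅ x hx hx'
      · exact absurd hx h₂.1

theorem IsDirectedPath.eq_nil {a : V} {p : Quiver.Path a a} (h : IsDirectedPath p) : p = .nil := by
  cases p with
  | nil => rfl
  | cons p e => exact absurd p.start_mem_vertices h.of_cons.2

/-- A directed path has only one initial segment that ends at a given vertex. -/
theorem IsDirectedPath.prefix_unique {s t b : V} {p q : Quiver.Path s b} {x y : Quiver.Path b t}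
    (h : p.comp x = q.comp y) (hd : IsDirectedPath (p.comp x)) : p = q ∧ x = y := by
  have key : ∀ {p q : Quiver.Path s b} {x y : Quiver.Path b t} (_ : p.comp x = q.comp y)
      (_ : IsDirectedPath (p.comp x)) (_ : p.length ≤ q.length), p = q ∧ x = y := by
    intro p q x y h hd hl
    obtain ⟨m, rfl, rfl⟩ := exists_eq_comp_of_comp_eq_comp _ _ _ _ h hl
    obtain rfl := hd.of_comp.2.1.of_comp.1.eq_nil
    simp
  rcases le_total p.length q.length with hl | hl
  · exact key h hd hl
  · obtain ⟨h₁, h₂⟩ := key h.symm (h ▸ hd) hl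
    exact ⟨h₁.symm, h₂.symm⟩

theorem exists_eq_comp_of_mem_pathEdges {s t : V} {p : Quiver.Path s t} {e : Quiver.Total V}
    (h : e ∈ pathEdges p) : ∃ (l : Quiver.Path s e.left) (r : Quiver.Path e.right t),
      p = l.comp (e.hom.toPath.comp r) := by
  induction p with
  | nil => simp at h
  | cons p e' ih =>
    simp only [pathEdges, List.mem_append, List.mem_singleton] at h
    rcases h with h | rfl
    · obtain ⟨l, r, rfl⟩ := ih h
      exact ⟨l, r.cons e', by simp⟩
    · exact ⟨p, .nil, by simp⟩

/-- A directed path whose edges belong to another directed path is a segment of it. -/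
theorem IsDirectedPath.exists_eq_comp {s t a b : V} {p : Quiver.Path s t} (hp : IsDirectedPath p)
    {d : Quiver.Path a b} (hd : 0 < d.length) (h : ∀ e ∈ pathEdges d, e ∈ pathEdges p) :
    ∃ (l : Quiver.Path s a) (r : Quiver.Path b t), p = l.comp (d.comp r) := by
  induction d with
  | nil => simp at hd
  | @cons b c d e ih =>
    obtain ⟨l₁, r₁, h₁⟩ := exists_eq_comp_of_mem_pathEdges (h ⟨b, c, e⟩ (by simp [pathEdges]))
    cases d with
    | nil => exact ⟨l₁, r₁, h₁⟩
    | cons d e' =>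
      obtain ⟨l, r, h₂⟩ := ih (by simp) fun x hx => h x (by simp [pathEdges] at hx ⊢; tauto)
      have h₃ : (l.comp (d.cons e')).comp r = l₁.comp (e.toPath.comp r₁) := by
        rw [← h₁, h₂, Quiver.Path.comp_assoc]
      have h₄ := (IsDirectedPath.prefix_unique h₃ (by
        rw [Quiver.Path.comp_assoc, ← h₂]; exact hp)).1
      refine ⟨l, r₁, ?_⟩
      rw [h₁, ← h₄]
      simp [← Quiver.Path.comp_toPath_eq_cons]

theorem IsDirectedPath.exists_eq_comp_right {s t a : V} {p : Quiver.Path s t}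
    (hp : IsDirectedPath p) {l : Quiver.Path s a} (h : ∀ e ∈ pathEdges l, e ∈ pathEdges p) :
    ∃ y : Quiver.Path a t, p = l.comp y := by
  rcases Nat.eq_zero_or_pos l.length with h0 | h0
  · cases l with
    | nil => exact ⟨p, by simp⟩
    | cons l e => simp at h0
  · obtain ⟨l₂, r₂, rfl⟩ := hp.exists_eq_comp h0 h
    obtain rfl : l₂ = .nil := hp.of_comp.1.eq_nil
    exact ⟨r₂, by simp⟩

theorem IsDirectedPath.exists_eq_comp_left {s t b : V} {p : Quiver.Path s t}
    (hp : IsDirectedPath p) {r : Quiver.Path b t} (h : ∀ e ∈ pathEdges r, e ∈ pathEdges p) :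
    ∃ z : Quiver.Path s b, p = z.comp r := by
  rcases Nat.eq_zero_or_pos r.length with h0 | h0
  · cases r with
    | nil => exact ⟨p, by simp⟩
    | cons l e => simp at h0
  · obtain ⟨l₂, r₂, rfl⟩ := hp.exists_eq_comp h0 h
    obtain rfl : r₂ = .nil := hp.of_comp.2.1.of_comp.2.1.eq_nil
    exact ⟨l₂, by simp⟩

theorem length_pos_of_ne {a b : V} (p : Quiver.Path a b) (h : a ≠ b) : 0 < p.length := by
  cases p with
  | nil => exact absurd rfl h
  | cons p e => simp

end DirectedPaths

/-! ### Atomic graphs -/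

section Atomic

/-- The boundary of an atomic graph: its domain and codomain differ only in the segment that is the
domain, respectively the codomain, of its interior face. -/
theorem AnchoredGraph.exists_of_atomic (G : AnchoredGraph) (F : G.InteriorFace)
    (hF : ∀ F', F' = F) : ∃ (l : Quiver.Path G.ext.src (G.face F).src)
      (r : Quiver.Path (G.face F).snk G.ext.snk),
      G.ext.dom = l.comp ((G.face F).dom.comp r) ∧
      G.ext.codom = l.comp ((G.face F).codom.comp r) := by
  have hd : IsDirectedPath G.ext.dom := G.isPath_dom none
  have hc : IsDirectedPath G.ext.codom := G.isPath_codom none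
  have hdl : 0 < (G.face F).dom.length := length_pos_of_ne _ (G.src_ne_snk (some F))
  have hcl : 0 < (G.face F).codom.length := length_pos_of_ne _ (G.src_ne_snk (some F))
  have hfwd : ∀ e, e ∈ pathEdges G.ext.codom ∨ e ∈ pathEdges (G.face F).dom := fun e => by
    obtain ⟨F' | F', h, -⟩ := G.forward_once e
    · exact Or.inl h
    · rw [hF F'] at h; exact Or.inr h
  have hbwd : ∀ e, e ∈ pathEdges G.ext.dom ∨ e ∈ pathEdges (G.face F).codom := fun e => by
    obtain ⟨F' | F', h, -⟩ := G.backward_once e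
    · exact Or.inl h
    · rw [hF F'] at h; exact Or.inr h
  obtain ⟨l, r, h₁⟩ := hd.exists_eq_comp hdl fun e he =>
    (hbwd e).resolve_right (G.edge_disjoint F e he)
  obtain ⟨l', r', h₂⟩ := hc.exists_eq_comp hcl fun e he =>
    (hfwd e).resolve_right fun he' => G.edge_disjoint F e he' he
  have hn := nodup_pathEdges hd
  rw [h₁] at hn
  simp only [pathEdges_comp, List.nodup_append, List.mem_append] at hn
  have hl : ∀ e ∈ pathEdges l, e ∈ pathEdges G.ext.codom := fun e he =>
    (hfwd e).resolve_right fun he' => hn.2.2 e he e (Or.inl he') rfl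
  have hr : ∀ e ∈ pathEdges r, e ∈ pathEdges G.ext.codom := fun e he =>
    (hfwd e).resolve_right fun he' => hn.2.1.2.2 e he' e he rfl
  obtain ⟨y, hy⟩ := hc.exists_eq_comp_right hl
  obtain ⟨z, hz⟩ := hc.exists_eq_comp_left hr
  have e₁ : l = l' := (IsDirectedPath.prefix_unique (hy.symm.trans h₂) (hy ▸ hc)).1
  have e₂ : r = r' := (IsDirectedPath.prefix_unique (x := r) (p := z)
    (q := l'.comp (G.face F).codom)
    (hz.symm.trans (h₂.trans (by simp))) (hz ▸ hc)).2
  exact ⟨l, r, h₁, by rw [h₂, e₁, e₂]⟩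

end Atomic

/-! ### Sweeps -/

section Sweep

universe v u v' u'
variable {V : Type u} [Quiver.{v} V] {W : Type u'} [Quiver.{v'} W]

/-- A vertex of the walk `p` or of the codomain of a member of the list. -/
def SweptVertex {s t : V} (p : Quiver.Path s t) (L : List (ParPath V)) (x : V) : Prop :=
  x ∈ p.vertices ∨ ∃ c ∈ L, x ∈ c.codom.vertices

/-- An edge of the walk `p` or of the codomain of a member of the list. -/
def SweptEdge {s t : V} (p : Quiver.Path s t) (L : List (ParPath V)) (e : Quiver.Total V) : Prop :=
  e ∈ pathEdges p ∨ ∃ c ∈ L, e ∈ pathEdges c.codom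

/-- `Sweep L c`: the walk `c.dom` is transformed into `c.codom` by successively replacing segments,
the domains of the members of `L`, by the corresponding codomains; and each codomain has only its
end points in common with what has been swept before. -/
inductive Sweep : List (ParPath V) → ParPath V → Prop
  | nil {s t : V} (p : Quiver.Path s t) : Sweep [] ⟨s, t, p, p⟩
  | snoc {L : List (ParPath V)} {s t a b : V} {p : Quiver.Path s t} (l : Quiver.Path s a)
      (d e : Quiver.Path a b) (r : Quiver.Path b t) (h : Sweep L ⟨s, t, p, l.comp (d.comp r)⟩)
      (fresh : ∀ x ∈ e.vertices, SweptVertex p L x → x = a ∨ x = b) :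
      Sweep (L ++ [⟨a, b, d, e⟩]) ⟨s, t, p, l.comp (e.comp r)⟩

theorem Sweep.snoc_of_eq {L : List (ParPath V)} {s t : V} {p q q' : Quiver.Path s t}
    (h : Sweep L ⟨s, t, p, q⟩) {s' t' a b : V} (l : Quiver.Path s' a) (d e : Quiver.Path a b)
    (r : Quiver.Path b t') (hc : (⟨s', t', l.comp (d.comp r), l.comp (e.comp r)⟩ : ParPath V) =
      ⟨s, t, q, q'⟩) (fresh : ∀ x ∈ e.vertices, SweptVertex p L x → x = a ∨ x = b) :
    Sweep (L ++ [⟨a, b, d, e⟩]) ⟨s, t, p, q'⟩ := by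
  cases hc
  exact .snoc l d e r h fresh

theorem vertices_mapPath (π : V ⥤q W) {a b : V} (p : Quiver.Path a b) :
    (π.mapPath p).vertices = p.vertices.map π.obj := by
  induction p with
  | nil => rfl
  | cons p e ih => simp [ih]

theorem pathEdges_mapPath (π : V ⥤q W) {a b : V} (p : Quiver.Path a b) :
    pathEdges (π.mapPath p) = (pathEdges p).map (mapEdge π) := by
  induction p with
  | nil => rfl
  | cons p e ih => simp [pathEdges, ih]; rfl

theorem SweptVertex.exists_of_map {π : V ⥤q W} {s t : V} {p : Quiver.Path s t}
    {L : List (ParPath V)} {y : W} (h : SweptVertex (π.mapPath p) (L.map (·.map π)) y) :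
    ∃ x, SweptVertex p L x ∧ π.obj x = y := by
  rcases h with h | ⟨c, hc, h⟩
  · rw [vertices_mapPath] at h
    obtain ⟨x, hx, rfl⟩ := List.mem_map.1 h
    exact ⟨x, Or.inl hx, rfl⟩
  · obtain ⟨c', hc', rfl⟩ := List.mem_map.1 hc
    simp only [ParPath.map, vertices_mapPath] at h
    obtain ⟨x, hx, rfl⟩ := List.mem_map.1 h
    exact ⟨x, Or.inr ⟨c', hc', hx⟩, rfl⟩

theorem Sweep.map {L : List (ParPath V)} {c : ParPath V} (h : Sweep L c) (π : V ⥤q W)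
    (hπ : Function.Injective π.obj) : Sweep (L.map (·.map π)) (c.map π) := by
  induction h with
  | nil p => exact .nil _
  | @snoc L s t a b p l d e r h fresh ih =>
    simp only [List.map_append, List.map_cons, List.map_nil, ParPath.map, Prefunctor.mapPath_comp]
    refine .snoc _ (π.mapPath d) _ _ ?_ ?_
    · simpa only [ParPath.map, Prefunctor.mapPath_comp] using ih
    · intro y hy hs
      rw [vertices_mapPath] at hy
      obtain ⟨x, hx, rfl⟩ := List.mem_map.1 hy
      obtain ⟨x', hx', hxx⟩ := hs.exists_of_map
      obtain rfl := hπ hxx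
      rcases fresh x' hx hx' with rfl | rfl <;> simp

theorem Sweep.mem_pathEdges {L : List (ParPath V)} {c : ParPath V} (h : Sweep L c) :
    ∀ x ∈ pathEdges c.codom, SweptEdge c.dom L x := by
  induction h with
  | nil p => exact fun x hx => Or.inl hx
  | @snoc L s t a b p l d e r h fresh ih =>
    intro x hx
    have ih' : x ∈ pathEdges (l.comp (d.comp r)) → SweptEdge p (L ++ [⟨a, b, d, e⟩]) x := fun hx =>
      (ih x hx).imp id fun ⟨c, hc, h⟩ => ⟨c, by simp [hc], h⟩
    simp only [pathEdges_comp, List.mem_append] at hx ih'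
    rcases hx with hx | hx | hx
    · exact ih' (Or.inl hx)
    · exact Or.inr ⟨⟨a, b, d, e⟩, by simp, hx⟩
    · exact ih' (Or.inr (Or.inr hx))

theorem IsDirectedPath.exists_increasing {a b : V} {p : Quiver.Path a b} (h : IsDirectedPath p)
    (hp : 0 < p.length) {α β : ℝ} (hαβ : α < β) : ∃ y : V → ℝ, y a = α ∧ y b = β ∧
      ∀ e ∈ pathEdges p, y e.left < y e.right := by
  classical
  induction p generalizing β with
  | nil => simp at hp
  | @cons b c p e ih =>
    obtain ⟨h₁, h₂⟩ := h.of_cons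
    have hca : a ≠ c := fun hac => h₂ (hac ▸ p.start_mem_vertices)
    have hcb : b ≠ c := fun hbc => h₂ (hbc ▸ p.end_mem_vertices)
    rcases Nat.eq_zero_or_pos p.length with h0 | h0
    · cases p with
      | cons p e => simp at h0
      | nil =>
        exact ⟨fun v => if v = c then β else α, by simp [hca], by simp,
          by simp [pathEdges, hcb, hαβ]⟩
    · obtain ⟨y, hya, hyb, hy⟩ := ih h₁ h0 (β := (α + β) / 2) (by linarith)
      refine ⟨Function.update y c β, by simp [hca, hya], by simp, fun e' he' => ?_⟩
      simp only [pathEdges, List.mem_append, List.mem_singleton] at he'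
      rcases he' with he' | rfl
      · have hl : e'.left ≠ c := fun h => h₂ (h ▸ left_mem_vertices he')
        have hr : e'.right ≠ c := fun h => h₂ (h ▸ right_mem_vertices he')
        simpa [hl, hr] using hy e' he'
      · simp only [Function.update_self, Function.update_of_ne hcb, hyb]
        linarith

theorem le_of_increasing {x : V → ℝ} {a b : V} {p : Quiver.Path a b}
    (h : ∀ e ∈ pathEdges p, x e.left < x e.right) : x a ≤ x b := by
  induction p with
  | nil => exact le_rfl
  | cons p e ih =>
    exact (ih fun e' he' => h e' (by simp [pathEdges, he'])).trans
      (h ⟨_, _, e⟩ (by simp [pathEdges])).le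

theorem lt_of_increasing {x : V → ℝ} {a b : V} {p : Quiver.Path a b} (hp : 0 < p.length)
    (h : ∀ e ∈ pathEdges p, x e.left < x e.right) : x a < x b := by
  cases p with
  | nil => simp at hp
  | cons p e =>
    exact (le_of_increasing (p := p) fun e' he' => h e' (by simp [pathEdges, he'])).trans_lt
      (h ⟨_, _, e⟩ (by simp [pathEdges]))

/-- The vertices of a sweep can be placed over the real line in such a way that all edges run from
left to right. -/
theorem Sweep.exists_increasing {L : List (ParPath V)} {c : ParPath V} (h : Sweep L c)
    (hc : IsDirectedPath c.dom) (hc' : c.src ≠ c.snk)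
    (hL : ∀ d ∈ L, IsDirectedPath d.codom ∧ d.src ≠ d.snk) :
    ∃ x : V → ℝ, ∀ e, SweptEdge c.dom L e → x e.left < x e.right := by
  classical
  induction h with
  | @nil s t p =>
    obtain ⟨y, -, -, hy⟩ := hc.exists_increasing (length_pos_of_ne p hc') zero_lt_one
    refine ⟨y, fun e he => hy e ?_⟩
    simpa [SweptEdge] using he
  | @snoc L s t a b p l d e r h fresh ih =>
    obtain ⟨x, hx⟩ := ih hc hc' fun d hd => hL d (by simp [hd])
    obtain ⟨he, hab⟩ := hL ⟨a, b, d, e⟩ (by simp)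
    have hlt : x a < x b := by
      refine lt_of_increasing (length_pos_of_ne d hab) fun e' he' => hx e' (h.mem_pathEdges _ ?_)
      simp [pathEdges_comp, he']
    -- The new vertices are placed between the end points of the replaced segment.
    obtain ⟨y, hya, hyb, hy⟩ := he.exists_increasing (length_pos_of_ne e hab) hlt
    refine ⟨fun v => if v ∈ e.vertices then y v else x v, fun e' he' => ?_⟩
    have hold : ∀ v, SweptVertex p L v → (if v ∈ e.vertices then y v else x v) = x v := by
      intro v hv
      split_ifs with hve
      · rcases fresh v hve hv with rfl | rfl
        · exact hya
        · exact hyb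
      · rfl
    have hcases : SweptEdge p L e' ∨ e' ∈ pathEdges e := by
      rcases he' with he' | ⟨c, hc, he'⟩
      · exact Or.inl (Or.inl he')
      · simp only [List.mem_append, List.mem_singleton] at hc
        rcases hc with hc | rfl
        · exact Or.inl (Or.inr ⟨c, hc, he'⟩)
        · exact Or.inr he'
    rcases hcases with he' | he'
    · have h₁ : SweptVertex p L e'.left := he'.imp left_mem_vertices
        fun ⟨c, hc, h⟩ => ⟨c, hc, left_mem_vertices h⟩
      have h₂ : SweptVertex p L e'.right := he'.imp right_mem_vertices
        fun ⟨c, hc, h⟩ => ⟨c, hc, right_mem_vertices h⟩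
      simp only [hold _ h₁, hold _ h₂]
      exact hx e' he'
    · simp only [left_mem_vertices he', right_mem_vertices he', if_true]
      exact hy e' he'

end Sweep

/-! ### Sweeps from pasting scheme presentations -/

section Presentation

/-- In an atomic graph, the codomain of the interior face meets the domain of the graph only in the
source and the sink of the face. -/
theorem AnchoredGraph.fresh_of_atomic (G : AnchoredGraph) (F : G.InteriorFace)
    {l : Quiver.Path G.ext.src (G.face F).src} {r : Quiver.Path (G.face F).snk G.ext.snk}
    (hd : G.ext.dom = l.comp ((G.face F).dom.comp r))
    (hc : G.ext.codom = l.comp ((G.face F).codom.comp r)) :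
    ∀ x ∈ (G.face F).codom.vertices, x ∈ G.ext.dom.vertices →
      x = (G.face F).src ∨ x = (G.face F).snk := by
  intro x hx hx'
  have h := G.isPath_codom none
  change IsDirectedPath G.ext.codom at h
  rw [hc] at h
  simp only [hd, mem_vertices_comp] at hx'
  rcases hx' with hx' | hx' | hx'
  · exact Or.inl (h.of_comp.2.2 x hx' (mem_vertices_comp.2 (Or.inl hx)))
  · exact G.vertex_disjoint F x hx' hx
  · exact Or.inr (h.of_comp.2.1.of_comp.2.2 x hx hx')

/-- A pasting scheme presentation lists the interior faces in an order in which they sweep the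
graph. -/
theorem HasPastingSchemePresentation.exists_sweep {K : AnchoredGraph}
    (h : HasPastingSchemePresentation K) : ∃ L : List K.InteriorFace, L.Nodup ∧ L ≠ [] ∧
      (∀ F, F ∈ L) ∧ Sweep (L.map K.face) K.ext := by
  induction h with
  | @atomic G hG =>
    obtain ⟨F, -, hF⟩ := hG
    obtain ⟨l, r, hd, hc⟩ := G.exists_of_atomic F fun F' => hF F' trivial
    refine ⟨[F], by simp, by simp, fun F' => by simp [hF F' trivial], ?_⟩
    refine Sweep.snoc_of_eq (L := []) (Sweep.nil G.ext.dom) l (G.face F).dom (G.face F).codom r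
      ?_ ?_
    · rw [← hd, ← hc]
    · intro x hx hs
      refine G.fresh_of_atomic F hd hc x hx ?_
      simpa [SweptVertex] using hs
  | @vcomp G H K hG hH v ih =>
    obtain ⟨L, hn, -, hm, hs⟩ := ih
    obtain ⟨F, -, hF⟩ := hH
    obtain ⟨l, r, hd, hc⟩ := H.exists_of_atomic F fun F' => hF F' trivial
    have hlist : (L.map (fun F => v.faces (.inl F)) ++ [v.faces (.inr F)]).map K.face =
        (L.map G.face).map (·.map v.inl) ++ [(H.face F).map v.inr] := by
      simp [v.face_left, v.face_right, Function.comp_def]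
    refine ⟨L.map (fun F => v.faces (.inl F)) ++ [v.faces (.inr F)], ?_, by simp, ?_, ?_⟩
    · rw [List.nodup_append]
      refine ⟨hn.map (v.faces.injective.comp Sum.inl_injective), by simp, ?_⟩
      simp only [List.mem_map, List.mem_singleton]
      rintro _ ⟨F, -, rfl⟩ _ rfl heq
      simpa using v.faces.injective heq
    · intro F'
      obtain ⟨F' | F', rfl⟩ := v.faces.surjective F'
      · simp [hm]
      · simp [hF F' trivial]
    · rw [hlist]
      have h₁ := hs.map v.inl v.inl_obj_injective
      have hswept : ∀ y : K.V, SweptVertex K.ext.dom ((L.map G.face).map (·.map v.inl)) y →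
          y ∈ Set.range v.inl.obj := by
        intro y hy
        have : SweptVertex (v.inl.mapPath G.ext.dom) ((L.map G.face).map (·.map v.inl)) y := by
          refine hy.imp (fun hy => ?_) id
          have := congrArg (fun c : ParPath K.V => c.dom.vertices) v.ext_left
          simp only [ParPath.map] at this
          rwa [this]
        obtain ⟨x, -, rfl⟩ := this.exists_of_map
        exact ⟨x, rfl⟩
      rw [v.ext_left] at h₁
      refine Sweep.snoc_of_eq h₁ (v.inr.mapPath l) (v.inr.mapPath (H.face F).dom)
        (v.inr.mapPath (H.face F).codom) (v.inr.mapPath r) ?_ ?_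
      · rw [← v.ext_right]
        simp only [ParPath.map, hd, hc, Prefunctor.mapPath_comp]
      · intro y hy hs
        rw [vertices_mapPath] at hy
        obtain ⟨x, hx, rfl⟩ := List.mem_map.1 hy
        obtain ⟨u, hu⟩ := hswept _ hs
        have h₂ : v.inr.obj x ∈ v.mid.vertices := by
          have h₃ := congrArg (fun c : ParPath K.V => c.codom.vertices) v.ext_left
          simp only [ParPath.map, vertices_mapPath] at h₃
          rw [← h₃, ← hu]
          exact List.mem_map_of_mem (v.obj_glue u x hu)
        have h₄ := congrArg (fun c : ParPath K.V => c.dom.vertices) v.ext_right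
        simp only [ParPath.map, vertices_mapPath] at h₄
        rw [← h₄] at h₂
        obtain ⟨x', hx', hxx⟩ := List.mem_map.1 h₂
        obtain rfl := v.inr_obj_injective hxx
        rcases H.fresh_of_atomic F hd hc x' hx hx' with rfl | rfl <;> simp

end Presentation

/-! ### Shears of the plane -/

section Shear

/-- The homeomorphism `(X, Y) ↦ (c X + d, Y - f X)` of the plane. -/
noncomputable def shear (c d : ℝ) (hc : 0 < c) (f : ℝ → ℝ) (hf : Continuous f) : ℂ ≃ₜ ℂ where
  toFun z := ⟨c * z.re + d, z.im - f z.re⟩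
  invFun w := ⟨(w.re - d) / c, w.im + f ((w.re - d) / c)⟩
  left_inv z := by
    have : (c * z.re + d - d) / c = z.re := by
      rw [add_sub_cancel_right, mul_div_cancel_left₀ _ hc.ne']
    apply Complex.ext <;> simp only [this, sub_add_cancel]
  right_inv w := by
    have : c * ((w.re - d) / c) + d = w.re := by rw [mul_div_cancel₀ _ hc.ne', sub_add_cancel]
    apply Complex.ext <;> simp only [this, add_sub_cancel_right]
  continuous_toFun := Complex.equivRealProdCLM.symm.continuous.comp
    (f := fun z : ℂ => (c * z.re + d, z.im - f z.re)) (by fun_prop)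
  continuous_invFun := Complex.equivRealProdCLM.symm.continuous.comp
    (f := fun w : ℂ => ((w.re - d) / c, w.im + f ((w.re - d) / c))) (by fun_prop)

theorem shear_apply (c d : ℝ) (hc : 0 < c) (f : ℝ → ℝ) (hf : Continuous f) (z : ℂ) :
    shear c d hc f hf z = ⟨c * z.re + d, z.im - f z.re⟩ := rfl

/-- The straight-line isotopy between the identity and a shear consists of shears. -/
theorem isOrientationPreserving_shear (c d : ℝ) (hc : 0 < c) (f : ℝ → ℝ) (hf : Continuous f) :
    IsOrientationPreserving (shear c d hc f hf) := by
  have hpos : ∀ s : unitInterval, 0 < 1 - (s : ℝ) + s * c := fun s => by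
    rcases eq_or_lt_of_le s.2.2 with h | h
    · rw [h]; simpa
    · have := mul_nonneg s.2.1 hc.le
      linarith
  refine ⟨fun s => shear (1 - (s : ℝ) + s * c) (s * d) (hpos s) (fun X => s * f X) (by fun_prop),
    ?_, ?_, ?_⟩
  · exact Complex.equivRealProdCLM.symm.continuous.comp
      (f := fun p : unitInterval × ℂ => ((1 - (p.1 : ℝ) + p.1 * c) * p.2.re + p.1 * d,
        p.2.im - p.1 * f p.2.re)) (by fun_prop)
  · ext z
    apply Complex.ext <;> simp [shear_apply]
  · ext z
    apply Complex.ext <;> simp [shear_apply]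

/-- An edge that is drawn as the graph of a continuous function from left to right has the region
below the graph on its right-hand side. -/
theorem PlaneGraph.onRight_of_graph (G : PlaneGraph) (e : Quiver.Total G.V) (R : Set ℂ) {α β : ℝ}
    (h : α < β) {f : ℝ → ℝ} (hf : Continuous f)
    (he : ∀ t : unitInterval, G.arc e t = ⟨α + t * (β - α), f (α + t * (β - α))⟩)
    (hR : ∀ᶠ ε : ℝ in 𝓝[>] 0, (⟨(α + β) / 2, f ((α + β) / 2) - ε⟩ : ℂ) ∈ R) : G.OnRight e R := by
  have hαβ : 0 < β - α := sub_pos.2 h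
  refine ⟨shear (β - α)⁻¹ (-α / (β - α)) (inv_pos.2 hαβ) f hf,
    isOrientationPreserving_shear _ _ _ _ _, fun t => ?_, ?_⟩
  · rw [he, shear_apply]
    apply Complex.ext
    · simp only [Complex.ofReal_re]
      field_simp
      ring
    · simp
  · filter_upwards [hR] with ε hε
    have h₁ : ((1 / 2 - ε * Complex.I : ℂ).re - -α / (β - α)) / (β - α)⁻¹ = (α + β) / 2 := by
      simp
      field_simp
      ring
    have h₂ : (shear (β - α)⁻¹ (-α / (β - α)) (inv_pos.2 hαβ) f hf).symm (1 / 2 - ε * Complex.I) =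
        ⟨(α + β) / 2, f ((α + β) / 2) - ε⟩ := by
      change (⟨_, _⟩ : ℂ) = _
      rw [h₁]
      apply Complex.ext
      · rfl
      · simp; ring
    rwa [h₂]

/-- An edge that is drawn as the graph of a continuous function from left to right has the region
above the graph on its left-hand side. -/
theorem PlaneGraph.onLeft_of_graph (G : PlaneGraph) (e : Quiver.Total G.V) (R : Set ℂ) {α β : ℝ}
    (h : α < β) {f : ℝ → ℝ} (hf : Continuous f)
    (he : ∀ t : unitInterval, G.arc e t = ⟨α + t * (β - α), f (α + t * (β - α))⟩)
    (hR : ∀ᶠ ε : ℝ in 𝓝[>] 0, (⟨(α + β) / 2, f ((α + β) / 2) + ε⟩ : ℂ) ∈ R) : G.OnLeft e R := by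
  have hαβ : 0 < β - α := sub_pos.2 h
  refine ⟨shear (β - α)⁻¹ (-α / (β - α)) (inv_pos.2 hαβ) f hf,
    isOrientationPreserving_shear _ _ _ _ _, fun t => ?_, ?_⟩
  · rw [he, shear_apply]
    apply Complex.ext
    · simp only [Complex.ofReal_re]
      field_simp
      ring
    · simp
  · filter_upwards [hR] with ε hε
    have h₁ : ((1 / 2 + ε * Complex.I : ℂ).re - -α / (β - α)) / (β - α)⁻¹ = (α + β) / 2 := by
      simp
      field_simp
      ring
    have h₂ : (shear (β - α)⁻¹ (-α / (β - α)) (inv_pos.2 hαβ) f hf).symm (1 / 2 + ε * Complex.I) =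
        ⟨(α + β) / 2, f ((α + β) / 2) + ε⟩ := by
      change (⟨_, _⟩ : ℂ) = _
      rw [h₁]
      apply Complex.ext
      · rfl
      · simp; ring
    rwa [h₂]

end Shear

/-! ### Components of complements -/

section Components

/-- If a set is the disjoint union of open preconnected sets, then these are its components. -/
theorem connectedComponentIn_eq_of_partition {X ι : Type*} [TopologicalSpace X] {S : Set X}
    {U : ι → Set X} (ho : ∀ i, IsOpen (U i)) (hc : ∀ i, IsPreconnected (U i))
    (hd : ∀ i j, i ≠ j → Disjoint (U i) (U j)) (hS : S = ⋃ i, U i) {i : ι} {z : X} (hz : z ∈ U i) :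
    connectedComponentIn S z = U i := by
  have hzS : z ∈ S := hS ▸ Set.mem_iUnion.2 ⟨i, hz⟩
  apply Set.Subset.antisymm
  · refine isPreconnected_connectedComponentIn.subset_left_of_subset_union (ho i)
      (v := ⋃ j : {j // j ≠ i}, U j.1) (isOpen_iUnion fun j => ho _) ?_ ?_
      ⟨z, mem_connectedComponentIn hzS, hz⟩
    · rw [Set.disjoint_iUnion_right]
      exact fun j => hd _ _ j.2.symm
    · refine (connectedComponentIn_subset _ _).trans ?_
      rw [hS]
      intro y hy
      obtain ⟨j, hj⟩ := Set.mem_iUnion.1 hy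
      by_cases h : j = i
      · exact Or.inl (h ▸ hj)
      · exact Or.inr (Set.mem_iUnion.2 ⟨⟨j, h⟩, hj⟩)
  · exact (hc i).subset_connectedComponentIn hz (hS ▸ Set.subset_iUnion U i)

theorem continuous_complex_mk {X : Type*} [TopologicalSpace X] {f g : X → ℝ} (hf : Continuous f)
    (hg : Continuous g) : Continuous fun x => (⟨f x, g x⟩ : ℂ) :=
  Complex.equivRealProdCLM.symm.continuous.comp (hf.prodMk hg)

theorem isPreconnected_between {α β : ℝ} {f g : ℝ → ℝ} (hf : Continuous f) (hg : Continuous g)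
    (hfg : ∀ X, α < X → X < β → f X < g X) :
    IsPreconnected {z : ℂ | (α < z.re ∧ z.re < β) ∧ f z.re < z.im ∧ z.im < g z.re} := by
  have h : {z : ℂ | (α < z.re ∧ z.re < β) ∧ f z.re < z.im ∧ z.im < g z.re} =
      (fun p : ℝ × ℝ => (⟨p.1, f p.1 + p.2 * (g p.1 - f p.1)⟩ : ℂ)) ''
        (Set.Ioo α β ×ˢ Set.Ioo 0 1) := by
    ext z
    constructor
    · rintro ⟨⟨h₁, h₂⟩, h₃, h₄⟩
      have hpos : 0 < g z.re - f z.re := sub_pos.2 (hfg _ h₁ h₂)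
      refine ⟨(z.re, (z.im - f z.re) / (g z.re - f z.re)), ⟨⟨h₁, h₂⟩, ?_, ?_⟩, ?_⟩
      · exact div_pos (sub_pos.2 h₃) hpos
      · rw [div_lt_one hpos]; linarith
      · apply Complex.ext
        · rfl
        · simp only
          rw [div_mul_cancel₀ _ hpos.ne']
          ring
    · rintro ⟨⟨X, τ⟩, ⟨⟨h₁, h₂⟩, h₃, h₄⟩, rfl⟩
      have hpos : 0 < g X - f X := sub_pos.2 (hfg _ h₁ h₂)
      refine ⟨⟨h₁, h₂⟩, ?_, ?_⟩
      · have := mul_pos h₃ hpos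
        simp only; linarith
      · have := mul_lt_mul_of_pos_right h₄ hpos
        simp only; linarith
  rw [h]
  exact ((convex_Ioo α β).prod (convex_Ioo 0 1)).isPreconnected.image _
    (continuous_complex_mk (by fun_prop) (by fun_prop)).continuousOn

theorem isPreconnected_outside {α β : ℝ} {f g : ℝ → ℝ} (hf : Continuous f) (hg : Continuous g) :
    IsPreconnected {z : ℂ | z.re < α ∨ β < z.re ∨ g z.re < z.im ∨ z.im < f z.re} := by
  have hgraph : ∀ (k : ℝ → ℝ) (_ : Continuous k) (s : Set ℝ) (_ : Convex ℝ s),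
      IsPreconnected ((fun p : ℝ × ℝ => (⟨p.1, k p.1 + p.2⟩ : ℂ)) '' (Set.univ ×ˢ s)) :=
    fun k hk s hs => (convex_univ.prod hs).isPreconnected.image _
      (continuous_complex_mk (by fun_prop) (by fun_prop)).continuousOn
  have hA : IsPreconnected {z : ℂ | z.re < α} := (convex_halfSpace_re_lt α).isPreconnected
  have hB : IsPreconnected {z : ℂ | β < z.re} := (convex_halfSpace_re_gt β).isPreconnected
  have hC : IsPreconnected {z : ℂ | g z.re < z.im} := by
    convert hgraph g hg (Set.Ioi 0) (convex_Ioi 0) using 1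
    ext z
    constructor
    · intro h
      exact ⟨(z.re, z.im - g z.re), ⟨trivial, Set.mem_Ioi.2 (sub_pos.2 h)⟩,
        by apply Complex.ext <;> simp⟩
    · rintro ⟨⟨X, τ⟩, ⟨-, h⟩, rfl⟩
      simpa using h
  have hD : IsPreconnected {z : ℂ | z.im < f z.re} := by
    convert hgraph f hf (Set.Iio 0) (convex_Iio 0) using 1
    ext z
    constructor
    · intro h
      exact ⟨(z.re, z.im - f z.re), ⟨trivial, Set.mem_Iio.2 (sub_neg.2 h)⟩,
        by apply Complex.ext <;> simp⟩
    · rintro ⟨⟨X, τ⟩, ⟨-, h⟩, rfl⟩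
      simpa using h
  have h₁ := IsPreconnected.union (⟨α - 1, g (α - 1) + 1⟩ : ℂ) (by simp) (by simp) hA hC
  have h₂ := IsPreconnected.union (⟨β + 1, g (β + 1) + 1⟩ : ℂ) (by simp) (by simp) h₁ hB
  have h₃ := IsPreconnected.union (⟨α - 1, f (α - 1) - 1⟩ : ℂ) (by simp) (by simp) h₂ hD
  convert h₃ using 1
  ext z
  simp only [Set.mem_ofPred_eq, Set.mem_union]
  tauto

end Components

/-! ### Monotone walks -/

section Monotone

variable {W : Type*} [Quiver W] {x : W → ℝ} (hx : ∀ {u v : W} (_ : u ⟶ v), x u < x v)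
include hx

theorem le_of_mem_vertices {u v w : W} {p : Quiver.Path u v} (h : w ∈ p.vertices) :
    x u ≤ x w ∧ x w ≤ x v := by
  induction p with
  | nil =>
    simp only [Quiver.Path.vertices_nil, List.mem_singleton] at h
    subst h
    exact ⟨le_rfl, le_rfl⟩
  | cons p e ih =>
    have he := hx e
    rcases (Quiver.Path.mem_vertices_cons _ _).1 h with h | rfl
    · exact ⟨(ih h).1, (ih h).2.trans he.le⟩
    · exact ⟨(le_of_increasing (p := p) (x := x) fun e _ => hx e.hom).trans he.le, le_rfl⟩

theorem le_of_mem_pathEdges {u v : W} {e : Quiver.Total W} {p : Quiver.Path u v}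
    (h : e ∈ pathEdges p) : x u ≤ x e.left ∧ x e.right ≤ x v :=
  ⟨(le_of_mem_vertices hx (left_mem_vertices h)).1,
    (le_of_mem_vertices hx (right_mem_vertices h)).2⟩

theorem vertex_eq_of_x_eq {u v w w' : W} {p : Quiver.Path u v} (h : w ∈ p.vertices)
    (h' : w' ∈ p.vertices) (hw : x w = x w') : w = w' := by
  induction p with
  | nil =>
    simp only [Quiver.Path.vertices_nil, List.mem_singleton] at h h'
    rw [h, h']
  | cons p e ih =>
    have he := hx e
    rcases (Quiver.Path.mem_vertices_cons _ _).1 h with h₁ | rfl <;>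
    rcases (Quiver.Path.mem_vertices_cons _ _).1 h' with h₂ | rfl
    · exact ih h₁ h₂
    · have := (le_of_mem_vertices hx h₁).2
      exact absurd hw (by linarith : x w < x w').ne
    · have := (le_of_mem_vertices hx h₂).2
      exact absurd hw (by linarith : x w' < x w).ne'
    · rfl

theorem not_between_of_mem {u v w : W} {e : Quiver.Total W} {p : Quiver.Path u v}
    (h : w ∈ p.vertices) (h' : e ∈ pathEdges p) : x w ≤ x e.left ∨ x e.right ≤ x w := by
  induction p with
  | nil => simp [pathEdges] at h'
  | cons p f ih =>
    have hf := hx f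
    simp only [pathEdges, List.mem_append, List.mem_singleton] at h'
    rcases (Quiver.Path.mem_vertices_cons _ _).1 h with h | rfl <;> rcases h' with h' | rfl
    · exact ih h h'
    · exact Or.inl (le_of_mem_vertices hx h).2
    · exact Or.inr ((le_of_mem_pathEdges hx h').2.trans hf.le)
    · exact Or.inr le_rfl

theorem edge_eq_of_between {u v : W} {e f : Quiver.Total W} {p : Quiver.Path u v} {X : ℝ}
    (h : e ∈ pathEdges p) (h' : f ∈ pathEdges p) (he : x e.left < X ∧ X < x e.right)
    (hf : x f.left < X ∧ X < x f.right) : e = f := by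
  induction p with
  | nil => simp [pathEdges] at h
  | cons p g ih =>
    simp only [pathEdges, List.mem_append, List.mem_singleton] at h h'
    rcases h with h | rfl <;> rcases h' with h' | rfl
    · exact ih h h'
    · have := (le_of_mem_pathEdges hx h).2
      simp only at hf
      linarith
    · have := (le_of_mem_pathEdges hx h').2
      simp only at he
      linarith
    · rfl

omit hx in
theorem exists_cell_over {u v : W} (p : Quiver.Path u v) {X : ℝ} (h : x u ≤ X) (h' : X ≤ x v) :
    (∃ w ∈ p.vertices, x w = X) ∨ ∃ e ∈ pathEdges p, x e.left < X ∧ X < x e.right := by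
  induction p with
  | nil => exact Or.inl ⟨u, by simp, le_antisymm h h'⟩
  | @cons b c p e ih =>
    rcases le_or_gt X (x b) with hb | hb
    · rcases ih hb with ⟨w, hw, hX⟩ | ⟨f, hf, hX⟩
      · exact Or.inl ⟨w, (Quiver.Path.mem_vertices_cons _ _).2 (Or.inl hw), hX⟩
      · exact Or.inr ⟨f, by simp [pathEdges, hf], hX⟩
    · rcases eq_or_lt_of_le h' with rfl | h'
      · exact Or.inl ⟨c, Quiver.Path.end_mem_vertices _, rfl⟩
      · exact Or.inr ⟨⟨b, c, e⟩, by simp [pathEdges], hb, h'⟩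

theorem isDirectedPath_of_increasing {u v : W} (p : Quiver.Path u v) : IsDirectedPath p := by
  induction p with
  | nil => simp [IsDirectedPath]
  | cons p e ih =>
    have he := hx e
    simp only [IsDirectedPath, Quiver.Path.vertices_cons, List.concat_eq_append, List.nodup_append]
    refine ⟨ih, by simp, fun a ha b hb hab => ?_⟩
    simp only [List.mem_singleton] at hb
    subst hab hb
    have := (le_of_mem_vertices hx ha).2
    linarith

theorem BPath.lt_of_increasing {u v : W} (p : BPath u v) : x u < x v := by
  induction p with
  | edge e => exact hx e
  | comp p q hp hq => exact hp.trans hq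

end Monotone

theorem eqvGen_of_mem_vertices {W : Type} [Quiver.{0} W] {u v w : W} {p : Quiver.Path u v}
    (h : w ∈ p.vertices) : Relation.EqvGen (fun a b : W => Nonempty (a ⟶ b)) u w := by
  induction p generalizing w with
  | nil =>
    simp only [Quiver.Path.vertices_nil, List.mem_singleton] at h
    subst h
    exact .refl _
  | cons p e ih =>
    rcases (Quiver.Path.mem_vertices_cons _ _).1 h with h | rfl
    · exact ih h
    · exact .trans _ _ _ (ih p.end_mem_vertices) (.rel _ _ ⟨e⟩)

/-! ### Steps between bracketed walks -/

section Step

variable {W : Type*} [Quiver W] {s t : W}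

/-- The replacement, inside the bracketed walk `P`, of a bracketed segment `D` by `E`; the result
is `Q`.  The context `C` is the part of the walk that does not change. -/
structure Step {W : Type*} [Quiver W] {s t : W} (P Q : BPath s t) where
  a : W
  b : W
  D : BPath a b
  E : BPath a b
  C : Context a b s t
  dom_eq : P = C.fill D
  codom_eq : Q = C.fill E

namespace Step

variable {P Q : BPath s t} (S : Step P Q)

/-- The segment that is replaced and the segment that replaces it. -/
def pair : ParBPath W := ⟨S.a, S.b, S.D, S.E⟩

theorem mem_vertices_dom_iff {v : W} : v ∈ P.toPath.vertices ↔
    v ∈ S.C.leftPath.vertices ∨ v ∈ S.D.toPath.vertices ∨ v ∈ S.C.rightPath.vertices := by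
  conv_lhs => rw [S.dom_eq, Context.toPath_fill, mem_vertices_comp, mem_vertices_comp]

theorem mem_vertices_codom_iff {v : W} : v ∈ Q.toPath.vertices ↔
    v ∈ S.C.leftPath.vertices ∨ v ∈ S.E.toPath.vertices ∨ v ∈ S.C.rightPath.vertices := by
  conv_lhs => rw [S.codom_eq, Context.toPath_fill, mem_vertices_comp, mem_vertices_comp]

theorem pathEdges_dom : pathEdges P.toPath =
    pathEdges S.C.leftPath ++ (pathEdges S.D.toPath ++ pathEdges S.C.rightPath) := by
  conv_lhs => rw [S.dom_eq, Context.toPath_fill, pathEdges_comp, pathEdges_comp]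

theorem pathEdges_codom : pathEdges Q.toPath =
    pathEdges S.C.leftPath ++ (pathEdges S.E.toPath ++ pathEdges S.C.rightPath) := by
  conv_lhs => rw [S.codom_eq, Context.toPath_fill, pathEdges_comp, pathEdges_comp]

theorem mem_vertices_dom {v : W} (h : v ∈ S.D.toPath.vertices) : v ∈ P.toPath.vertices :=
  S.mem_vertices_dom_iff.2 (Or.inr (Or.inl h))

theorem mem_vertices_codom {v : W} (h : v ∈ S.E.toPath.vertices) : v ∈ Q.toPath.vertices :=
  S.mem_vertices_codom_iff.2 (Or.inr (Or.inl h))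

theorem mem_edges_dom {e : Quiver.Total W} (h : e ∈ pathEdges S.D.toPath) :
    e ∈ pathEdges P.toPath := by
  simp [S.pathEdges_dom, h]

theorem mem_edges_codom {e : Quiver.Total W} (h : e ∈ pathEdges S.E.toPath) :
    e ∈ pathEdges Q.toPath := by
  simp [S.pathEdges_codom, h]

theorem left_mem_vertices_dom : S.a ∈ P.toPath.vertices :=
  S.mem_vertices_dom (Quiver.Path.start_mem_vertices _)

theorem right_mem_vertices_dom : S.b ∈ P.toPath.vertices :=
  S.mem_vertices_dom (Quiver.Path.end_mem_vertices _)

/-- A vertex of the new walk is on the new segment, or it is an old vertex that does not lie over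
the interior of that segment. -/
theorem vertex_cases {x : W → ℝ} (hx : ∀ {u v : W} (_ : u ⟶ v), x u < x v) {v : W}
    (h : v ∈ Q.toPath.vertices) :
    v ∈ S.E.toPath.vertices ∨ v ∈ P.toPath.vertices ∧ (x v ≤ x S.a ∨ x S.b ≤ x v) := by
  rw [S.mem_vertices_codom_iff] at h
  rw [S.mem_vertices_dom_iff]
  rcases h with h | h | h
  · exact Or.inr ⟨Or.inl h, Or.inl (le_of_mem_vertices hx h).2⟩
  · exact Or.inl h
  · exact Or.inr ⟨Or.inr (Or.inr h), Or.inr (le_of_mem_vertices hx h).1⟩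

/-- An edge of the new walk is on the new segment, or it is an old edge that does not lie over the
interior of that segment. -/
theorem edge_cases {x : W → ℝ} (hx : ∀ {u v : W} (_ : u ⟶ v), x u < x v) {e : Quiver.Total W}
    (h : e ∈ pathEdges Q.toPath) :
    e ∈ pathEdges S.E.toPath ∨
      e ∈ pathEdges P.toPath ∧ (x e.right ≤ x S.a ∨ x S.b ≤ x e.left) := by
  rw [S.pathEdges_codom] at h
  rw [S.pathEdges_dom]
  simp only [List.mem_append] at h ⊢
  rcases h with h | h | h
  · exact Or.inr ⟨Or.inl h, Or.inl (le_of_mem_pathEdges hx h).2⟩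
  · exact Or.inl h
  · exact Or.inr ⟨Or.inr (Or.inr h), Or.inr (le_of_mem_pathEdges hx h).1⟩

theorem edge_cases_dom {e : Quiver.Total W} (h : e ∈ pathEdges P.toPath) :
    e ∈ pathEdges S.D.toPath ∨ e ∈ pathEdges Q.toPath := by
  rw [S.pathEdges_dom] at h
  rw [S.pathEdges_codom]
  simp only [List.mem_append] at h ⊢
  tauto

end Step

end Step

/-! ### Layouts -/

/-- A sequence of bracketed walks `row 0, …, row n` with common end points, each of which arises
from the preceding one by the replacement of a segment by a new one, which shares no edge and,
except for its end points, no vertex with the rows before it. The function `x`, which increases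
along each edge, will be the horizontal coordinate of the vertices in a drawing. -/
structure RowSequence (W : Type) [Quiver.{0} W] (n : ℕ) where
  s : W
  t : W
  row : ℕ → BPath s t
  step : ∀ i : Fin n, Step (row i.1) (row (i.1 + 1))
  x : W → ℝ
  x_lt : ∀ {u v : W} (_ : u ⟶ v), x u < x v
  vfresh : ∀ (i : Fin n) (v), v ∈ (step i).E.toPath.vertices → ∀ j ≤ i.1,
    v ∈ (row j).toPath.vertices → v = (step i).a ∨ v = (step i).b
  efresh : ∀ (i : Fin n) (e), e ∈ pathEdges (step i).E.toPath → ∀ j ≤ i.1,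
    e ∉ pathEdges (row j).toPath

/-- A sequence of rows that contain all vertices and edges of the graph. -/
structure Layout (W : Type) [Quiver.{0} W] (n : ℕ) extends RowSequence W n where
  vcover : ∀ v, ∃ j ≤ n, v ∈ (row j).toPath.vertices
  ecover : ∀ e, ∃ j ≤ n, e ∈ pathEdges (row j).toPath

namespace Layout

variable {W : Type} [Quiver.{0} W] {n : ℕ} (L : Layout W n)

theorem lt (i : Fin n) : L.x (L.step i).a < L.x (L.step i).b := (L.step i).D.lt_of_increasing L.x_lt

theorem s_lt_t : L.x L.s < L.x L.t := (L.row 0).lt_of_increasing L.x_lt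

theorem le_of_mem (v : W) : L.x L.s ≤ L.x v ∧ L.x v ≤ L.x L.t := by
  obtain ⟨j, -, h⟩ := L.vcover v
  exact le_of_mem_vertices L.x_lt h

section Level

open Classical

/-- The first row that contains the vertex. -/
noncomputable def vlev (v : W) : ℕ := Nat.find (L.vcover v)

/-- The first row that contains the edge. -/
noncomputable def elev (e : Quiver.Total W) : ℕ := Nat.find (L.ecover e)

theorem vlev_le (v : W) : L.vlev v ≤ n := (Nat.find_spec (L.vcover v)).1

theorem elev_le (e : Quiver.Total W) : L.elev e ≤ n := (Nat.find_spec (L.ecover e)).1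

theorem mem_vlev (v : W) : v ∈ (L.row (L.vlev v)).toPath.vertices :=
  (Nat.find_spec (L.vcover v)).2

theorem mem_elev (e : Quiver.Total W) : e ∈ pathEdges (L.row (L.elev e)).toPath :=
  (Nat.find_spec (L.ecover e)).2

theorem vlev_le_of_mem {v : W} {j : ℕ} (hj : j ≤ n) (h : v ∈ (L.row j).toPath.vertices) :
    L.vlev v ≤ j := Nat.find_min' _ ⟨hj, h⟩

theorem elev_le_of_mem {e : Quiver.Total W} {j : ℕ} (hj : j ≤ n)
    (h : e ∈ pathEdges (L.row j).toPath) : L.elev e ≤ j := Nat.find_min' _ ⟨hj, h⟩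

/-- A vertex that is new in row `i + 1` lies strictly inside the `i`-th new segment. -/
theorem between_of_vlev_eq {v : W} (i : Fin n) (h : L.vlev v = i.1 + 1) :
    L.x (L.step i).a < L.x v ∧ L.x v < L.x (L.step i).b := by
  have hv := L.mem_vlev v
  rw [h] at hv
  have hn : v ∉ (L.row i.1).toPath.vertices := fun h' => by
    have := L.vlev_le_of_mem i.2.le h'
    omega
  rcases (L.step i).vertex_cases L.x_lt hv with hv | hv
  · obtain ⟨h₁, h₂⟩ := le_of_mem_vertices L.x_lt hv
    refine ⟨lt_of_le_of_ne h₁ fun h => hn ?_, lt_of_le_of_ne h₂ fun h => hn ?_⟩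
    · rw [← vertex_eq_of_x_eq L.x_lt (Quiver.Path.start_mem_vertices _) hv h]
      exact (L.step i).left_mem_vertices_dom
    · rw [vertex_eq_of_x_eq L.x_lt hv (Quiver.Path.end_mem_vertices _) h]
      exact (L.step i).right_mem_vertices_dom
  · exact absurd hv.1 hn

theorem between_of_elev_eq {e : Quiver.Total W} (i : Fin n) (h : L.elev e = i.1 + 1) :
    L.x (L.step i).a ≤ L.x e.left ∧ L.x e.right ≤ L.x (L.step i).b := by
  have he := L.mem_elev e
  rw [h] at he
  rcases (L.step i).edge_cases L.x_lt he with he | he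
  · exact le_of_mem_pathEdges L.x_lt he
  · have := L.elev_le_of_mem i.2.le he.1
    omega

theorem elev_eq_of_mem_codom {e : Quiver.Total W} (i : Fin n)
    (h : e ∈ pathEdges (L.step i).E.toPath) : L.elev e = i.1 + 1 := by
  refine le_antisymm (L.elev_le_of_mem i.2 ((L.step i).mem_edges_codom h)) ?_
  by_contra hlt
  exact L.efresh i e h _ (by omega) (L.mem_elev e)

/-- The rows that contain a given edge are consecutive. -/
theorem mem_row_of_le {e : Quiver.Total W} {j k : ℕ} (hk : k ≤ n)
    (h : e ∈ pathEdges (L.row k).toPath) (hj : L.elev e ≤ j) (hjk : j ≤ k) :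
    e ∈ pathEdges (L.row j).toPath := by
  induction k with
  | zero => rwa [Nat.le_zero.1 hjk]
  | succ k ih =>
    rcases Nat.le_succ_iff.1 hjk with h' | rfl
    · rcases (L.step ⟨k, hk⟩).edge_cases L.x_lt h with h | h
      · have := L.elev_eq_of_mem_codom ⟨k, hk⟩ h
        simp only at this
        omega
      · exact ih (by omega) h.1 h'
    · exact h

theorem nodup_row (j : ℕ) : (pathEdges (L.row j).toPath).Nodup :=
  nodup_pathEdges (isDirectedPath_of_increasing L.x_lt _)

theorem not_mem_row_succ {e : Quiver.Total W} (i : Fin n) (h : e ∈ pathEdges (L.step i).D.toPath) :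
    e ∉ pathEdges (L.row (i.1 + 1)).toPath := by
  intro h'
  have hn := L.nodup_row i.1
  have he : e ∉ pathEdges (L.step i).E.toPath :=
    fun h'' => L.efresh i e h'' i.1 le_rfl ((L.step i).mem_edges_dom h)
  rw [(L.step i).pathEdges_codom] at h'
  rw [(L.step i).pathEdges_dom] at hn
  simp only [List.nodup_append, List.mem_append] at hn h'
  rcases h' with h' | h' | h'
  · exact hn.2.2 e h' e (Or.inl h) rfl
  · exact he h'
  · exact hn.2.1.2.2 e h e h' rfl

theorem not_mem_row_of_lt {e : Quiver.Total W} (i : Fin n) {k : ℕ} (hk : k ≤ n)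
    (h : e ∈ pathEdges (L.step i).D.toPath) (hik : i.1 < k) :
    e ∉ pathEdges (L.row k).toPath := fun h' =>
  L.not_mem_row_succ i h (L.mem_row_of_le hk h'
    ((L.elev_le_of_mem i.2.le ((L.step i).mem_edges_dom h)).trans (by omega)) hik)

/-- Each edge is in the codomain of the graph or in the domain of a step, but not in two of them. -/
theorem existsUnique_dom (e : Quiver.Total W) : ∃! F : Option (Fin n),
    e ∈ F.elim (pathEdges (L.row n).toPath) fun i => pathEdges (L.step i).D.toPath := by
  have key : ∀ k, k ≤ n → e ∈ pathEdges (L.row (n - k)).toPath → ∃ F : Option (Fin n),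
      e ∈ F.elim (pathEdges (L.row n).toPath) fun i => pathEdges (L.step i).D.toPath := by
    intro k
    induction k with
    | zero => exact fun _ h => ⟨none, h⟩
    | succ k ih =>
      intro hk h
      rcases (L.step ⟨n - (k + 1), by omega⟩).edge_cases_dom h with h | h
      · exact ⟨some ⟨n - (k + 1), by omega⟩, h⟩
      · refine ih (by omega) ?_
        have : n - k = n - (k + 1) + 1 := by omega
        rwa [this]
  obtain ⟨F, hF⟩ := key (n - L.elev e) (by omega) (by
    have : n - (n - L.elev e) = L.elev e := by have := L.elev_le e; omega
    rw [this]
    exact L.mem_elev e)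
  refine ⟨F, hF, fun F' hF' => ?_⟩
  rcases F with _ | i <;> rcases F' with _ | j
  · rfl
  · exact absurd hF (L.not_mem_row_of_lt j le_rfl hF' j.2)
  · exact absurd hF' (L.not_mem_row_of_lt i le_rfl hF i.2)
  · rcases lt_trichotomy i j with h | h | h
    · exact absurd ((L.step j).mem_edges_dom hF') (L.not_mem_row_of_lt i j.2.le hF h)
    · rw [h]
    · exact absurd ((L.step i).mem_edges_dom hF) (L.not_mem_row_of_lt j i.2.le hF' h)

/-- Each edge is in the domain of the graph or in the codomain of a step, but not in two of them. -/
theorem existsUnique_codom (e : Quiver.Total W) : ∃! F : Option (Fin n),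
    e ∈ F.elim (pathEdges (L.row 0).toPath) fun i => pathEdges (L.step i).E.toPath := by
  have hlev : ∀ F : Option (Fin n),
      e ∈ F.elim (pathEdges (L.row 0).toPath) (fun i => pathEdges (L.step i).E.toPath) →
      L.elev e = F.elim 0 fun i => i.1 + 1 := by
    rintro (_ | i) h
    · exact Nat.le_zero.1 (L.elev_le_of_mem (Nat.zero_le _) h)
    · exact L.elev_eq_of_mem_codom i h
  obtain ⟨F, hF⟩ : ∃ F : Option (Fin n),
      e ∈ F.elim (pathEdges (L.row 0).toPath) fun i => pathEdges (L.step i).E.toPath := by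
    have h := L.mem_elev e
    have hn := L.elev_le e
    rcases hl : L.elev e with _ | k
    · exact ⟨none, by rwa [hl] at h⟩
    · rw [hl] at h hn
      rcases (L.step ⟨k, hn⟩).edge_cases L.x_lt h with h | h
      · exact ⟨some ⟨k, hn⟩, h⟩
      · have : L.elev e ≤ k := L.elev_le_of_mem (Nat.le_of_succ_le hn) h.1
        omega
  refine ⟨F, hF, fun F' hF' => ?_⟩
  have h₁ := hlev F hF
  have h₂ := hlev F' hF'
  rw [h₁] at h₂
  rcases F with _ | i <;> rcases F' with _ | j <;> simp at h₂
  · rfl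
  · rw [Fin.ext h₂]

end Level

/-! ### The heights of the rows -/

section Height

/-- A continuous function that is positive exactly over the interior of the `i`-th segment. -/
noncomputable def bump (i : ℕ) (X : ℝ) : ℝ :=
  if h : i < n then max 0 ((X - L.x (L.step ⟨i, h⟩).a) * (L.x (L.step ⟨i, h⟩).b - X)) else 0

/-- The function whose graph is the drawing of row `k`. -/
noncomputable def height (k : ℕ) (X : ℝ) : ℝ := -∑ i ∈ Finset.range k, L.bump i X

theorem continuous_bump (i : ℕ) : Continuous (L.bump i) := by
  unfold bump
  split <;> fun_prop

theorem continuous_height (k : ℕ) : Continuous (L.height k) := by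
  unfold height
  exact (continuous_finsetSum _ fun i _ => L.continuous_bump i).neg

theorem height_succ (k : ℕ) (X : ℝ) : L.height (k + 1) X = L.height k X - L.bump k X := by
  simp only [height, Finset.sum_range_succ]
  ring

theorem bump_nonneg (i : ℕ) (X : ℝ) : 0 ≤ L.bump i X := by
  unfold bump
  split
  · exact le_max_left _ _
  · exact le_rfl

theorem bump_pos_iff (i : Fin n) (X : ℝ) :
    0 < L.bump i X ↔ L.x (L.step i).a < X ∧ X < L.x (L.step i).b := by
  have h := L.lt i
  simp only [bump, i.2, dif_pos, lt_max_iff, lt_irrefl, false_or]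
  constructor
  · intro h'
    rcases mul_pos_iff.1 h' with h' | h'
    · exact ⟨sub_pos.1 h'.1, sub_pos.1 h'.2⟩
    · have h₁ := sub_neg.1 h'.1
      have h₂ := sub_neg.1 h'.2
      exact absurd (h₁.trans h) (h₂.le.not_gt)
  · exact fun h' => mul_pos (sub_pos.2 h'.1) (sub_pos.2 h'.2)

theorem bump_eq_zero (i : Fin n) {X : ℝ} (h : X ≤ L.x (L.step i).a ∨ L.x (L.step i).b ≤ X) :
    L.bump i X = 0 := by
  refine le_antisymm (not_lt.1 fun h' => ?_) (L.bump_nonneg _ _)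
  obtain ⟨h₁, h₂⟩ := (L.bump_pos_iff i X).1 h'
  rcases h with h | h <;> linarith

theorem height_antitone (X : ℝ) : Antitone fun k => L.height k X :=
  antitone_nat_of_succ_le fun k => by
    have := L.bump_nonneg k X
    simp only [height_succ]
    linarith

theorem height_succ_lt_iff (i : Fin n) (X : ℝ) : L.height (i + 1) X < L.height i X ↔
    L.x (L.step i).a < X ∧ X < L.x (L.step i).b := by
  rw [height_succ, ← bump_pos_iff]
  constructor <;> intro h <;> linarith

theorem height_succ_eq (i : Fin n) {X : ℝ} (h : X ≤ L.x (L.step i).a ∨ L.x (L.step i).b ≤ X) :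
    L.height (i + 1) X = L.height i X := by
  rw [height_succ, bump_eq_zero L i h, sub_zero]

/-- The height of a vertex can be read off from any row that contains it. -/
theorem height_eq_vlev {v : W} {k : ℕ} (hk : k ≤ n) (h : v ∈ (L.row k).toPath.vertices) :
    L.height k (L.x v) = L.height (L.vlev v) (L.x v) := by
  induction k with
  | zero => rw [Nat.le_zero.1 (L.vlev_le_of_mem hk h)]
  | succ k ih =>
    rcases Nat.le_succ_iff.1 (L.vlev_le_of_mem hk h) with hl | hl
    · have hout : v ∈ (L.row k).toPath.vertices ∧
          (L.x v ≤ L.x (L.step ⟨k, hk⟩).a ∨ L.x (L.step ⟨k, hk⟩).b ≤ L.x v) := by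
        rcases (L.step ⟨k, hk⟩).vertex_cases L.x_lt h with h | h
        · rcases L.vfresh ⟨k, hk⟩ v h (L.vlev v) hl (L.mem_vlev v) with h | h
          · rw [h]
            exact ⟨(L.step ⟨k, hk⟩).left_mem_vertices_dom, Or.inl le_rfl⟩
          · rw [h]
            exact ⟨(L.step ⟨k, hk⟩).right_mem_vertices_dom, Or.inr le_rfl⟩
        · exact h
      rw [L.height_succ_eq ⟨k, hk⟩ hout.2]
      exact ih (by omega) hout.1
    · rw [hl]

/-- The height of a point of an edge can be read off from any row that contains the edge. -/
theorem height_eq_elev {e : Quiver.Total W} {k : ℕ} (hk : k ≤ n)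
    (h : e ∈ pathEdges (L.row k).toPath) {X : ℝ} (h₁ : L.x e.left ≤ X) (h₂ : X ≤ L.x e.right) :
    L.height k X = L.height (L.elev e) X := by
  induction k with
  | zero => rw [Nat.le_zero.1 (L.elev_le_of_mem hk h)]
  | succ k ih =>
    rcases Nat.le_succ_iff.1 (L.elev_le_of_mem hk h) with hl | hl
    · rcases (L.step ⟨k, hk⟩).edge_cases L.x_lt h with h | h
      · exact absurd (L.mem_elev e) (L.efresh ⟨k, hk⟩ e h _ hl)
      · rw [L.height_succ_eq ⟨k, hk⟩ (h.2.imp h₂.trans fun h => h.trans h₁)]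
        exact ih (by omega) h.1
    · rw [hl]

/-- If row `j` and row `k` have the same height over `X`, and row `k` lies strictly below the row
before it there, then `k` is the first of the rows with this height; in particular `k ≤ j`. -/
theorem level_le {j k : ℕ} {X : ℝ} (hk : k ≤ n)
    (hX : ∀ i : Fin n, k = i.1 + 1 → L.x (L.step i).a < X ∧ X < L.x (L.step i).b)
    (h : L.height j X = L.height k X) : k ≤ j := by
  by_contra hlt
  obtain ⟨i, rfl⟩ : ∃ i, k = i + 1 := ⟨k - 1, by omega⟩
  have h₁ := (L.height_succ_lt_iff ⟨i, hk⟩ X).2 (hX ⟨i, hk⟩ rfl)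
  have h₂ := L.height_antitone X (show j ≤ i by omega)
  simp only at h₁ h₂
  linarith

end Height

/-! ### The drawing of a layout -/

section Drawing

include L in
theorem finite_vertices : Finite W := by
  have : (Set.univ : Set W) ⊆ ⋃ j : Fin (n + 1), {v | v ∈ (L.row j).toPath.vertices} := by
    intro v _
    obtain ⟨j, hj, h⟩ := L.vcover v
    exact Set.mem_iUnion.2 ⟨⟨j, by omega⟩, h⟩
  exact Set.finite_univ_iff.1 ((Set.finite_iUnion fun j => List.finite_toSet _).subset this)

include L in
theorem finite_edges : Finite (Quiver.Total W) := by
  have : (Set.univ : Set (Quiver.Total W)) ⊆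
      ⋃ j : Fin (n + 1), {e | e ∈ pathEdges (L.row j).toPath} := by
    intro v _
    obtain ⟨j, hj, h⟩ := L.ecover v
    exact Set.mem_iUnion.2 ⟨⟨j, by omega⟩, h⟩
  exact Set.finite_univ_iff.1 ((Set.finite_iUnion fun j => List.finite_toSet _).subset this)

theorem exists_mem_pathEdges {a b : W} (p : BPath a b) : ∃ e, e ∈ pathEdges p.toPath :=
  List.exists_mem_of_length_pos p.length_pos

/-- The underlying graph of a layout with at least one step. -/
def toGraph (hn : 0 < n) : Graph where
  V := W
  finite_V := L.finite_vertices
  finite_E := L.finite_edges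
  two_le_V := by
    have := L.finite_vertices
    have : Nontrivial W := ⟨L.s, L.t, fun h => L.s_lt_t.ne (congrArg L.x h)⟩
    exact Finite.one_lt_card
  two_le_E := by
    have := L.finite_edges
    obtain ⟨e, he⟩ := exists_mem_pathEdges (L.row 0)
    obtain ⟨f, hf⟩ := exists_mem_pathEdges (L.step ⟨0, hn⟩).E
    -- The new segment of the first step contributes an edge that is not in row `0`.
    have : Nontrivial (Quiver.Total W) :=
      ⟨e, f, fun h => L.efresh ⟨0, hn⟩ f hf 0 le_rfl (h ▸ he)⟩
    exact Finite.one_lt_card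

variable (hn : 0 < n)

/-- The drawing on the disjoint union of the cells. -/
noncomputable def drawCells : (L.toGraph hn).Cells → ℂ :=
  Sum.elim (fun v => ⟨L.x v.1, L.height (L.vlev v.1) (L.x v.1)⟩)
    fun p => ⟨L.x p.1.left + p.2 * (L.x p.1.right - L.x p.1.left),
      L.height (L.elev p.1) (L.x p.1.left + p.2 * (L.x p.1.right - L.x p.1.left))⟩

/-- The drawing of the graph: each row is drawn as the graph of a function. -/
noncomputable def draw : (L.toGraph hn).Realization → ℂ :=
  Quot.lift (L.drawCells hn) (by
    rintro _ _ (e | e)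
    · have h := L.height_eq_vlev (L.elev_le e) (left_mem_vertices (L.mem_elev e))
      apply Complex.ext <;> simp [drawCells, h]
    · have h := L.height_eq_vlev (L.elev_le e) (right_mem_vertices (L.mem_elev e))
      apply Complex.ext <;> simp [drawCells, h])

theorem continuous_draw : Continuous (L.draw hn) := by
  refine continuous_quot_lift _ ?_
  refine continuous_sum_dom.2 ⟨?_, ?_⟩
  · exact continuous_sigma fun v => continuous_of_const fun _ _ => rfl
  · refine continuous_sigma fun e => ?_
    exact continuous_complex_mk (by fun_prop)
      ((L.continuous_height (L.elev e)).comp (by fun_prop))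

/-- Each point of the realization is a vertex or an interior point of an edge. -/
theorem realization_cases (p : (L.toGraph hn).Realization) :
    (∃ v : W, p = Quot.mk _ (.inl ⟨v, ()⟩)) ∨
      ∃ (e : Quiver.Total W) (t : unitInterval), (0 < (t : ℝ) ∧ (t : ℝ) < 1) ∧
        p = Quot.mk _ (.inr ⟨e, t⟩) := by
  induction p using Quot.ind with
  | mk p =>
    rcases p with ⟨v, ⟨⟩⟩ | ⟨e, t⟩
    · exact Or.inl ⟨v, rfl⟩
    · rcases eq_or_lt_of_le t.2.1 with h₀ | h₀
      · have : t = 0 := Subtype.ext h₀.symm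
        subst this
        exact Or.inl ⟨e.left, (Quot.sound (Graph.Glue.tail (G := L.toGraph hn) e)).symm⟩
      · rcases eq_or_lt_of_le t.2.2 with h₁ | h₁
        · have : t = 1 := Subtype.ext h₁
          subst this
          exact Or.inl ⟨e.right, Quot.sound (Graph.Glue.head (G := L.toGraph hn) e)⟩
        · exact Or.inr ⟨e, t, ⟨h₀, h₁⟩, rfl⟩

theorem between_of_param {α β t : ℝ} (h : α < β) (h₀ : 0 < t) (h₁ : t < 1) :
    α < α + t * (β - α) ∧ α + t * (β - α) < β := by
  have h₂ := mul_pos h₀ (sub_pos.2 h)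
  have h₃ := mul_lt_mul_of_pos_right h₁ (sub_pos.2 h)
  constructor <;> linarith

/-- Two cells over the same point at the same height have the same level by `level_le`, and hence
are cells of one row; but a row has only one cell over each point. -/
theorem injective_draw : Function.Injective (L.draw hn) := by
  have hvE : ∀ (v : W) (i : Fin n), L.vlev v = i.1 + 1 →
      L.x (L.step i).a < L.x v ∧ L.x v < L.x (L.step i).b := fun v i => L.between_of_vlev_eq i
  have heE : ∀ (e : Quiver.Total W) {X : ℝ} (_ : L.x e.left < X ∧ X < L.x e.right) (i : Fin n),
      L.elev e = i.1 + 1 → L.x (L.step i).a < X ∧ X < L.x (L.step i).b := fun e X hX i hi =>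
    have := L.between_of_elev_eq i hi
    ⟨this.1.trans_lt hX.1, hX.2.trans_le this.2⟩
  have hve : ∀ (v : W) (e : Quiver.Total W) (t : unitInterval), (0 < (t : ℝ) ∧ (t : ℝ) < 1) →
      L.draw hn (Quot.mk _ (.inl ⟨v, ()⟩)) ≠ L.draw hn (Quot.mk _ (.inr ⟨e, t⟩)) := by
    intro v e t ht h
    have hX := between_of_param (L.x_lt e.hom) ht.1 ht.2
    have h₁ : L.x v = L.x e.left + t * (L.x e.right - L.x e.left) := congrArg Complex.re h
    have h₂ : L.height (L.vlev v) (L.x v) = L.height (L.elev e) _ := congrArg Complex.im h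
    rw [← h₁] at h₂ hX
    have hl : L.vlev v = L.elev e := le_antisymm (L.level_le (L.vlev_le v) (hvE v) h₂.symm)
      (L.level_le (L.elev_le e) (heE e hX) h₂)
    have hm := L.mem_vlev v
    rw [hl] at hm
    rcases not_between_of_mem L.x_lt hm (L.mem_elev e) with h | h <;> linarith
  intro p q h
  rcases L.realization_cases hn p with ⟨v, rfl⟩ | ⟨e, t, ht, rfl⟩ <;>
  rcases L.realization_cases hn q with ⟨w, rfl⟩ | ⟨f, u, hu, rfl⟩
  · have h₁ : L.x v = L.x w := congrArg Complex.re h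
    have h₂ : L.height (L.vlev v) (L.x v) = L.height (L.vlev w) (L.x w) := congrArg Complex.im h
    have hw := hvE w
    rw [← h₁] at h₂ hw
    have hl : L.vlev v = L.vlev w := le_antisymm (L.level_le (L.vlev_le v) (hvE v) h₂.symm)
      (L.level_le (L.vlev_le w) hw h₂)
    have hm := L.mem_vlev v
    rw [hl] at hm
    rw [vertex_eq_of_x_eq L.x_lt hm (L.mem_vlev w) h₁]
  · exact absurd h (hve v f u hu)
  · exact absurd h.symm (hve w e t ht)
  · have hX := between_of_param (L.x_lt e.hom) ht.1 ht.2
    have hY := between_of_param (L.x_lt f.hom) hu.1 hu.2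
    have h₁ : L.x e.left + t * (L.x e.right - L.x e.left) =
      L.x f.left + u * (L.x f.right - L.x f.left) := congrArg Complex.re h
    have h₂ : L.height (L.elev e) _ = L.height (L.elev f) _ := congrArg Complex.im h
    rw [← h₁] at h₂ hY
    have hl : L.elev e = L.elev f := le_antisymm (L.level_le (L.elev_le e) (heE e hX) h₂.symm)
      (L.level_le (L.elev_le f) (heE f hY) h₂)
    have hm := L.mem_elev e
    rw [hl] at hm
    obtain rfl := edge_eq_of_between L.x_lt hm (L.mem_elev f) hX hY
    have hpos := sub_pos.2 (L.x_lt e.hom)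
    have : (t : ℝ) = u := mul_right_cancel₀ hpos.ne' (by linarith)
    rw [Subtype.ext this]

theorem isEmbedding_draw : IsEmbedding (L.draw hn) := by
  have := L.finite_vertices
  have := L.finite_edges
  have : Finite (L.toGraph hn).V := (L.toGraph hn).finite_V
  have : Finite (Quiver.Total (L.toGraph hn).V) := (L.toGraph hn).finite_E
  have : CompactSpace (L.toGraph hn).Realization := inferInstance
  exact ((L.continuous_draw hn).isClosedEmbedding (L.injective_draw hn)).isEmbedding

/-- The plane graph underlying a layout with at least one step. -/
noncomputable def toPlaneGraph : PlaneGraph where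
  toGraph := L.toGraph hn
  connected := fun u v => by
    have h : ∀ w : W, Relation.EqvGen (fun a b : W => Nonempty (a ⟶ b)) L.s w := fun w => by
      obtain ⟨j, -, hj⟩ := L.vcover w
      exact eqvGen_of_mem_vertices hj
    exact .trans _ _ _ (.symm _ _ (h u)) (h v)
  emb := L.draw hn
  isEmbedding := L.isEmbedding_draw hn

/-- The image of the drawing is the union of the graphs of the height functions. -/
theorem mem_range_draw (z : ℂ) : z ∈ Set.range (L.draw hn) ↔
    (L.x L.s ≤ z.re ∧ z.re ≤ L.x L.t) ∧ ∃ k ≤ n, z.im = L.height k z.re := by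
  constructor
  · rintro ⟨p, rfl⟩
    rcases L.realization_cases hn p with ⟨v, rfl⟩ | ⟨e, t, ht, rfl⟩
    · exact ⟨L.le_of_mem v, _, L.vlev_le v, rfl⟩
    · have hX := between_of_param (L.x_lt e.hom) ht.1 ht.2
      exact ⟨⟨(L.le_of_mem e.left).1.trans hX.1.le, hX.2.le.trans (L.le_of_mem e.right).2⟩, _,
        L.elev_le e, rfl⟩
  · rintro ⟨⟨h₁, h₂⟩, k, hk, h⟩
    rcases exists_cell_over (L.row k).toPath h₁ h₂ with ⟨v, hv, hX⟩ | ⟨e, he, hX⟩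
    · refine ⟨Quot.mk _ (.inl ⟨v, ()⟩), Complex.ext hX ?_⟩
      rw [h, ← hX]
      exact (L.height_eq_vlev hk hv).symm
    · have hpos := sub_pos.2 (L.x_lt e.hom)
      have ht : L.x e.left + (z.re - L.x e.left) / (L.x e.right - L.x e.left) *
          (L.x e.right - L.x e.left) = z.re := by
        rw [div_mul_cancel₀ _ hpos.ne']
        ring
      refine ⟨Quot.mk _ (.inr ⟨e, ⟨(z.re - L.x e.left) / (L.x e.right - L.x e.left),
        div_nonneg (by linarith) hpos.le, (div_le_one hpos).2 (by linarith)⟩⟩),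
        Complex.ext ht ?_⟩
      change L.height (L.elev e) (_ + _ * _) = _
      rw [ht, h]
      exact (L.height_eq_elev hk he hX.1.le hX.2.le).symm

end Drawing

/-! ### The faces of the drawing -/

section Regions

/-- The components of the complement of the drawing: `some i` is the open region between row `i` and
row `i + 1`, and `none` is the region outside all rows. -/
def chamber : Option (Fin n) → Set ℂ
  | none => {z | z.re < L.x L.s ∨ L.x L.t < z.re ∨ L.height 0 z.re < z.im ∨
      z.im < L.height n z.re}
  | some i => {z | (L.x (L.step i).a < z.re ∧ z.re < L.x (L.step i).b) ∧
      L.height (i.1 + 1) z.re < z.im ∧ z.im < L.height i.1 z.re}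

theorem isOpen_chamber (o : Option (Fin n)) : IsOpen (L.chamber o) := by
  have hre : ∀ k, Continuous fun z : ℂ => L.height k z.re := fun k =>
    (L.continuous_height k).comp Complex.continuous_re
  rcases o with _ | i
  · exact (isOpen_lt Complex.continuous_re continuous_const).union
      ((isOpen_lt continuous_const Complex.continuous_re).union
        ((isOpen_lt (hre 0) Complex.continuous_im).union
          (isOpen_lt Complex.continuous_im (hre n))))
  · exact ((isOpen_lt continuous_const Complex.continuous_re).inter
      (isOpen_lt Complex.continuous_re continuous_const)).inter
        ((isOpen_lt (hre _) Complex.continuous_im).inter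
          (isOpen_lt Complex.continuous_im (hre _)))

theorem isPreconnected_chamber (o : Option (Fin n)) : IsPreconnected (L.chamber o) := by
  rcases o with _ | i
  · exact isPreconnected_outside (L.continuous_height n) (L.continuous_height 0)
  · exact isPreconnected_between (L.continuous_height _) (L.continuous_height _)
      fun X h₁ h₂ => (L.height_succ_lt_iff i X).2 ⟨h₁, h₂⟩

theorem disjoint_chamber (o o' : Option (Fin n)) (h : o ≠ o') :
    Disjoint (L.chamber o) (L.chamber o') := by
  have key : ∀ i : Fin n, Disjoint (L.chamber none) (L.chamber (some i)) := by
    intro i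
    rw [Set.disjoint_left]
    rintro z h ⟨⟨h₁, h₂⟩, h₃, h₄⟩
    have hs := L.le_of_mem (L.step i).a
    have ht := L.le_of_mem (L.step i).b
    have h₅ : L.height i.1 z.re ≤ L.height 0 z.re := L.height_antitone z.re (Nat.zero_le i.1)
    have h₆ : L.height n z.re ≤ L.height (i.1 + 1) z.re := L.height_antitone z.re i.2
    rcases h with h | h | h | h <;> linarith
  have key' : ∀ i j : Fin n, i < j → Disjoint (L.chamber (some i)) (L.chamber (some j)) := by
    intro i j hij
    rw [Set.disjoint_left]
    rintro z ⟨-, h₃, -⟩ ⟨-, -, h₄⟩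
    have h₅ : L.height j.1 z.re ≤ L.height (i.1 + 1) z.re := L.height_antitone z.re hij
    linarith
  rcases o with _ | i <;> rcases o' with _ | j
  · exact absurd rfl h
  · exact key j
  · exact (key i).symm
  · rcases lt_trichotomy i j with h' | h' | h'
    · exact key' i j h'
    · exact absurd (congrArg some h') h
    · exact (key' j i h').symm

variable (hn : 0 < n)

/-- A point that lies between the first and the last row without lying on a row is in the chamber
above the first row below it. -/
theorem complement_eq : (L.toPlaneGraph hn).complement = ⋃ o, L.chamber o := by
  ext z
  have hr : z ∈ (L.toPlaneGraph hn).complement ↔ z ∉ Set.range (L.draw hn) := Iff.rfl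
  rw [hr, mem_range_draw, Set.mem_iUnion]
  constructor
  · intro h
    by_cases hz : z ∈ L.chamber none
    · exact ⟨none, hz⟩
    simp only [chamber, Set.mem_ofPred_eq, not_or, not_lt] at hz
    obtain ⟨h₁, h₂, h₃, h₄⟩ := hz
    have hne : ∀ k ≤ n, z.im ≠ L.height k z.re := fun k hk hk' => h ⟨⟨h₁, h₂⟩, k, hk, hk'⟩
    classical
    have hex : ∃ k, L.height k z.re ≤ z.im := ⟨n, h₄⟩
    have hspec := Nat.find_spec hex
    have hle : Nat.find hex ≤ n := Nat.find_min' hex h₄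
    rcases hk : Nat.find hex with _ | i
    · rw [hk] at hspec
      exact absurd (le_antisymm h₃ hspec) (hne 0 (Nat.zero_le _))
    · rw [hk] at hspec hle
      have h₅ : z.im < L.height i z.re := not_le.1 (Nat.find_min hex (by omega))
      have h₆ : L.height (i + 1) z.re < z.im := lt_of_le_of_ne hspec (hne _ hle).symm
      exact ⟨some ⟨i, hle⟩, (L.height_succ_lt_iff ⟨i, hle⟩ _).1 (h₆.trans h₅), h₆, h₅⟩
  · rintro ⟨_ | i, hz⟩ ⟨⟨h₁, h₂⟩, k, hk, h⟩
    · have h₅ : L.height k z.re ≤ L.height 0 z.re := L.height_antitone z.re (Nat.zero_le k)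
      have h₆ : L.height n z.re ≤ L.height k z.re := L.height_antitone z.re hk
      rcases hz with hz | hz | hz | hz <;> linarith
    · obtain ⟨-, h₃, h₄⟩ := hz
      rcases le_or_gt k i.1 with hki | hki
      · have : L.height i.1 z.re ≤ L.height k z.re := L.height_antitone z.re hki
        linarith
      · have : L.height k z.re ≤ L.height (i.1 + 1) z.re := L.height_antitone z.re hki
        linarith

theorem connectedComponentIn_complement {o : Option (Fin n)} {z : ℂ} (hz : z ∈ L.chamber o) :
    connectedComponentIn (L.toPlaneGraph hn).complement z = L.chamber o :=
  connectedComponentIn_eq_of_partition L.isOpen_chamber L.isPreconnected_chamber L.disjoint_chamber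
    (L.complement_eq hn) hz

theorem isBounded_chamber (i : Fin n) : Bornology.IsBounded (L.chamber (some i)) := by
  obtain ⟨m, hm⟩ := (isCompact_Icc (a := L.x (L.step i).a) (b := L.x (L.step i).b)).bddBelow_image
    (L.continuous_height (i.1 + 1)).continuousOn
  refine ((Metric.isBounded_Icc (L.x (L.step i).a) (L.x (L.step i).b)).reProdIm
    (Metric.isBounded_Icc m 0)).subset ?_
  rintro z ⟨⟨h₁, h₂⟩, h₃, h₄⟩
  refine ⟨⟨h₁.le, h₂.le⟩, (hm ⟨z.re, ⟨h₁.le, h₂.le⟩, rfl⟩).trans h₃.le, ?_⟩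
  have h₅ : L.height i.1 z.re ≤ L.height 0 z.re := L.height_antitone z.re (Nat.zero_le i.1)
  have h₆ : L.height 0 z.re = 0 := by simp [height]
  linarith

theorem not_isBounded_chamber : ¬ Bornology.IsBounded (L.chamber none) := by
  intro h
  obtain ⟨R, hR⟩ := h.exists_norm_le
  have h₁ := hR (⟨-(|R| + |L.x L.s| + 1), 0⟩ : ℂ) (Or.inl (by
    have := neg_abs_le (L.x L.s)
    have := abs_nonneg R
    simp only
    linarith))
  have h₂ := (Complex.abs_re_le_norm (⟨-(|R| + |L.x L.s| + 1), 0⟩ : ℂ)).trans h₁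
  simp only [abs_neg] at h₂
  have h₃ := le_abs_self (|R| + |L.x L.s| + 1)
  have h₄ := le_abs_self R
  have h₅ := abs_nonneg (L.x L.s)
  linarith

theorem nonempty_chamber (i : Fin n) : (L.chamber (some i)).Nonempty := by
  have h := L.lt i
  have hX : L.x (L.step i).a < (L.x (L.step i).a + L.x (L.step i).b) / 2 ∧
      (L.x (L.step i).a + L.x (L.step i).b) / 2 < L.x (L.step i).b := ⟨by linarith, by linarith⟩
  have hY := (L.height_succ_lt_iff i _).2 hX
  exact ⟨⟨(L.x (L.step i).a + L.x (L.step i).b) / 2,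
    (L.height (i.1 + 1) ((L.x (L.step i).a + L.x (L.step i).b) / 2) +
      L.height i.1 ((L.x (L.step i).a + L.x (L.step i).b) / 2)) / 2⟩, hX, by
        simp only; linarith, by simp only; linarith⟩

/-- The interior faces of the drawing correspond to the steps. -/
noncomputable def faceEquiv : Fin n ≃ (L.toPlaneGraph hn).InteriorFace :=
  Equiv.ofBijective
    (fun i => ⟨L.chamber (some i), by
      obtain ⟨z, hz⟩ := L.nonempty_chamber i
      refine ⟨⟨z, ?_, (L.connectedComponentIn_complement hn hz).symm⟩, L.isBounded_chamber i⟩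
      rw [L.complement_eq hn]
      exact Set.mem_iUnion.2 ⟨_, hz⟩⟩) <| by
    constructor
    · intro i j h
      have h' : L.chamber (some i) = L.chamber (some j) := congrArg Subtype.val h
      by_contra hne
      obtain ⟨z, hz⟩ := L.nonempty_chamber i
      exact Set.disjoint_left.1 (L.disjoint_chamber (some i) (some j) (by simpa using hne)) hz
        (h' ▸ hz)
    · rintro ⟨F, ⟨z, hz, rfl⟩, hb⟩
      rw [L.complement_eq hn] at hz
      obtain ⟨_ | i, hi⟩ := Set.mem_iUnion.1 hz
      · rw [L.connectedComponentIn_complement hn hi] at hb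
        exact absurd hb L.not_isBounded_chamber
      · exact ⟨i, Subtype.ext (L.connectedComponentIn_complement hn hi).symm⟩

theorem exterior_eq : (L.toPlaneGraph hn).exterior = L.chamber none := by
  ext z
  constructor
  · rintro ⟨hz, hb⟩
    rw [L.complement_eq hn] at hz
    obtain ⟨_ | i, hi⟩ := Set.mem_iUnion.1 hz
    · exact hi
    · rw [L.connectedComponentIn_complement hn hi] at hb
      exact absurd (L.isBounded_chamber i) hb
  · intro hz
    refine ⟨?_, ?_⟩
    · rw [L.complement_eq hn]
      exact Set.mem_iUnion.2 ⟨_, hz⟩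
    · rw [L.connectedComponentIn_complement hn hz]
      exact L.not_isBounded_chamber

theorem region_eq (F : (L.toPlaneGraph hn).Face) :
    (L.toPlaneGraph hn).region F = L.chamber (F.map (L.faceEquiv hn).symm) := by
  rcases F with _ | F
  · exact L.exterior_eq hn
  · obtain ⟨i, rfl⟩ := (L.faceEquiv hn).surjective F
    simp only [Option.map_some, Equiv.symm_apply_apply]
    rfl

end Regions

/-! ### The anchored graph of a layout -/

section Anchored

variable (hn : 0 < n)

/-- The drawing of a layout, with the rows `0` and `n` and the segments of the steps as anchors. -/
noncomputable def toPreAnchoredGraph : PreAnchoredGraph where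
  toPlaneGraph := L.toPlaneGraph hn
  ext := ⟨L.s, L.t, (L.row 0).toPath, (L.row n).toPath⟩
  face F := ⟨(L.step ((L.faceEquiv hn).symm F)).a, (L.step ((L.faceEquiv hn).symm F)).b,
    (L.step ((L.faceEquiv hn).symm F)).D.toPath, (L.step ((L.faceEquiv hn).symm F)).E.toPath⟩

theorem midpoint_mem (e : Quiver.Total W) : L.x e.left < (L.x e.left + L.x e.right) / 2 ∧
    (L.x e.left + L.x e.right) / 2 < L.x e.right := by
  have := L.x_lt e.hom
  constructor <;> linarith

theorem existsUnique_face {p : Option (Fin n) → Prop} (h : ∃! o, p o) :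
    ∃! F : (L.toPlaneGraph hn).Face, p (F.map (L.faceEquiv hn).symm) := by
  obtain ⟨o, ho, hu⟩ := h
  refine ⟨o.map (L.faceEquiv hn), by simpa [Function.comp_def] using ho, fun F hF => ?_⟩
  rw [← hu _ hF]
  simp [Function.comp_def]

theorem forwardEdges_eq (F : (L.toPlaneGraph hn).Face) :
    (L.toPreAnchoredGraph hn).forwardEdges F = (F.map (L.faceEquiv hn).symm).elim
      (pathEdges (L.row n).toPath) fun i => pathEdges (L.step i).D.toPath := by
  rcases F with _ | F <;> rfl

theorem backwardEdges_eq (F : (L.toPlaneGraph hn).Face) :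
    (L.toPreAnchoredGraph hn).backwardEdges F = (F.map (L.faceEquiv hn).symm).elim
      (pathEdges (L.row 0).toPath) fun i => pathEdges (L.step i).E.toPath := by
  rcases F with _ | F <;> rfl

/-- The drawing of a layout is an anchored graph. -/
noncomputable def toAnchoredGraph : AnchoredGraph where
  toPreAnchoredGraph := L.toPreAnchoredGraph hn
  src_ne_snk := by
    rintro (_ | F) h
    · exact L.s_lt_t.ne (congrArg L.x h)
    · exact (L.lt _).ne (congrArg L.x h)
  isPath_dom F := isDirectedPath_of_increasing L.x_lt _
  isPath_codom F := isDirectedPath_of_increasing L.x_lt _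
  onRight F e he := by
    have hr : (L.toPreAnchoredGraph hn).region F = _ := L.region_eq hn F
    have hX := L.midpoint_mem e
    rw [hr]
    replace he := (congrArg (e ∈ ·) (L.forwardEdges_eq hn F)).mp he
    refine PlaneGraph.onRight_of_graph _ e _ (L.x_lt e.hom) (L.continuous_height (L.elev e))
      (fun t => rfl) ?_
    rcases F with _ | F
    · rw [← L.height_eq_elev le_rfl he hX.1.le hX.2.le]
      filter_upwards [self_mem_nhdsWithin] with ε hε
      exact Or.inr (Or.inr (Or.inr (sub_lt_self _ hε)))
    · change e ∈ pathEdges (L.step ((L.faceEquiv hn).symm F)).D.toPath at he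
      change ∀ᶠ ε : ℝ in 𝓝[>] 0, _ ∈ L.chamber (some ((L.faceEquiv hn).symm F))
      generalize (L.faceEquiv hn).symm F = i at *
      rw [← L.height_eq_elev i.2.le ((L.step i).mem_edges_dom he) hX.1.le hX.2.le]
      obtain ⟨h₁, h₂⟩ := le_of_mem_pathEdges L.x_lt he
      have hY : L.x (L.step i).a < (L.x e.left + L.x e.right) / 2 ∧
        (L.x e.left + L.x e.right) / 2 < L.x (L.step i).b := ⟨by linarith, by linarith⟩
      have hlt := (L.height_succ_lt_iff i _).2 hY
      filter_upwards [Ioo_mem_nhdsGT (sub_pos.2 hlt)] with ε hε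
      exact ⟨hY, by have := hε.2; simp only; linarith, sub_lt_self _ hε.1⟩
  onLeft F e he := by
    have hr : (L.toPreAnchoredGraph hn).region F = _ := L.region_eq hn F
    have hX := L.midpoint_mem e
    rw [hr]
    replace he := (congrArg (e ∈ ·) (L.backwardEdges_eq hn F)).mp he
    refine PlaneGraph.onLeft_of_graph _ e _ (L.x_lt e.hom) (L.continuous_height (L.elev e))
      (fun t => rfl) ?_
    rcases F with _ | F
    · rw [← L.height_eq_elev (Nat.zero_le _) he hX.1.le hX.2.le]
      filter_upwards [self_mem_nhdsWithin] with ε hε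
      exact Or.inr (Or.inr (Or.inl (lt_add_of_pos_right _ hε)))
    · change e ∈ pathEdges (L.step ((L.faceEquiv hn).symm F)).E.toPath at he
      change ∀ᶠ ε : ℝ in 𝓝[>] 0, _ ∈ L.chamber (some ((L.faceEquiv hn).symm F))
      generalize (L.faceEquiv hn).symm F = i at *
      rw [← L.height_eq_elev i.2 ((L.step i).mem_edges_codom he) hX.1.le hX.2.le]
      obtain ⟨h₁, h₂⟩ := le_of_mem_pathEdges L.x_lt he
      have hY : L.x (L.step i).a < (L.x e.left + L.x e.right) / 2 ∧
        (L.x e.left + L.x e.right) / 2 < L.x (L.step i).b := ⟨by linarith, by linarith⟩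
      have hlt := (L.height_succ_lt_iff i _).2 hY
      filter_upwards [Ioo_mem_nhdsGT (sub_pos.2 hlt)] with ε hε
      exact ⟨hY, lt_add_of_pos_right _ hε.1, by have := hε.2; simp only; linarith⟩
  forward_once e := by
    have h := L.existsUnique_face hn (L.existsUnique_dom e)
    simp only [← L.forwardEdges_eq hn] at h
    exact h
  backward_once e := by
    have h := L.existsUnique_face hn (L.existsUnique_codom e)
    simp only [← L.backwardEdges_eq hn] at h
    exact h
  edge_disjoint F e he he' :=
    L.efresh ((L.faceEquiv hn).symm F) e he' _ le_rfl ((L.step _).mem_edges_dom he)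
  vertex_disjoint F v hv hv' :=
    L.vfresh ((L.faceEquiv hn).symm F) v hv' _ le_rfl ((L.step _).mem_vertices_dom hv)

/-- The bracketed graph that a layout presents. -/
noncomputable def toBracketedGraph : BracketedGraph where
  toAnchoredGraph := L.toAnchoredGraph hn
  extDom := ⟨L.row 0, rfl⟩
  extCodom := ⟨L.row n, rfl⟩
  faceDom F := ⟨(L.step ((L.faceEquiv hn).symm F)).D, rfl⟩
  faceCodom F := ⟨(L.step ((L.faceEquiv hn).symm F)).E, rfl⟩

theorem bface_toBracketedGraph (i : Fin n) :
    (L.toBracketedGraph hn).bface (L.faceEquiv hn i) = (L.step i).pair := by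
  change (L.step ((L.faceEquiv hn).symm (L.faceEquiv hn i))).pair = _
  rw [Equiv.symm_apply_apply]

end Anchored

end Layout

/-! ### Injective morphisms of graphs -/

section Injective

variable {V : Type*} [Quiver V] {W : Type*} [Quiver W]

theorem BPath.map_id {u v : V} (p : BPath u v) : p.map (𝟭q V) = p := by
  induction p with
  | edge e => rfl
  | comp p q hp hq => exact congrArg₂ BPath.comp hp hq

theorem BPath.bracketing_map (π : V ⥤q W) {u v : V} (p : BPath u v) :
    (p.map π).bracketing = p.bracketing := by
  induction p with
  | edge e => rfl
  | comp p q hp hq => exact congrArg₂ Bracketing.app hp hq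

/-- A bracketed walk is determined by its bracketing and its edges. -/
theorem BPath.sigma_ext {u v u' v' : V} (p : BPath u v) (q : BPath u' v')
    (h : p.bracketing = q.bracketing) (he : pathEdges p.toPath = pathEdges q.toPath) :
    (⟨_, _, p⟩ : Σ x y : V, BPath x y) = ⟨_, _, q⟩ := by
  have := p.map_eq_map (𝟭q V) q h (by rw [he])
  rwa [BPath.map_id, BPath.map_id] at this

theorem BPath.map_injective {π : V ⥤q W} (hπ : Function.Injective (mapEdge π)) {u v : V}
    {p q : BPath u v} (h : p.map π = q.map π) : p = q := by
  have hb : p.bracketing = q.bracketing := by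
    rw [← p.bracketing_map π, h, q.bracketing_map]
  have he := congrArg (fun r => pathEdges (toPath r)) h
  simp only [toPath_map, pathEdges_mapPath] at he
  have := BPath.sigma_ext p q hb (List.map_injective_iff.2 hπ he)
  simpa using this

theorem ParBPath.map_injective {π : V ⥤q W} (ho : Function.Injective π.obj)
    (hπ : Function.Injective (mapEdge π)) {c d : ParBPath V} (h : c.map π = d.map π) : c = d := by
  obtain ⟨s, t, p, q⟩ := c
  obtain ⟨s', t', p', q'⟩ := d
  obtain rfl := ho (congrArg ParBPath.src h)
  obtain rfl := ho (congrArg ParBPath.snk h)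
  simp only [ParBPath.map, ParBPath.mk.injEq, heq_eq_eq, true_and] at h
  rw [BPath.map_injective hπ h.1, BPath.map_injective hπ h.2]

/-- The pair of underlying walks: forget the brackets. -/
def ParBPath.toParPath (c : ParBPath V) : ParPath V := ⟨c.src, c.snk, c.dom.toPath, c.codom.toPath⟩

theorem ParBPath.toParPath_map (c : ParBPath V) (π : V ⥤q W) :
    (c.map π).toParPath = c.toParPath.map π := by
  simp only [toParPath, ParBPath.map, ParPath.map, BPath.toPath_map]

theorem mem_vertices_map (π : V ⥤q W) {u v w : V} {p : BPath u v} (h : w ∈ p.toPath.vertices) :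
    π.obj w ∈ (p.map π).toPath.vertices := by
  rw [BPath.toPath_map, vertices_mapPath]
  exact List.mem_map_of_mem h

theorem mem_pathEdges_map (π : V ⥤q W) {u v : V} {e : Quiver.Total V} {p : BPath u v}
    (h : e ∈ pathEdges p.toPath) : mapEdge π e ∈ pathEdges (p.map π).toPath := by
  rw [BPath.toPath_map, pathEdges_mapPath]
  exact List.mem_map_of_mem h

theorem mem_vertices_of_map {π : V ⥤q W} (ho : Function.Injective π.obj) {u v w : V} {p : BPath u v}
    (h : π.obj w ∈ (p.map π).toPath.vertices) : w ∈ p.toPath.vertices := by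
  rw [BPath.toPath_map, vertices_mapPath] at h
  exact (List.mem_map_of_injective ho).1 h

theorem mem_pathEdges_of_map {π : V ⥤q W} (hπ : Function.Injective (mapEdge π)) {u v : V}
    {e : Quiver.Total V} {p : BPath u v} (h : mapEdge π e ∈ pathEdges (p.map π).toPath) :
    e ∈ pathEdges p.toPath := by
  rw [BPath.toPath_map, pathEdges_mapPath] at h
  exact (List.mem_map_of_injective hπ).1 h

end Injective

/-! ### Subgraphs -/

section Subgraph

variable {W : Type} [Quiver.{0} W] {P P' : W → Prop} {Q Q' : Quiver.Total W → Prop}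

/-- The subgraph with the vertices that satisfy `P` and the edges between them that satisfy `Q`. -/
structure Subgraph (P : W → Prop) (Q : Quiver.Total W → Prop) : Type where
  val : W
  property : P val

instance : Quiver.{0} (Subgraph P Q) := ⟨fun u v => {e : u.1 ⟶ v.val // Q ⟨u.1, v.1, e⟩}⟩

/-- The inclusion of a subgraph. -/
def Subgraph.incl : Subgraph P Q ⥤q W where
  obj := Subgraph.val
  map := Subtype.val

/-- The inclusion of a subgraph in a larger one. -/
def Subgraph.mono (hP : ∀ w, P w → P' w) (hQ : ∀ e, Q e → Q' e) :
    Subgraph P Q ⥤q Subgraph P' Q' where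
  obj v := ⟨v.1, hP _ v.2⟩
  map e := ⟨e.1, hQ _ e.2⟩

theorem Subgraph.incl_obj_injective :
    Function.Injective (Subgraph.incl : Subgraph P Q ⥤q W).obj := by
  rintro ⟨u, hu⟩ ⟨v, hv⟩ h
  cases h
  rfl

theorem Subgraph.incl_edge_injective :
    Function.Injective (mapEdge (Subgraph.incl : Subgraph P Q ⥤q W)) := by
  rintro ⟨⟨u, hu⟩, ⟨v, hv⟩, ⟨e, he⟩⟩ ⟨⟨u', hu'⟩, ⟨v', hv'⟩, ⟨e', he'⟩⟩ h
  have h : (⟨u, v, e⟩ : Quiver.Total W) = ⟨u', v', e'⟩ := h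
  cases h
  rfl

theorem Subgraph.mono_edge_injective (hP : ∀ w, P w → P' w) (hQ : ∀ e, Q e → Q' e) :
    Function.Injective (mapEdge (Subgraph.mono hP hQ)) := fun e f h =>
  have h' : mapEdge Subgraph.incl e = mapEdge Subgraph.incl f := by
    have := congrArg (mapEdge Subgraph.incl) h
    exact this
  Subgraph.incl_edge_injective h'

theorem Subgraph.mono_obj_injective (hP : ∀ w, P w → P' w) (hQ : ∀ e, Q e → Q' e) :
    Function.Injective (Subgraph.mono hP hQ).obj := fun u v h =>
  have h' : u.val = v.val := by
    have := congrArg Subgraph.val h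
    exact this
  Subgraph.incl_obj_injective h'

/-- A walk whose vertices and edges belong to a subgraph can be lifted to it. -/
theorem Subgraph.exists_bpath {u v : W} (p : BPath u v) (hP : ∀ w ∈ p.toPath.vertices, P w)
    (hQ : ∀ e ∈ pathEdges p.toPath, Q e) (hu : P u) (hv : P v) :
    ∃ p' : BPath (⟨u, hu⟩ : Subgraph P Q) (⟨v, hv⟩ : Subgraph P Q), p'.map Subgraph.incl = p := by
  induction p with
  | edge e =>
    exact ⟨.edge ⟨e, hQ _ (by simp [BPath.toPath, Quiver.Hom.toPath, pathEdges])⟩, rfl⟩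
  | @comp u w v p q ihp ihq =>
    simp only [BPath.toPath, mem_vertices_comp, pathEdges_comp, List.mem_append] at hP hQ
    obtain ⟨p', hp⟩ := ihp (fun w h => hP w (Or.inl h)) (fun e h => hQ e (Or.inl h)) hu
      (hP w (Or.inl (Quiver.Path.end_mem_vertices _)))
    obtain ⟨q', hq⟩ := ihq (fun w h => hP w (Or.inr h)) (fun e h => hQ e (Or.inr h)) _ hv
    exact ⟨p'.comp q', congrArg₂ BPath.comp hp hq⟩

/-- A factorization of a bracketed walk through a context can be lifted along an inclusion. -/
theorem Subgraph.exists_context {a b u v : W} (c : Context a b u v) (d : BPath a b) {hu : P u}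
    {hv : P v} (p : BPath (⟨u, hu⟩ : Subgraph P Q) (⟨v, hv⟩ : Subgraph P Q))
    (h : p.map Subgraph.incl = c.fill d) :
    ∃ (ha : P a) (hb : P b)
      (c' : Context (⟨a, ha⟩ : Subgraph P Q) (⟨b, hb⟩ : Subgraph P Q) ⟨u, hu⟩ ⟨v, hv⟩)
      (d' : BPath (⟨a, ha⟩ : Subgraph P Q) (⟨b, hb⟩ : Subgraph P Q)),
      p = c'.fill d' ∧ c'.map Subgraph.incl = c ∧ d'.map Subgraph.incl = d := by
  induction c with
  | hole => exact ⟨hu, hv, .hole, p, rfl, rfl, h⟩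
  | left r c ih =>
    cases p with
    | edge e => simp [BPath.map, Context.fill] at h
    | @comp _ w _ p q =>
      obtain ⟨w, hw⟩ := w
      simp only [BPath.map, Context.fill] at h
      injection h with h₁ h₂ h₃ h₄ h₅
      change w = _ at h₂
      subst h₂
      obtain ⟨ha, hb, c', d', rfl, hc, hd⟩ := ih q (eq_of_heq h₅)
      exact ⟨ha, hb, .left p c', d', rfl, congrArg₂ Context.left (eq_of_heq h₄) hc, hd⟩
  | right c r ih =>
    cases p with
    | edge e => simp [BPath.map, Context.fill] at h
    | @comp _ w _ p q =>
      obtain ⟨w, hw⟩ := w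
      simp only [BPath.map, Context.fill] at h
      injection h with h₁ h₂ h₃ h₄ h₅
      change w = _ at h₂
      subst h₂
      obtain ⟨ha, hb, c', d', rfl, hc, hd⟩ := ih p (eq_of_heq h₄)
      exact ⟨ha, hb, .right c' q, d', rfl, congrArg₂ Context.right hc (eq_of_heq h₅), hd⟩

/-- A step can be lifted to a subgraph that contains both of its walks. -/
theorem Subgraph.exists_step {s t : W} {hs : P s} {ht : P t}
    {p q : BPath (⟨s, hs⟩ : Subgraph P Q) (⟨t, ht⟩ : Subgraph P Q)} {p₀ q₀ : BPath s t}
    (hp : p.map Subgraph.incl = p₀) (hq : q.map Subgraph.incl = q₀) (S : Step p₀ q₀) :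
    ∃ S' : Step p q, S'.pair.map Subgraph.incl = S.pair := by
  obtain ⟨a, b, D, E, C, hD, hE⟩ := S
  obtain ⟨ha, hb, c, d, hpd, hc, hd⟩ := Subgraph.exists_context C D p (hp.trans hD)
  obtain ⟨_, _, c', e, hqe, hc', he⟩ := Subgraph.exists_context C E q (hq.trans hE)
  -- The two lifted contexts `c` and `c'` have the same image under the injective inclusion.
  have hcc : q = c.fill e := by
    apply BPath.map_injective (π := Subgraph.incl) Subgraph.incl_edge_injective
    rw [hqe, Context.map_fill, Context.map_fill]
    exact congrArg (fun x => Context.fill (e.map Subgraph.incl) x) (hc'.trans hc.symm)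
  refine ⟨⟨⟨a, ha⟩, ⟨b, hb⟩, d, e, c, hpd, hcc⟩, ?_⟩
  simp only [Step.pair, ParBPath.map, hd, he]
  rfl

end Subgraph

/-! ### Segments of row sequences -/

namespace RowSequence

variable {W : Type} [Quiver.{0} W] {N : ℕ} (R : RowSequence W N)

/-- The graph formed by the rows `m, …, m + k`. -/
abbrev Sub (m k : ℕ) : Type :=
  Subgraph (fun w => ∃ j ≤ k, w ∈ (R.row (m + j)).toPath.vertices)
    fun e => ∃ j ≤ k, e ∈ pathEdges (R.row (m + j)).toPath

theorem exists_row (m k j : ℕ) : ∃ p : BPath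
    (⟨R.s, 0, Nat.zero_le k, (R.row (m + 0)).toPath.start_mem_vertices⟩ : R.Sub m k)
    (⟨R.t, 0, Nat.zero_le k, (R.row (m + 0)).toPath.end_mem_vertices⟩ : R.Sub m k),
    p.map Subgraph.incl = R.row (m + min j k) :=
  Subgraph.exists_bpath _ (fun _ h => ⟨_, min_le_right _ _, h⟩)
    (fun _ h => ⟨_, min_le_right _ _, h⟩)
    _ _

/-- The rows of a segment of the sequence, in the graph that they form. -/
noncomputable def subRow (m k j : ℕ) := (R.exists_row m k j).choose

theorem subRow_map (m k : ℕ) {j : ℕ} (hj : j ≤ k) :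
    (R.subRow m k j).map Subgraph.incl = R.row (m + j) := by
  have h : R.row (m + min j k) = R.row (m + j) := by rw [min_eq_left hj]
  exact (R.exists_row m k j).choose_spec.trans h

theorem exists_subStep {m k : ℕ} (h : m + k ≤ N) (i : Fin k) :
    ∃ S : Step (R.subRow m k i.1) (R.subRow m k (i.1 + 1)),
      S.pair.map Subgraph.incl = (R.step ⟨m + i.1, by omega⟩).pair :=
  Subgraph.exists_step (R.subRow_map m k i.2.le) (R.subRow_map m k i.2) (R.step ⟨m + i.1, by omega⟩)

/-- The steps of a segment of the sequence, in the graph that the segment forms. -/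
noncomputable def subStep {m k : ℕ} (h : m + k ≤ N) (i : Fin k) := (R.exists_subStep h i).choose

theorem subStep_map {m k : ℕ} (h : m + k ≤ N) (i : Fin k) :
    (R.subStep h i).pair.map Subgraph.incl = (R.step ⟨m + i.1, by omega⟩).pair :=
  (R.exists_subStep h i).choose_spec

/-- The layout of the graph formed by the rows `m, …, m + k`. -/
noncomputable def layout {m k : ℕ} (h : m + k ≤ N) : Layout (R.Sub m k) k where
  s := _
  t := _
  row := R.subRow m k
  step := R.subStep h
  x v := R.x v.1
  x_lt e := R.x_lt e.1
  vfresh i v hv j hj hvj := by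
    have hS := R.subStep_map h i
    have h₁ : v.val ∈ ((R.subStep h i).pair.map Subgraph.incl).codom.toPath.vertices :=
      mem_vertices_map Subgraph.incl hv
    have h₂ : v.val ∈ ((R.subRow m k j).map Subgraph.incl).toPath.vertices :=
      mem_vertices_map Subgraph.incl hvj
    rw [hS] at h₁
    rw [R.subRow_map m k (hj.trans i.2.le)] at h₂
    rcases R.vfresh ⟨m + i.1, by omega⟩ v.val h₁ (m + j) (by simp only; omega) h₂ with h₃ | h₃
    · exact Or.inl (Subgraph.incl_obj_injective (h₃.trans (congrArg ParBPath.src hS).symm))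
    · exact Or.inr (Subgraph.incl_obj_injective (h₃.trans (congrArg ParBPath.snk hS).symm))
  efresh i e he j hj hej := by
    have hS := R.subStep_map h i
    have h₁ : mapEdge Subgraph.incl e ∈
        pathEdges ((R.subStep h i).pair.map Subgraph.incl).codom.toPath :=
      mem_pathEdges_map Subgraph.incl he
    have h₂ := mem_pathEdges_map Subgraph.incl hej
    rw [hS] at h₁
    rw [R.subRow_map m k (hj.trans i.2.le)] at h₂
    exact R.efresh ⟨m + i.1, by omega⟩ _ h₁ (m + j) (by simp only; omega) h₂
  vcover v := by
    obtain ⟨j, hj, hv⟩ := v.property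
    refine ⟨j, hj, mem_vertices_of_map Subgraph.incl_obj_injective (π := Subgraph.incl) ?_⟩
    rw [R.subRow_map m k hj]
    exact hv
  ecover e := by
    obtain ⟨j, hj, he⟩ := e.hom.2
    refine ⟨j, hj, mem_pathEdges_of_map Subgraph.incl_edge_injective (π := Subgraph.incl) ?_⟩
    rw [R.subRow_map m k hj]
    exact he

end RowSequence

namespace Layout

theorem row_zero_eq {W : Type} [Quiver.{0} W] (L : Layout W 1) (i : Fin 1) :
    L.row 0 = (L.step i).C.fill (L.step i).D := by
  obtain rfl := Subsingleton.elim i 0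
  exact (L.step 0).dom_eq

theorem row_one_eq {W : Type} [Quiver.{0} W] (L : Layout W 1) (i : Fin 1) :
    L.row 1 = (L.step i).C.fill (L.step i).E := by
  obtain rfl := Subsingleton.elim i 0
  exact (L.step 0).codom_eq

/-- The graph of a layout with a single step is consistent. -/
noncomputable def consistent {W : Type} [Quiver.{0} W] (L : Layout W 1) :
    Consistent (L.toBracketedGraph Nat.one_pos) where
  F := L.faceEquiv Nat.one_pos 0
  unique F := by
    rw [← (L.faceEquiv Nat.one_pos).apply_symm_apply F]
    exact congrArg _ (Subsingleton.elim _ _)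
  ctx := (L.step ((L.faceEquiv Nat.one_pos).symm (L.faceEquiv Nat.one_pos 0))).C
  dom_eq := L.row_zero_eq _
  codom_eq := L.row_one_eq _

end Layout

/-! ### Composition schemes from row sequences -/

section MapsOfGraphs

variable {W : Type} [Quiver.{0} W]

theorem BracketedGraph.ext_map (G : BracketedGraph) {π : G.V ⥤q W}
    {c : ParBPath W} (h : G.bext.map π = c) : G.ext.map π = c.toParPath := by
  rw [← h, ParBPath.toParPath_map]
  simp only [ParBPath.toParPath, BracketedGraph.bext, G.extDom.2, G.extCodom.2]

theorem BracketedGraph.face_map (G : BracketedGraph) (F : G.InteriorFace)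
    {π : G.V ⥤q W} {c : ParBPath W} (h : (G.bface F).map π = c) :
    (G.face F).map π = c.toParPath := by
  rw [← h, ParBPath.toParPath_map]
  simp only [ParBPath.toParPath, BracketedGraph.bface, (G.faceDom F).2, (G.faceCodom F).2]

/-- Bracketed domains and codomains in subgraphs agree if they agree in the large graph. -/
theorem Subgraph.map_mono_eq {P P' : W → Prop} {Q Q' : Quiver.Total W → Prop}
    (hP : ∀ w, P w → P' w) (hQ : ∀ e, Q e → Q' e) {c : ParBPath (Subgraph P Q)}
    {d : ParBPath (Subgraph P' Q')} (h : c.map Subgraph.incl = d.map Subgraph.incl) :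
    c.map (Subgraph.mono hP hQ) = d := by
  apply ParBPath.map_injective (π := Subgraph.incl) Subgraph.incl_obj_injective
    Subgraph.incl_edge_injective
  rw [← ParBPath.map_comp]
  exact h

end MapsOfGraphs

namespace RowSequence

variable {W : Type} [Quiver.{0} W] {N : ℕ} (R : RowSequence W N)

/-- The bracketed graph formed by the rows `m, …, m + k`. -/
noncomputable def graph {m k : ℕ} (h : m + k ≤ N) (hk : 0 < k) : BracketedGraph :=
  (R.layout h).toBracketedGraph hk

theorem bext_graph {m k : ℕ} (h : m + k ≤ N) (hk : 0 < k) :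
    (R.graph h hk).bext.map Subgraph.incl = ⟨R.s, R.t, R.row m, R.row (m + k)⟩ := by
  have h₀ := R.subRow_map m k (Nat.zero_le k)
  have h₁ := R.subRow_map m k le_rfl
  change (⟨R.s, R.t, (R.subRow m k 0).map Subgraph.incl, (R.subRow m k k).map Subgraph.incl⟩ :
    ParBPath W) = _
  rw [h₀, h₁]
  rfl

theorem bface_graph {m k : ℕ} (h : m + k ≤ N) (hk : 0 < k) (i : Fin k) :
    ((R.graph h hk).bface ((R.layout h).faceEquiv hk i)).map Subgraph.incl =
      (R.step ⟨m + i.1, by omega⟩).pair :=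
  (congrArg (fun c => ParBPath.map c Subgraph.incl)
    ((R.layout h).bface_toBracketedGraph hk i)).trans
    (R.subStep_map h i)

/-- A vertex that row `m + k + j'` with `j' ≤ 1` shares with an earlier row `m + j` is on row `m +
k`. -/
theorem vertex_glue {m k : ℕ} (h : m + k + 1 ≤ N) {w : W} {j : ℕ} (hj : j ≤ k)
    (hw : w ∈ (R.row (m + j)).toPath.vertices) {j' : ℕ} (hj' : j' ≤ 1)
    (hw' : w ∈ (R.row (m + k + j')).toPath.vertices) : w ∈ (R.row (m + k)).toPath.vertices := by
  rcases Nat.le_one_iff_eq_zero_or_eq_one.1 hj' with rfl | rfl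
  · exact hw'
  · rcases (R.step ⟨m + k, h⟩).vertex_cases R.x_lt hw' with hE | hP
    · rcases R.vfresh ⟨m + k, h⟩ w hE (m + j) (by simp only; omega) hw with rfl | rfl
      · exact (R.step ⟨m + k, h⟩).left_mem_vertices_dom
      · exact (R.step ⟨m + k, h⟩).right_mem_vertices_dom
    · exact hP.1

/-- An edge that row `m + k + j'` with `j' ≤ 1` shares with an earlier row `m + j` is on row `m +
k`. -/
theorem edge_glue {m k : ℕ} (h : m + k + 1 ≤ N) {e : Quiver.Total W} {j : ℕ} (hj : j ≤ k)
    (he : e ∈ pathEdges (R.row (m + j)).toPath) {j' : ℕ} (hj' : j' ≤ 1)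
    (he' : e ∈ pathEdges (R.row (m + k + j')).toPath) : e ∈ pathEdges (R.row (m + k)).toPath := by
  rcases Nat.le_one_iff_eq_zero_or_eq_one.1 hj' with rfl | rfl
  · exact he'
  · rcases (R.step ⟨m + k, h⟩).edge_cases R.x_lt he' with hE | hP
    · exact absurd he (R.efresh ⟨m + k, h⟩ e hE (m + j) (by simp only; omega))
    · exact hP.1

/-- The vertical composite of a segment of the sequence with the next step. -/
noncomputable def bvcomp {m k : ℕ} (h : m + k + 1 ≤ N) (hk : 0 < k) :
    BVComp (R.graph (m := m) (k := k) (by omega) hk) (R.graph (m := m + k) (k := 1) h Nat.one_pos)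
      (R.graph (m := m) (k := k + 1) h k.succ_pos) :=
  have hPl : ∀ w, (∃ j ≤ k, w ∈ (R.row (m + j)).toPath.vertices) →
    ∃ j ≤ k + 1, w ∈ (R.row (m + j)).toPath.vertices := fun w ⟨j, hj, h⟩ => ⟨j, by omega, h⟩
  have hQl : ∀ e, (∃ j ≤ k, e ∈ pathEdges (R.row (m + j)).toPath) →
    ∃ j ≤ k + 1, e ∈ pathEdges (R.row (m + j)).toPath := fun w ⟨j, hj, h⟩ => ⟨j, by omega, h⟩
  have hPr : ∀ w, (∃ j ≤ 1, w ∈ (R.row (m + k + j)).toPath.vertices) →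
    ∃ j ≤ k + 1, w ∈ (R.row (m + j)).toPath.vertices := fun w ⟨j, hj, h⟩ =>
      ⟨k + j, by omega, by rwa [← add_assoc]⟩
  have hQr : ∀ e, (∃ j ≤ 1, e ∈ pathEdges (R.row (m + k + j)).toPath) →
    ∃ j ≤ k + 1, e ∈ pathEdges (R.row (m + j)).toPath := fun w ⟨j, hj, h⟩ =>
      ⟨k + j, by omega, by rwa [← add_assoc]⟩
  let K := R.graph (m := m) (k := k + 1) h k.succ_pos
  have hel : (R.graph (m := m) (k := k) (by omega) hk).bext.map (Subgraph.mono hPl hQl) =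
      ⟨K.ext.src, K.ext.snk, K.extDom.1, R.subRow m (k + 1) k⟩ :=
    Subgraph.map_mono_eq _ _ ((R.bext_graph _ _).trans (by
      have h₀ := R.subRow_map m (k + 1) (Nat.zero_le (k + 1))
      have h₁ := R.subRow_map m (k + 1) (Nat.le_succ k)
      change _ = (⟨R.s, R.t, (R.subRow m (k + 1) 0).map Subgraph.incl,
        (R.subRow m (k + 1) k).map Subgraph.incl⟩ : ParBPath W)
      rw [h₀, h₁]
      rfl))
  have her : (R.graph (m := m + k) (k := 1) h Nat.one_pos).bext.map (Subgraph.mono hPr hQr) =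
      ⟨K.ext.src, K.ext.snk, R.subRow m (k + 1) k, K.extCodom.1⟩ :=
    Subgraph.map_mono_eq _ _ ((R.bext_graph _ _).trans (by
      have h₀ := R.subRow_map m (k + 1) le_rfl
      have h₁ := R.subRow_map m (k + 1) (Nat.le_succ k)
      change _ = (⟨R.s, R.t, (R.subRow m (k + 1) k).map Subgraph.incl,
        (R.subRow m (k + 1) (k + 1)).map Subgraph.incl⟩ : ParBPath W)
      rw [h₀, h₁]
      rfl))
  let faces := ((R.layout (m := m) (k := k) (by omega)).faceEquiv hk).symm.sumCongr
    ((R.layout (m := m + k) (k := 1) h).faceEquiv Nat.one_pos).symm |>.trans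
      (finSumFinEquiv.trans ((R.layout (m := m) (k := k + 1) h).faceEquiv k.succ_pos))
  have hfl : ∀ F, K.bface (faces (.inl F)) =
      ((R.graph (m := m) (k := k) (by omega) hk).bface F).map (Subgraph.mono hPl hQl) := fun F => by
    obtain ⟨i, rfl⟩ := ((R.layout (m := m) (k := k) (by omega)).faceEquiv hk).surjective F
    symm
    apply Subgraph.map_mono_eq
    have : faces (.inl ((R.layout (m := m) (k := k) (by omega)).faceEquiv hk i)) =
        (R.layout (m := m) (k := k + 1) h).faceEquiv k.succ_pos (Fin.castAdd 1 i) := by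
      simp [faces]
    rw [this]
    exact (R.bface_graph _ _ i).trans (R.bface_graph _ _ (Fin.castAdd 1 i)).symm
  have hfr : ∀ F, K.bface (faces (.inr F)) =
      ((R.graph (m := m + k) (k := 1) h Nat.one_pos).bface F).map (Subgraph.mono hPr hQr) :=
      fun F => by
    obtain ⟨i, rfl⟩ := ((R.layout (m := m + k) (k := 1) h).faceEquiv Nat.one_pos).surjective F
    symm
    apply Subgraph.map_mono_eq
    have : faces (.inr ((R.layout (m := m + k) (k := 1) h).faceEquiv Nat.one_pos i)) =
        (R.layout (m := m) (k := k + 1) h).faceEquiv k.succ_pos (Fin.natAdd k i) := by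
      simp [faces]
    rw [this]
    refine (R.bface_graph _ _ i).trans (Eq.trans ?_ (R.bface_graph _ _ (Fin.natAdd k i)).symm)
    have : (⟨m + k + i.1, by omega⟩ : Fin N) = ⟨m + (Fin.natAdd k i).1, by
      have := (Fin.natAdd k i).2; omega⟩ := Fin.ext (add_assoc _ _ _)
    rw [this]
  { inl := Subgraph.mono hPl hQl
    inr := Subgraph.mono hPr hQr
    inl_obj_injective := Subgraph.mono_obj_injective hPl hQl
    inr_obj_injective := Subgraph.mono_obj_injective hPr hQr
    inl_edge_injective := Subgraph.mono_edge_injective hPl hQl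
    inr_edge_injective := Subgraph.mono_edge_injective hPr hQr
    obj_cover := by
      rintro ⟨w, j, hj, hw⟩
      rcases Nat.le_succ_iff.1 hj with hj | rfl
      · exact Or.inl ⟨⟨w, j, hj, hw⟩, rfl⟩
      · exact Or.inr ⟨⟨w, 1, le_rfl, hw⟩, rfl⟩
    edge_cover := by
      rintro ⟨⟨u, hu⟩, ⟨v, hv⟩, ⟨e, j, hj, he⟩⟩
      rcases Nat.le_succ_iff.1 hj with hj | rfl
      · exact Or.inl ⟨⟨⟨u, j, hj, left_mem_vertices he⟩, ⟨v, j, hj, right_mem_vertices he⟩,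
          ⟨e, j, hj, he⟩⟩, rfl⟩
      · exact Or.inr ⟨⟨⟨u, 1, le_rfl, left_mem_vertices he⟩, ⟨v, 1, le_rfl, right_mem_vertices he⟩,
          ⟨e, 1, le_rfl, he⟩⟩, rfl⟩
    mid := (R.subRow m (k + 1) k).toPath
    bmid := R.subRow m (k + 1) k
    ext_left := BracketedGraph.ext_map _ hel
    ext_right := BracketedGraph.ext_map _ her
    obj_glue := by
      rintro ⟨u, j, hj, hu⟩ ⟨v, j', hj', hv⟩ huv
      have huv : u = v := congrArg Subgraph.val huv
      subst huv
      have hg := R.vertex_glue h hj hu hj' hv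
      rw [← R.subRow_map m k le_rfl] at hg
      exact mem_vertices_of_map (π := Subgraph.incl) Subgraph.incl_obj_injective hg
    edge_glue := by
      intro e f hef
      obtain ⟨j, hj, he⟩ := e.hom.2
      obtain ⟨j', hj', hf⟩ := f.hom.2
      have hef : mapEdge Subgraph.incl e = mapEdge Subgraph.incl f :=
        congrArg (mapEdge Subgraph.incl) hef
      change mapEdge Subgraph.incl e ∈ _ at he
      change mapEdge Subgraph.incl f ∈ _ at hf
      rw [← hef] at hf
      have hg := R.edge_glue h hj he hj' hf
      rw [← R.subRow_map m k le_rfl] at hg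
      exact mem_pathEdges_of_map (π := Subgraph.incl) Subgraph.incl_edge_injective hg
    faces := faces
    face_left := fun F => (BracketedGraph.face_map _ F (hfl F).symm).symm
    face_right := fun F => (BracketedGraph.face_map _ F (hfr F).symm).symm
    bext_left := hel
    bext_right := her
    bface_left := hfl
    bface_right := hfr }

/-- The graph formed by an initial segment of the rows is a composition scheme. -/
noncomputable def compositionScheme : ∀ {k : ℕ} (h : 0 + (k + 1) ≤ N),
    CompositionScheme (R.graph h k.succ_pos)
  | 0, h => .single (R.layout h).consistent
  | k + 1, h => .vcomp (compositionScheme (k := k) (by omega)) (R.layout _).consistent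
      (R.bvcomp h k.succ_pos)

/-- The graph of a sequence of rows: a composition scheme that consists of the vertices and edges of
the rows, and whose faces are the steps. -/
theorem exists_compositionScheme {M : ℕ} (R : RowSequence W (M + 1)) :
    ∃ (H : BracketedGraph) (_ : CompositionScheme H) (ι : H.V ⥤q W)
      (fe : Fin (M + 1) ≃ H.InteriorFace), Function.Injective ι.obj ∧
      Function.Injective (mapEdge ι) ∧
      (∀ w, (∃ v, ι.obj v = w) ↔ ∃ j ≤ M + 1, w ∈ (R.row j).toPath.vertices) ∧
      (∀ e, (∃ e', mapEdge ι e' = e) ↔ ∃ j ≤ M + 1, e ∈ pathEdges (R.row j).toPath) ∧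
      H.bext.map ι = ⟨R.s, R.t, R.row 0, R.row (M + 1)⟩ ∧
      ∀ i, (H.bface (fe i)).map ι = (R.step i).pair := by
  have h : 0 + (M + 1) ≤ M + 1 := (zero_add _).le
  refine ⟨R.graph h M.succ_pos, R.compositionScheme h, Subgraph.incl,
    (R.layout h).faceEquiv M.succ_pos, Subgraph.incl_obj_injective, Subgraph.incl_edge_injective,
    fun w => ⟨?_, ?_⟩, fun e => ⟨?_, ?_⟩, ?_, fun i => ?_⟩
  · rintro ⟨⟨v, j, hj, hv⟩, rfl⟩
    exact ⟨j, hj, by rwa [zero_add] at hv⟩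
  · rintro ⟨j, hj, hw⟩
    exact ⟨⟨w, j, hj, by rwa [zero_add]⟩, rfl⟩
  · rintro ⟨⟨⟨u, hu⟩, ⟨v, hv⟩, ⟨e, j, hj, he⟩⟩, rfl⟩
    exact ⟨j, hj, by rwa [zero_add] at he⟩
  · rintro ⟨j, hj, he⟩
    rw [← zero_add j] at he
    exact ⟨⟨⟨e.left, j, hj, left_mem_vertices he⟩, ⟨e.right, j, hj, right_mem_vertices he⟩,
      ⟨e.hom, j, hj, he⟩⟩, rfl⟩
  · refine (R.bext_graph h M.succ_pos).trans ?_
    rw [zero_add]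
  · refine (R.bface_graph h M.succ_pos i).trans ?_
    have : (⟨0 + i.1, by omega⟩ : Fin (M + 1)) = i := Fin.ext (zero_add _)
    rw [this]

end RowSequence

/-! ### Rebracketing -/

section Rebracketing

variable {V : Type*} [Quiver V]

/-- `q` arises from `p` by one step of rebracketing inside the bracketed walk. -/
def Rebrackets {u v : V} (p q : BPath u v) : Prop := ∃ S : Step p q, Nonempty (Rebracket S.pair)

theorem Rebracket.toPath_eq {c : ParBPath V} (r : Rebracket c) : c.dom.toPath = c.codom.toPath := by
  cases r <;> simp [BPath.toPath]

theorem Rebrackets.toPath_eq {u v : V} {p q : BPath u v} (h : Rebrackets p q) :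
    p.toPath = q.toPath := by
  obtain ⟨S, ⟨r⟩⟩ := h
  have : S.D.toPath = S.E.toPath := r.toPath_eq
  obtain ⟨a, b, D, E, C, rfl, rfl⟩ := S
  rw [Context.toPath_fill, Context.toPath_fill, this]

theorem Rebrackets.assoc {u v w z : V} (p : BPath u v) (q : BPath v w) (r : BPath w z) :
    Rebrackets ((p.comp q).comp r) (p.comp (q.comp r)) :=
  ⟨⟨_, _, _, _, .hole, rfl, rfl⟩, ⟨.assoc p q r⟩⟩

theorem Rebrackets.assocInv {u v w z : V} (p : BPath u v) (q : BPath v w) (r : BPath w z) :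
    Rebrackets (p.comp (q.comp r)) ((p.comp q).comp r) :=
  ⟨⟨_, _, _, _, .hole, rfl, rfl⟩, ⟨.assocInv p q r⟩⟩

theorem Rebrackets.symm {u v : V} {p q : BPath u v} (h : Rebrackets p q) : Rebrackets q p := by
  obtain ⟨⟨a, b, D, E, C, rfl, rfl⟩, ⟨r⟩⟩ := h
  refine ⟨⟨a, b, E, D, C, rfl, rfl⟩, ?_⟩
  simp only [Step.pair] at r ⊢
  cases r with
  | assoc => exact ⟨.assocInv _ _ _⟩
  | assocInv => exact ⟨.assoc _ _ _⟩

theorem Rebrackets.comp_left {u v w : V} (r : BPath u v) {p q : BPath v w} (h : Rebrackets p q) :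
    Rebrackets (r.comp p) (r.comp q) := by
  obtain ⟨⟨a, b, D, E, C, rfl, rfl⟩, hr⟩ := h
  exact ⟨⟨a, b, D, E, .left r C, rfl, rfl⟩, hr⟩

theorem Rebrackets.comp_right {u v w : V} {p q : BPath u v} (h : Rebrackets p q) (r : BPath v w) :
    Rebrackets (p.comp r) (q.comp r) := by
  obtain ⟨⟨a, b, D, E, C, rfl, rfl⟩, hr⟩ := h
  exact ⟨⟨a, b, D, E, .right C r, rfl, rfl⟩, hr⟩

/-- Rebracketing moves the last edge out of all inner brackets. -/
theorem exists_rebrackets_comp_edge {u v : V} (p : BPath u v) : (∃ e : u ⟶ v, p = .edge e) ∨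
    ∃ (w : V) (p' : BPath u w) (e : w ⟶ v),
      Relation.ReflTransGen Rebrackets p (p'.comp (.edge e)) := by
  induction p with
  | edge e => exact Or.inl ⟨e, rfl⟩
  | comp p q _ ih =>
    rcases ih with ⟨e, rfl⟩ | ⟨w, q', e, h⟩
    · exact Or.inr ⟨_, p, e, .refl⟩
    · exact Or.inr ⟨w, p.comp q', e,
        (h.lift (p.comp ·) fun _ _ => Rebrackets.comp_left p).tail (.assocInv _ _ _)⟩

theorem reflTransGen_rebrackets_toPath {u v : V} {p q : BPath u v}
    (h : Relation.ReflTransGen Rebrackets p q) : p.toPath = q.toPath := by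
  induction h with
  | refl => rfl
  | tail _ h ih => exact ih.trans h.toPath_eq

/-- Any two bracketings of the same walk are related by a sequence of steps of rebracketing. -/
theorem reflTransGen_rebrackets {u v : V} (p q : BPath u v) (h : p.toPath = q.toPath) :
    Relation.ReflTransGen Rebrackets p q := by
  have hsymm : ∀ {u v : V} {p q : BPath u v}, Relation.ReflTransGen Rebrackets p q →
      Relation.ReflTransGen Rebrackets q p := fun h =>
    h.swap.lift id fun _ _ => Rebrackets.symm
  generalize hn : p.toPath.length = n
  induction n generalizing v with
  | zero =>
    have := p.length_pos
    rw [length_pathEdges] at this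
    omega
  | succ n ih =>
    have hedge : ∀ {w : V} (p' : BPath u w) (e : w ⟶ v) (f : u ⟶ v),
        (p'.comp (.edge e)).toPath ≠ (BPath.edge f).toPath := fun p' e f h => by
      have h₁ := p'.length_pos
      have h₂ := congrArg Quiver.Path.length h
      rw [length_pathEdges] at h₁
      simp only [BPath.toPath, Quiver.Path.length_comp, Quiver.Path.length_toPath] at h₂
      omega
    rcases exists_rebrackets_comp_edge p with ⟨e, rfl⟩ | ⟨w, p', e, hp⟩ <;>
    rcases exists_rebrackets_comp_edge q with ⟨f, rfl⟩ | ⟨w', q', f, hq⟩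
    · have := eq_of_heq (Quiver.Path.hom_heq_of_cons_eq_cons h)
      rw [this]
    · exact absurd (h.trans (reflTransGen_rebrackets_toPath hq)).symm (hedge _ _ _)
    · exact absurd ((reflTransGen_rebrackets_toPath hp).symm.trans h) (hedge _ _ _)
    · have h' := (reflTransGen_rebrackets_toPath hp).symm.trans
        (h.trans (reflTransGen_rebrackets_toPath hq))
      have hlen := congrArg Quiver.Path.length (reflTransGen_rebrackets_toPath hp)
      rw [hn] at hlen
      simp only [BPath.toPath, Quiver.Hom.toPath, Quiver.Path.comp_cons, Quiver.Path.comp_nil,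
        Quiver.Path.length_cons] at h' hlen
      obtain rfl := Quiver.Path.obj_eq_of_cons_eq_cons h'
      have h₁ := eq_of_heq (Quiver.Path.heq_of_cons_eq_cons h')
      have h₂ := eq_of_heq (Quiver.Path.hom_heq_of_cons_eq_cons h')
      subst h₂
      exact hp.trans (((ih p' q' h₁ (by omega)).lift (·.comp (.edge e))
        fun _ _ h => h.comp_right _).trans (hsymm hq))

theorem exists_toPath_eq {u v : V} (p : Quiver.Path u v) (h : 0 < p.length) :
    ∃ b : BPath u v, b.toPath = p := by
  induction p with
  | nil => simp at h
  | cons p e ih =>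
    rcases Nat.eq_zero_or_pos p.length with h₀ | h₀
    · cases p with
      | nil => exact ⟨.edge e, rfl⟩
      | cons => simp at h₀
    · obtain ⟨b, rfl⟩ := ih h₀
      exact ⟨b.comp (.edge e), rfl⟩

/-- Any two walks are the two sides of a hole in some bracketed walk. -/
theorem exists_context {s t a b : V} (l : Quiver.Path s a) (r : Quiver.Path b t) :
    ∃ C : Context a b s t, C.leftPath = l ∧ C.rightPath = r := by
  have h : ∃ C : Context a b s b, C.leftPath = l ∧ C.rightPath = .nil := by
    rcases Nat.eq_zero_or_pos l.length with h₀ | h₀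
    · cases l with
      | nil => exact ⟨.hole, rfl, rfl⟩
      | cons => simp at h₀
    · obtain ⟨p, rfl⟩ := exists_toPath_eq l h₀
      exact ⟨.left p .hole, by simp [Context.leftPath], rfl⟩
  obtain ⟨C, hl, hr⟩ := h
  rcases Nat.eq_zero_or_pos r.length with h₀ | h₀
  · cases r with
    | nil => exact ⟨C, hl, hr⟩
    | cons => simp at h₀
  · obtain ⟨p, rfl⟩ := exists_toPath_eq r h₀
    exact ⟨.right C p, hl, by simp [Context.rightPath, hr]⟩

end Rebracketing

/-! ### Bracketed sweeps -/

section BracketedSweep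

variable {V : Type*} [Quiver V] {I : Type*}

/-- A step from `p` to `q` that is a step of rebracketing if the kind is `none`, and replaces the
domain of `bf i` by its codomain if the kind is `some i`. -/
def IsStep (bf : I → ParBPath V) (k : Option I) {s t : V} (p q : BPath s t) : Prop :=
  ∃ S : Step p q, (∀ i, k = some i → S.pair = bf i) ∧ (k = none → Nonempty (Rebracket S.pair))

/-- A sequence of bracketed walks from `p` to `q`, each of which arises from the preceding one by
a step: either a step of rebracketing, of kind `none`, or the replacement of the domain of
the member `i` of the family `bf` by its codomain, of kind `some i`.  The members of the list are
used exactly once, and each codomain has only its end points in common with earlier walks. -/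
structure BracketedSweep (bf : I → ParBPath V) {s t : V} (p q : BPath s t) (L : List I) (N : ℕ)
    (row : ℕ → BPath s t) (kind : ℕ → Option I) : Prop where
  row_zero : row 0 = p
  row_eq : ∀ n, N ≤ n → row n = q
  step : ∀ n, n < N → IsStep bf (kind n) (row n) (row (n + 1))
  mem_of_kind : ∀ n i, n < N → kind n = some i → i ∈ L
  exists_kind : ∀ i ∈ L, ∃ n < N, kind n = some i
  kind_injective : ∀ n m i, n < N → m < N → kind n = some i → kind m = some i → n = m
  fresh : ∀ n i, n < N → kind n = some i → ∀ x ∈ (bf i).codom.toPath.vertices, ∀ j ≤ n,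
    x ∈ (row j).toPath.vertices → x = (bf i).src ∨ x = (bf i).snk
  swept : ∀ n, ∀ x ∈ (row n).toPath.vertices,
    SweptVertex p.toPath (L.map fun i => (bf i).toParPath) x

theorem BracketedSweep.nil (bf : I → ParBPath V) {s t : V} (p : BPath s t) :
    BracketedSweep bf p p [] 0 (fun _ => p) (fun _ => none) where
  row_zero := rfl
  row_eq _ _ := rfl
  step n hn := absurd hn (Nat.not_lt_zero n)
  mem_of_kind n _ hn := absurd hn (Nat.not_lt_zero n)
  exists_kind i hi := by simp at hi
  kind_injective n _ _ hn := absurd hn (Nat.not_lt_zero n)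
  fresh n _ hn := absurd hn (Nat.not_lt_zero n)
  swept _ _ hx := Or.inl hx

theorem SweptVertex.mono {s t : V} {p : Quiver.Path s t} {L L' : List (ParPath V)} {x : V}
    (h : SweptVertex p L x) (hL : ∀ c ∈ L, c ∈ L') : SweptVertex p L' x :=
  h.imp_right fun ⟨c, hc, hx⟩ => ⟨c, hL c hc, hx⟩

/-- A sequence of bracketed walks is extended by one step. -/
theorem BracketedSweep.snoc {bf : I → ParBPath V} {s t : V} {p q q' : BPath s t} {L L' : List I}
    {N : ℕ} {row : ℕ → BPath s t} {kind : ℕ → Option I} (h : BracketedSweep bf p q L N row kind)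
    (k : Option I) (hL : ∀ i, i ∈ L' ↔ i ∈ L ∨ k = some i) (hk : ∀ i ∈ L, k ≠ some i)
    (S : Step q q') (hS : ∀ i, k = some i → S.pair = bf i)
    (hS' : k = none → Nonempty (Rebracket S.pair))
    (hfresh : ∀ i, k = some i → ∀ x ∈ (bf i).codom.toPath.vertices,
      SweptVertex p.toPath (L.map fun i => (bf i).toParPath) x →
        x = (bf i).src ∨ x = (bf i).snk) :
    BracketedSweep bf p q' L' (N + 1) (fun n => if n ≤ N then row n else q')
      (fun n => if n < N then kind n else k) where
  row_zero := by simp [h.row_zero]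
  row_eq n hn := if_neg (by omega)
  step n hn := by
    rcases Nat.lt_succ_iff_lt_or_eq.1 hn with hn | rfl
    · rw [if_pos hn.le, if_pos hn, if_pos (Nat.succ_le_of_lt hn)]
      exact h.step n hn
    · rw [if_pos le_rfl, if_neg (lt_irrefl _), if_neg (Nat.not_succ_le_self _), h.row_eq n le_rfl]
      exact ⟨S, hS, hS'⟩
  mem_of_kind n i hn hi := by
    rcases Nat.lt_succ_iff_lt_or_eq.1 hn with hn | rfl
    · simp only [hn, if_true] at hi
      exact (hL i).2 (Or.inl (h.mem_of_kind n i hn hi))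
    · simp only [lt_irrefl, if_false] at hi
      exact (hL i).2 (Or.inr hi)
  exists_kind i hi := by
    rcases (hL i).1 hi with hi | hi
    · obtain ⟨n, hn, hi⟩ := h.exists_kind i hi
      exact ⟨n, by omega, by simp only [hn, if_true, hi]⟩
    · exact ⟨N, by omega, by simp only [lt_irrefl, if_false, hi]⟩
  kind_injective n m i hn hm hni hmi := by
    rcases Nat.lt_succ_iff_lt_or_eq.1 hn with hn | rfl <;>
    rcases Nat.lt_succ_iff_lt_or_eq.1 hm with hm | rfl
    · simp only [hn, hm, if_true] at hni hmi
      exact h.kind_injective n m i hn hm hni hmi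
    · simp only [hn, lt_irrefl, if_true, if_false] at hni hmi
      exact absurd hmi (hk i (h.mem_of_kind n i hn hni))
    · simp only [hm, lt_irrefl, if_true, if_false] at hni hmi
      exact absurd hni (hk i (h.mem_of_kind m i hm hmi))
    · rfl
  fresh n i hn hi x hx j hj hxj := by
    have hjN : j ≤ N := by omega
    simp only [hjN, if_true] at hxj
    rcases Nat.lt_succ_iff_lt_or_eq.1 hn with hn | rfl
    · simp only [hn, if_true] at hi
      exact h.fresh n i hn hi x hx j hj hxj
    · simp only [lt_irrefl, if_false] at hi
      exact hfresh i hi x hx (h.swept j x hxj)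
  swept n x hx := by
    have hmono : ∀ c ∈ L.map fun i => (bf i).toParPath, c ∈ L'.map fun i => (bf i).toParPath := by
      intro c hc
      obtain ⟨i, hi, rfl⟩ := List.mem_map.1 hc
      exact List.mem_map_of_mem ((hL i).2 (Or.inl hi))
    by_cases hn : n ≤ N
    · simp only [hn, if_true] at hx
      exact (h.swept n x hx).mono hmono
    · simp only [hn, if_false] at hx
      have hq : ∀ x ∈ q.toPath.vertices,
          SweptVertex p.toPath (L'.map fun i => (bf i).toParPath) x := fun x hx =>
        (h.swept N x (by rwa [h.row_eq N le_rfl])).mono hmono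
      have hE : S.E.toPath.vertices ⊆ S.D.toPath.vertices ∨ ∃ i, k = some i := by
        cases k with
        | some i => exact Or.inr ⟨i, rfl⟩
        | none =>
          obtain ⟨r⟩ := hS' rfl
          have : S.D.toPath = S.E.toPath := r.toPath_eq
          rw [this]
          exact Or.inl fun _ h => h
      rcases S.mem_vertices_codom_iff.1 hx with hx | hx | hx
      · exact hq x (S.mem_vertices_dom_iff.2 (Or.inl hx))
      · rcases hE with hE | ⟨i, hi⟩
        · exact hq x (S.mem_vertices_dom (hE hx))
        · refine Or.inr ⟨(bf i).toParPath, List.mem_map_of_mem ((hL i).2 (Or.inr hi)), ?_⟩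
          rw [← hS i hi]
          exact hx
      · exact hq x (S.mem_vertices_dom_iff.2 (Or.inr (Or.inr hx)))

/-- The last walk of the sequence can be rebracketed arbitrarily, by appending steps of
rebracketing. -/
theorem BracketedSweep.rebracket {bf : I → ParBPath V} {s t : V} {p q q' : BPath s t} {L : List I}
    (h : ∃ N row kind, BracketedSweep bf p q L N row kind) (hq : q.toPath = q'.toPath) :
    ∃ N row kind, BracketedSweep bf p q' L N row kind := by
  have hr := reflTransGen_rebrackets q q' hq
  induction hr with
  | refl => exact h
  | @tail q₁ q₂ h₁ h₂ ih =>
    obtain ⟨N, row, kind, h⟩ := ih (reflTransGen_rebrackets_toPath h₁)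
    obtain ⟨S, hS⟩ := h₂
    exact ⟨_, _, _, h.snoc (L' := L) none (by simp) (by simp) S (by simp) (fun _ => hS) (by simp)⟩

/-- A sweep is refined to a sequence of steps on bracketed walks. -/
theorem Sweep.exists_bracketedSweep (bf : I → ParBPath V) {M : List (ParPath V)} {c : ParPath V}
    (h : Sweep M c) : ∀ (L : List I), L.Nodup → M = L.map (fun i => (bf i).toParPath) →
      ∀ p : BPath c.src c.snk, p.toPath = c.dom → ∀ q : BPath c.src c.snk, q.toPath = c.codom →
        ∃ N row kind, BracketedSweep bf p q L N row kind := by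
  induction h with
  | nil p₀ =>
    intro L _ hM p hp q hq
    obtain rfl := List.map_eq_nil_iff.1 hM.symm
    exact BracketedSweep.rebracket ⟨_, _, _, .nil bf p⟩ (hp.trans hq.symm)
  | @snoc M s t a b p₀ l d e r h fresh ih =>
    intro L hL hM p hp q hq
    obtain ⟨L₁, L₂, rfl, hL₁, hL₂⟩ := List.map_eq_append_iff.1 hM.symm
    obtain ⟨i, rfl⟩ : ∃ i, L₂ = [i] := by
      have := congrArg List.length hL₂
      exact List.length_eq_one_iff.1 (by simpa using this)
    simp only [List.map_cons, List.map_nil, List.cons.injEq, and_true] at hL₂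
    obtain ⟨C, hCl, hCr⟩ := exists_context l r
    obtain ⟨D, E, hDE, rfl, rfl⟩ : ∃ D E : BPath a b, bf i = ⟨a, b, D, E⟩ ∧ D.toPath = d ∧
        E.toPath = e := by
      generalize bf i = c at hL₂
      obtain ⟨a', b', D, E⟩ := c
      cases hL₂
      exact ⟨D, E, rfl, rfl, rfl⟩
    have hi : i ∉ L₁ := fun hi => by
      rw [List.nodup_append] at hL
      exact hL.2.2 i hi i (by simp) rfl
    obtain ⟨N, row, kind, hs⟩ := ih L₁ (List.nodup_append.1 hL).1 hL₁.symm p hp (C.fill D)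
      (by rw [Context.toPath_fill, hCl, hCr])
    refine BracketedSweep.rebracket (q := C.fill E) ⟨_, _, _, hs.snoc (L' := L₁ ++ [i]) (some i)
      (by simp [eq_comm]) ?_ ⟨a, b, D, E, C, rfl, rfl⟩ ?_ (by simp) ?_⟩ ?_
    · rintro j hj h
      cases h
      exact hi hj
    · rintro j h
      cases h
      exact hDE.symm
    · rintro j h x hx hsx
      cases h
      rw [hDE] at hx ⊢
      rw [hL₁, show p.toPath = p₀ from hp] at hsx
      exact fresh x hx hsx
    · rw [Context.toPath_fill, hCl, hCr]
      exact hq.symm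

end BracketedSweep

/-! ### Walks with names -/

section Named

variable {V : Type} [Quiver.{0} V]

/-- Infinitely many copies of the vertices of `V`, distinguished by their names. -/
structure Named (V : Type) : Type where
  name : ℕ
  val : V

/-- Between named vertices there are infinitely many copies of each edge. -/
instance : Quiver.{0} (Named V) := ⟨fun u v => ℕ × (u.val ⟶ v.val)⟩

/-- The name of an edge. -/
def edgeName (e : Quiver.Total (Named V)) : ℕ := Prod.fst (α := ℕ) e.hom

/-- Forget the names. -/
def Named.proj : Named V ⥤q V where
  obj := Named.val
  map e := Prod.snd (α := ℕ) e

/-- The copy of a bracketed walk in which all edges and all inner vertices have the name `i`, and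
the end points have given names. -/
def BPath.copy (i : ℕ) : ∀ {u v : V} (_ : BPath u v) (m k : ℕ), BPath (Named.mk m u) (Named.mk k v)
  | u, v, .edge e, m, k => .edge (u := Named.mk m u) (v := Named.mk k v) (i, e)
  | _, _, .comp p q, m, k => .comp (p.copy i m i) (q.copy i i k)

theorem BPath.copy_map (i : ℕ) {u v : V} (p : BPath u v) (m k : ℕ) :
    (p.copy i m k).map Named.proj = p := by
  induction p generalizing m k with
  | edge e => rfl
  | comp p q hp hq => exact congrArg₂ BPath.comp (hp _ _) (hq _ _)

theorem BPath.mem_vertices_copy {i : ℕ} {u v : V} {p : BPath u v} {m k : ℕ} {w : Named V}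
    (h : w ∈ (p.copy i m k).toPath.vertices) : w = ⟨m, u⟩ ∨ w = ⟨k, v⟩ ∨ w.name = i := by
  induction p generalizing m k with
  | edge e =>
    simp only [copy, toPath, Quiver.Hom.toPath, Quiver.Path.mem_vertices_cons,
      Quiver.Path.vertices_nil, List.mem_singleton] at h
    exact h.imp_right Or.inl
  | comp p q hp hq =>
    simp only [copy, toPath, mem_vertices_comp] at h
    rcases h with h | h
    · rcases hp h with h | h | h
      · exact Or.inl h
      · exact Or.inr (Or.inr (congrArg Named.name h))
      · exact Or.inr (Or.inr h)
    · rcases hq h with h | h | h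
      · exact Or.inr (Or.inr (congrArg Named.name h))
      · exact Or.inr (Or.inl h)
      · exact Or.inr (Or.inr h)

theorem BPath.mem_pathEdges_copy {i : ℕ} {u v : V} {p : BPath u v} {m k : ℕ}
    {e : Quiver.Total (Named V)} (h : e ∈ pathEdges (p.copy i m k).toPath) : edgeName e = i := by
  induction p generalizing m k with
  | edge e =>
    simp only [copy, toPath, Quiver.Hom.toPath, pathEdges, List.nil_append,
      List.mem_singleton] at h
    subst h
    rfl
  | comp p q hp hq =>
    simp only [copy, toPath, pathEdges_comp, List.mem_append] at h
    exact h.elim hp hq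

/-- A factorization of a bracketed walk through a context can be lifted to a walk with names. -/
theorem Named.exists_context {a b u v : V} (c : Context a b u v) (d : BPath a b) {m k : ℕ}
    (p : BPath (Named.mk m u) (Named.mk k v)) (h : p.map Named.proj = c.fill d) :
    ∃ (i j : ℕ) (c' : Context (Named.mk i a) (Named.mk j b) (Named.mk m u) (Named.mk k v))
      (d' : BPath (Named.mk i a) (Named.mk j b)),
      p = c'.fill d' ∧ c'.map Named.proj = c ∧ d'.map Named.proj = d := by
  induction c generalizing m k with
  | hole => exact ⟨m, k, .hole, p, rfl, rfl, h⟩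
  | left r c ih =>
    cases p with
    | edge e => simp [BPath.map, Context.fill] at h
    | @comp _ w _ p q =>
      obtain ⟨l, w⟩ := w
      simp only [BPath.map, Context.fill] at h
      injection h with h₁ h₂ h₃ h₄ h₅
      change w = _ at h₂
      subst h₂
      obtain ⟨i, j, c', d', rfl, hc, hd⟩ := ih q (eq_of_heq h₅)
      exact ⟨i, j, .left p c', d', rfl, congrArg₂ Context.left (eq_of_heq h₄) hc, hd⟩
  | right c r ih =>
    cases p with
    | edge e => simp [BPath.map, Context.fill] at h
    | @comp _ w _ p q =>
      obtain ⟨l, w⟩ := w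
      simp only [BPath.map, Context.fill] at h
      injection h with h₁ h₂ h₃ h₄ h₅
      change w = _ at h₂
      subst h₂
      obtain ⟨i, j, c', d', rfl, hc, hd⟩ := ih p (eq_of_heq h₄)
      exact ⟨i, j, .right c' q, d', rfl, congrArg₂ Context.right hc (eq_of_heq h₅), hd⟩

/-- A step can be lifted to walks with names, so that everything in the new segment except for its
end points gets a prescribed name. -/
theorem Named.exists_step {s t : V} {m k : ℕ} (p : BPath (Named.mk m s) (Named.mk k t))
    {p₀ q₀ : BPath s t} (hp : p.map Named.proj = p₀) (S : Step p₀ q₀) (i : ℕ) :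
    ∃ (q : BPath (Named.mk m s) (Named.mk k t)) (S' : Step p q), q.map Named.proj = q₀ ∧
      S'.pair.map Named.proj = S.pair ∧
      (∀ w ∈ S'.E.toPath.vertices, w = S'.a ∨ w = S'.b ∨ w.name = i) ∧
      ∀ e ∈ pathEdges S'.E.toPath, edgeName e = i := by
  obtain ⟨a, b, D, E, C, hD, hE⟩ := S
  obtain ⟨j, l, c, d, hpd, hc, hd⟩ := Named.exists_context C D p (hp.trans hD)
  refine ⟨c.fill (E.copy i j l), ⟨_, _, d, E.copy i j l, c, hpd, rfl⟩, ?_, ?_,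
    fun w => BPath.mem_vertices_copy, fun e => BPath.mem_pathEdges_copy⟩
  · rw [Context.map_fill, hE]
    exact congrArg₂ (fun (x : BPath a b) (y : Context a b s t) => y.fill x) (E.copy_map i j l) hc
  · simp only [Step.pair, ParBPath.map, hd, E.copy_map i j l]
    rfl

variable {I : Type} {bf : I → ParBPath V} {s t : V} {p q : BPath s t} {L : List I} {N : ℕ}
  {row : ℕ → BPath s t} {kind : ℕ → Option I}

/-- A step between walks with names whose kind is `k`, and whose new segment has the name `i`. -/
def IsNamedStep (bf : I → ParBPath V) (k : Option I) (i : ℕ)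
    {s t : Named V} (p q : BPath s t) : Prop :=
  ∃ S : Step p q, ((∀ i, k = some i → S.pair.map Named.proj = bf i) ∧
    (k = none → Nonempty (Rebracket (S.pair.map Named.proj)))) ∧
    (∀ w ∈ S.E.toPath.vertices, w = S.a ∨ w = S.b ∨ w.name = i) ∧
    ∀ e ∈ pathEdges S.E.toPath, edgeName e = i

/-- A sequence of bracketed walks can be lifted to walks with names, so that everything that is new
in row `n` has the name `n`. -/
theorem BracketedSweep.exists_named (h : BracketedSweep bf p q L N row kind) :
    ∃ nrow : ℕ → BPath (Named.mk 0 s) (Named.mk 0 t), nrow 0 = (row 0).copy 0 0 0 ∧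
      (∀ n, (nrow n).map Named.proj = row n) ∧
      ∀ n < N, IsNamedStep bf (kind n) (n + 1) (nrow n) (nrow (n + 1)) := by
  have key : ∀ n (P : {P : BPath (Named.mk 0 s) (Named.mk 0 t) // P.map Named.proj = row n}),
      ∃ Q : {Q : BPath (Named.mk 0 s) (Named.mk 0 t) // Q.map Named.proj = row (n + 1)},
        n < N → IsNamedStep bf (kind n) (n + 1) P.1 Q.1 := by
    rintro n ⟨P, hP⟩
    by_cases hn : n < N
    · obtain ⟨S, hS, hS'⟩ := h.step n hn
      obtain ⟨Q, S', hQ, hp, hv, he⟩ := Named.exists_step P hP S (n + 1)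
      refine ⟨⟨Q, hQ⟩, fun _ => ⟨S', ⟨?_, ?_⟩, hv, he⟩⟩
      · rwa [hp]
      · rwa [hp]
    · refine ⟨⟨P, ?_⟩, fun h => absurd h hn⟩
      rw [hP, h.row_eq n (by omega), h.row_eq (n + 1) (by omega)]
  choose f hf using key
  let r : ∀ n, {P : BPath (Named.mk 0 s) (Named.mk 0 t) // P.map Named.proj = row n} := fun n =>
    Nat.rec ⟨(row 0).copy 0 0 0, BPath.copy_map _ _ _ _⟩ f n
  exact ⟨fun n => (r n).1, rfl, fun n => (r n).2, fun n hn => hf n (r n) hn⟩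

/-- A sequence of bracketed walks lifts to a sequence of rows in which new segments are disjoint
from the preceding rows. -/
theorem BracketedSweep.exists_rowSequence (h : BracketedSweep bf p q L N row kind)
    (x : V → ℝ) (hx : ∀ {u v : V} (_ : u ⟶ v), x u < x v) :
    ∃ R : RowSequence (Named V) N,
      (∀ n m, (⟨_, _, (R.row n).map Named.proj, (R.row m).map Named.proj⟩ : ParBPath V) =
        ⟨s, t, row n, row m⟩) ∧
      (∀ w w' : Named V, w.val = w'.val → R.x w = R.x w') ∧
      ∀ n : Fin N, (∀ i, kind n = some i → (R.step n).pair.map Named.proj = bf i) ∧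
        (kind n = none → Nonempty (Rebracket ((R.step n).pair.map Named.proj))) := by
  obtain ⟨nrow, h0, hmap, hstep⟩ := h.exists_named
  choose S hS hv he using hstep
  -- Row `n` only contains names up to `n`, whereas the new segment of step `n` has the name `n + 1`.
  have hname : ∀ n ≤ N, (∀ w ∈ (nrow n).toPath.vertices, w.name ≤ n) ∧
      ∀ e ∈ pathEdges (nrow n).toPath, edgeName e ≤ n := by
    intro n
    induction n with
    | zero =>
      intro _
      rw [h0]
      refine ⟨fun w hw => ?_, fun e he => (BPath.mem_pathEdges_copy he).le⟩
      rcases BPath.mem_vertices_copy hw with h | h | h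
      · exact (congrArg Named.name h).le
      · exact (congrArg Named.name h).le
      · exact h.le
    | succ n ih =>
      intro hn
      obtain ⟨ihv, ihe⟩ := ih (by omega)
      refine ⟨fun w hw => ?_, fun e hwe => ?_⟩
      · rcases (S n hn).mem_vertices_codom_iff.1 hw with h | h | h
        · exact (ihv w ((S n hn).mem_vertices_dom_iff.2 (Or.inl h))).trans n.le_succ
        · rcases hv n hn w h with rfl | rfl | h
          · exact (ihv _ (S n hn).left_mem_vertices_dom).trans n.le_succ
          · exact (ihv _ (S n hn).right_mem_vertices_dom).trans n.le_succ
          · exact h.le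
        · exact (ihv w ((S n hn).mem_vertices_dom_iff.2 (Or.inr (Or.inr h)))).trans n.le_succ
      · rw [(S n hn).pathEdges_codom, List.mem_append, List.mem_append] at hwe
        have hd := fun h => (ihe e ((S n hn).pathEdges_dom ▸ h)).trans n.le_succ
        rw [List.mem_append, List.mem_append] at hd
        rcases hwe with h | h | h
        · exact hd (Or.inl h)
        · exact (he n hn e h).le
        · exact hd (Or.inr (Or.inr h))
  refine ⟨{
    s := _
    t := _
    row := nrow
    step := fun i => S i.1 i.2
    x := fun w => x w.val
    x_lt := fun e => hx (Prod.snd (α := ℕ) e)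
    vfresh := fun i w hw j hj hwj => ?_
    efresh := fun i e hwe j hj hej => ?_ }, fun n m => ?_, fun w w' h => congrArg x h,
    fun n => hS n.1 n.2⟩
  · rcases hv i.1 i.2 w hw with h | h | h
    · exact Or.inl h
    · exact Or.inr h
    · have := (hname j (by omega)).1 w hwj
      omega
  · have h₁ := he i.1 i.2 e hwe
    have h₂ := (hname j (by omega)).2 e hej
    omega
  · rw [← hmap n, ← hmap m]
    rfl

end Named

/-! ### Collapsing the steps of rebracketing -/

/-- Elements that occur in a sequence of stages and have the same label are related, provided that
labels distinguish the elements of one stage and that a new element of a stage either is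
related to an element of the preceding stage with the same label or has a new label. -/
theorem eqvGen_of_label {X Y : Type*} (label : X → Y) (r : X → X → Prop) (mem : ℕ → X → Prop)
    (N : ℕ)
    (hinj : ∀ n x y, mem n x → mem n y → label x = label y → x = y)
    (hstep : ∀ n < N, ∀ x, mem (n + 1) x →
      (∃ y, mem n y ∧ label y = label x ∧ Relation.EqvGen r y x) ∨
        ∀ j ≤ n, ∀ y, mem j y → label y ≠ label x) :
    ∀ n ≤ N, ∀ j ≤ n, ∀ j' ≤ n, ∀ x y, mem j x → mem j' y → label x = label y →
      Relation.EqvGen r x y := by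
  intro n
  induction n with
  | zero =>
    intro _ j hj j' hj' x y hx hy h
    obtain rfl := Nat.le_zero.1 hj
    obtain rfl := Nat.le_zero.1 hj'
    rw [hinj 0 x y hx hy h]
    exact .refl _
  | succ n ih =>
    intro hn
    have hcase : ∀ j ≤ n + 1, ∀ x, mem j x →
        (∃ j ≤ n, ∃ y, mem j y ∧ label y = label x ∧ Relation.EqvGen r y x) ∨
          (mem (n + 1) x ∧ ∀ j ≤ n, ∀ y, mem j y → label y ≠ label x) := by
      intro j hj x hx
      rcases Nat.le_succ_iff.1 hj with hj | rfl
      · exact Or.inl ⟨j, hj, x, hx, rfl, .refl _⟩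
      · rcases hstep n hn x hx with ⟨y, h⟩ | h
        · exact Or.inl ⟨n, le_rfl, y, h⟩
        · exact Or.inr ⟨hx, h⟩
    intro j hj j' hj' x y hx hy h
    rcases hcase j hj x hx with ⟨i, hi, x', hx', hlx, hrx⟩ | ⟨hx', hnx⟩ <;>
    rcases hcase j' hj' y hy with ⟨i', hi', y', hy', hly, hry⟩ | ⟨hy', hny⟩
    · exact (hrx.symm _ _).trans _ _ _ ((ih (by omega) i hi i' hi' x' y' hx' hy'
        (hlx.trans (h.trans hly.symm))).trans _ _ _ hry)
    · exact absurd (hlx.trans h) (hny i hi x' hx')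
    · exact absurd (hly.trans h.symm) (hnx i' hi' y' hy')
    · rw [hinj _ x y hx' hy' h]
      exact .refl _

/-- Morphisms of graphs preserve bracketings, so that a pair of bracketed walks is an associativity
if its image is a step of rebracketing. -/
theorem isAssociativity_of_map {V W : Type*} [Quiver V] [Quiver W] {π : V ⥤q W} {c : ParBPath V}
    (h : Nonempty (Rebracket (c.map π))) : IsAssociativity c := by
  obtain ⟨r⟩ := h
  obtain ⟨s, t, p, q⟩ := c
  have key : (∃ b₁ b₂ b₃ : Bracketing, p.bracketing = .app (.app b₁ b₂) b₃ ∧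
      q.bracketing = .app b₁ (.app b₂ b₃)) ∨ ∃ b₁ b₂ b₃ : Bracketing,
      p.bracketing = .app b₁ (.app b₂ b₃) ∧ q.bracketing = .app (.app b₁ b₂) b₃ := by
    rw [← p.bracketing_map π, ← q.bracketing_map π]
    change Rebracket ⟨_, _, p.map π, q.map π⟩ at r
    generalize p.map π = p' at *
    generalize q.map π = q' at *
    cases r with
    | assoc => exact Or.inl ⟨_, _, _, rfl, rfl⟩
    | assocInv => exact Or.inr ⟨_, _, _, rfl, rfl⟩
  have happ : ∀ {u v : V} (p : BPath u v) {b₁ b₂ : Bracketing}, p.bracketing = .app b₁ b₂ →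
      ∃ (w : V) (p₁ : BPath u w) (p₂ : BPath w v), p = p₁.comp p₂ ∧ p₁.bracketing = b₁ ∧
        p₂.bracketing = b₂ := by
    intro u v p b₁ b₂ h
    cases p with
    | edge e => cases h
    | comp p₁ p₂ =>
      injection h with h₁ h₂
      exact ⟨_, p₁, p₂, rfl, h₁, h₂⟩
  rcases key with ⟨b₁, b₂, b₃, hp, hq⟩ | ⟨b₁, b₂, b₃, hp, hq⟩
  · obtain ⟨w, p₁₂, p₃, rfl, h₁₂, h₃⟩ := happ p hp
    obtain ⟨w', p₁, p₂, rfl, h₁, h₂⟩ := happ p₁₂ h₁₂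
    obtain ⟨z, q₁, q₂₃, rfl, k₁, k₂₃⟩ := happ q hq
    obtain ⟨z', q₂, q₃, rfl, k₂, k₃⟩ := happ q₂₃ k₂₃
    exact .fwd _ _ _ _ _ _ (h₁.trans k₁.symm) (h₂.trans k₂.symm) (h₃.trans k₃.symm)
  · obtain ⟨w, p₁, p₂₃, rfl, h₁, h₂₃⟩ := happ p hp
    obtain ⟨w', p₂, p₃, rfl, h₂, h₃⟩ := happ p₂₃ h₂₃
    obtain ⟨z, q₁₂, q₃, rfl, k₁₂, k₃⟩ := happ q hq
    obtain ⟨z', q₁, q₂, rfl, k₁, k₂⟩ := happ q₁₂ k₁₂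
    exact .bwd _ _ _ _ _ _ (h₁.trans k₁.symm) (h₂.trans k₂.symm) (h₃.trans k₃.symm)

theorem getElem?_eq_some_of_map {X Y : Type*} {f : X → Y} (hf : Function.Injective f) {l : List X}
    {l' : List Y} (h : l.map f = l') {k : ℕ} {x : X} (hk : l'[k]? = some (f x)) :
    l[k]? = some x := by
  subst h
  rw [List.getElem?_map, Option.map_eq_some_iff] at hk
  obtain ⟨y, hy, hxy⟩ := hk
  rw [hy, hf hxy]

theorem eq_of_map_getElem? {X Y Z : Type*} {f : X → Y} {g : Y → Z} {l l' : List X} {m m' : List Y}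
    (h : l.map f = m) (h' : l'.map f = m') (hm : m.map g = m'.map g) {k : ℕ} {x x' : X}
    (hx : l[k]? = some x) (hx' : l'[k]? = some x') : g (f x) = g (f x') := by
  subst h h'
  have := congrArg (·[k]?) hm
  simpa [hx, hx'] using this

theorem exists_getElem?_of_map_eq {X Y : Type*} {f : X → Y} {l l' : List X} (h : l.map f = l'.map f)
    {x : X} (hx : x ∈ l') :
    ∃ (k : ℕ) (y : X), y ∈ l ∧ l[k]? = some y ∧ l'[k]? = some x ∧ f y = f x := by
  obtain ⟨k, hk⟩ := List.mem_iff_getElem?.1 hx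
  have h₁ : (l.map f)[k]? = some (f x) := by rw [h, List.getElem?_map, hk]; rfl
  rw [List.getElem?_map, Option.map_eq_some_iff] at h₁
  obtain ⟨y, hy, hxy⟩ := h₁
  exact ⟨k, y, List.mem_iff_getElem?.2 ⟨k, hy⟩, hy, hk, hxy⟩

/-! ### Existence of composition scheme extensions -/

section Extension

variable {G : BracketedGraph}

theorem BracketedGraph.toParPath_bface (G : BracketedGraph) (F : G.InteriorFace) :
    (G.bface F).toParPath = G.face F := by
  simp only [ParBPath.toParPath, BracketedGraph.bface, (G.faceDom F).2, (G.faceCodom F).2]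

/-- The edges of a walk come from the first walk and from the faces that have been used before. -/
theorem BracketedSweep.edge_swept {V : Type*} [Quiver V] {I : Type*} {bf : I → ParBPath V} {s t : V}
    {p q : BPath s t} {L : List I} {N : ℕ} {row : ℕ → BPath s t} {kind : ℕ → Option I}
    (h : BracketedSweep bf p q L N row kind) {n : ℕ} (hn : n ≤ N) {e : Quiver.Total V}
    (he : e ∈ pathEdges (row n).toPath) : e ∈ pathEdges p.toPath ∨
      ∃ m < n, ∃ i, kind m = some i ∧ e ∈ pathEdges (bf i).codom.toPath := by
  induction n with
  | zero => rw [h.row_zero] at he; exact Or.inl he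
  | succ n ih =>
    have ih' : e ∈ pathEdges (row n).toPath → _ := fun h' =>
      (ih (by omega) h').imp_right fun ⟨m, hm, h⟩ => (⟨m, by omega, h⟩ : ∃ m < n + 1, ∃ i, _)
    obtain ⟨S, hS, hS'⟩ := h.step n hn
    rw [S.pathEdges_codom, List.mem_append, List.mem_append] at he
    rw [S.pathEdges_dom, List.mem_append, List.mem_append] at ih'
    rcases he with he | he | he
    · exact ih' (Or.inl he)
    · cases hk : kind n with
      | none =>
        obtain ⟨r⟩ := hS' hk
        have : S.D.toPath = S.E.toPath := r.toPath_eq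
        exact ih' (Or.inr (Or.inl (this ▸ he)))
      | some i =>
        refine Or.inr ⟨n, n.lt_succ_self, i, hk, ?_⟩
        rw [← hS i hk]
        exact he
    · exact ih' (Or.inr (Or.inr he))

theorem AnchoredGraph.mem_dom_or_codom (G : AnchoredGraph) (e : Quiver.Total G.V) :
    e ∈ pathEdges G.ext.dom ∨ ∃ F, e ∈ pathEdges (G.face F).codom := by
  obtain ⟨_ | F, hF, -⟩ := G.backward_once e
  · exact Or.inl hF
  · exact Or.inr ⟨F, hF⟩

/-- Each vertex of a connected graph is incident to an edge, because there are at least two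
vertices. -/
theorem Graph.exists_incident (G : Graph) (hG : G.Connected) (v : G.V) :
    ∃ e : Quiver.Total G.V, e.left = v ∨ e.right = v := by
  have := G.finite_V
  have : Nontrivial G.V := Finite.one_lt_card_iff_nontrivial.1 G.two_le_V
  obtain ⟨w, hw⟩ := exists_ne v
  have key : ∀ u w : G.V, Relation.EqvGen (fun a b : G.V => Nonempty (a ⟶ b)) u w → u ≠ w →
      (∃ e : Quiver.Total G.V, e.left = u ∨ e.right = u) ∧
        ∃ e : Quiver.Total G.V, e.left = w ∨ e.right = w := by
    intro u w h
    induction h with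
    | rel a b h =>
      obtain ⟨e⟩ := h
      exact fun _ => ⟨⟨⟨a, b, e⟩, Or.inl rfl⟩, ⟨⟨a, b, e⟩, Or.inr rfl⟩⟩
    | refl => exact fun h => absurd rfl h
    | symm _ _ _ ih => exact fun h => (ih h.symm).symm
    | trans a b c _ _ ih₁ ih₂ =>
      intro hac
      rcases eq_or_ne a b with rfl | hab
      · exact ih₂ hac
      · rcases eq_or_ne b c with rfl | hbc
        · exact ih₁ hac
        · exact ⟨(ih₁ hab).1, (ih₂ hbc).2⟩
  exact (key v w (hG v w) hw.symm).1

/-- A sequence of steps that contains each face of `G` exactly once gives rise to a composition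
scheme extension of `G`: the graph of the lifted sequence, where the steps of rebracketing are
collapsed. -/
theorem BracketedSweep.exists_extension {L : List G.InteriorFace} (hL : ∀ F, F ∈ L) {N : ℕ}
    (F₀ : G.InteriorFace)
    {row : ℕ → BPath G.ext.src G.ext.snk} {kind : ℕ → Option G.InteriorFace}
    (h : BracketedSweep G.bface G.extDom.1 G.extCodom.1 L N row kind)
    (x : G.V → ℝ) (hx : ∀ {u v : G.V} (_ : u ⟶ v), x u < x v) :
    Nonempty (CompositionSchemeExtension G) := by
  obtain ⟨R, hrow, hRx, hRstep⟩ := h.exists_rowSequence x hx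
  obtain ⟨M, rfl⟩ : ∃ M, N = M + 1 := by
    obtain ⟨n, hn, -⟩ := h.exists_kind F₀ (hL F₀)
    exact ⟨N - 1, by omega⟩
  obtain ⟨H, scheme, ι, fe, hιv, hιe, hv, he, hbext, hbface⟩ := R.exists_compositionScheme
  have hlv : ∀ n, (R.row n).toPath.vertices.map Named.proj.obj = (row n).toPath.vertices :=
      fun n => by
    rw [← vertices_mapPath, ← BPath.toPath_map]
    exact congrArg (fun c : ParBPath G.V => c.dom.toPath.vertices) (hrow n n)
  have hle : ∀ n, (pathEdges (R.row n).toPath).map (mapEdge Named.proj) =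
      pathEdges (row n).toPath := fun n => by
    rw [← pathEdges_mapPath, ← BPath.toPath_map]
    exact congrArg (fun c : ParBPath G.V => pathEdges c.dom.toPath) (hrow n n)
  -- The boundaries of the faces of `H`, seen in the graph with names.
  have hface : ∀ i, (H.face (fe i)).map ι = (R.step i).pair.toParPath := fun i =>
    BracketedGraph.face_map H (fe i) (hbface i)
  have hDv : ∀ i, (H.face (fe i)).dom.vertices.map ι.obj = (R.step i).D.toPath.vertices :=
      fun i => by
    rw [← vertices_mapPath]
    exact congrArg (fun c : ParPath (Named G.V) => c.dom.vertices) (hface i)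
  have hEv : ∀ i, (H.face (fe i)).codom.vertices.map ι.obj = (R.step i).E.toPath.vertices :=
    fun i => by
    rw [← vertices_mapPath]
    exact congrArg (fun c : ParPath (Named G.V) => c.codom.vertices) (hface i)
  have hDe : ∀ i, (pathEdges (H.face (fe i)).dom).map (mapEdge ι) = pathEdges (R.step i).D.toPath :=
    fun i => by
    rw [← pathEdges_mapPath]
    exact congrArg (fun c : ParPath (Named G.V) => pathEdges c.dom) (hface i)
  have hEe : ∀ i, (pathEdges (H.face (fe i)).codom).map (mapEdge ι) =
      pathEdges (R.step i).E.toPath := fun i => by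
    rw [← pathEdges_mapPath]
    exact congrArg (fun c : ParPath (Named G.V) => pathEdges c.codom) (hface i)
  -- The two sides of a step of rebracketing have the same labels.
  have hrebr : ∀ i : Fin (M + 1), kind i = none →
      Named.proj.mapPath (R.step i).D.toPath = Named.proj.mapPath (R.step i).E.toPath :=
      fun i hi => by
    obtain ⟨r⟩ := (hRstep i).2 hi
    have := r.toPath_eq
    simp only [ParBPath.map, BPath.toPath_map] at this
    exact this
  have hrv : ∀ i : Fin (M + 1), kind i = none → (R.step i).D.toPath.vertices.map Named.proj.obj =
      (R.step i).E.toPath.vertices.map Named.proj.obj := fun i hi => by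
    rw [← vertices_mapPath, ← vertices_mapPath, hrebr i hi]
  have hre : ∀ i : Fin (M + 1), kind i = none →
      (pathEdges (R.step i).D.toPath).map (mapEdge Named.proj) =
      (pathEdges (R.step i).E.toPath).map (mapEdge Named.proj) := fun i hi => by
    rw [← pathEdges_mapPath, ← pathEdges_mapPath, hrebr i hi]
  -- The labels on the codomain of a step that is a face of `G`.
  have hfacev : ∀ (i : Fin (M + 1)) (F : G.InteriorFace), kind i = some F →
      (R.step i).E.toPath.vertices.map Named.proj.obj = (G.bface F).codom.toPath.vertices :=
      fun i F hi => by
    rw [← vertices_mapPath, ← BPath.toPath_map]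
    exact congrArg (fun c : ParBPath G.V => c.codom.toPath.vertices) ((hRstep i).1 F hi)
  have hfacee : ∀ (i : Fin (M + 1)) (F : G.InteriorFace), kind i = some F →
      (pathEdges (R.step i).E.toPath).map (mapEdge Named.proj) =
        pathEdges (G.bface F).codom.toPath := fun i F hi => by
    rw [← pathEdges_mapPath, ← BPath.toPath_map]
    exact congrArg (fun c : ParBPath G.V => pathEdges c.codom.toPath) ((hRstep i).1 F hi)
  have hcodom : ∀ F, pathEdges (G.bface F).codom.toPath = pathEdges (G.face F).codom := fun F =>
    congrArg (fun c : ParPath G.V => pathEdges c.codom) (G.toParPath_bface F)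
  have hvinj : ∀ n (w w' : Named G.V), w ∈ (R.row n).toPath.vertices →
      w' ∈ (R.row n).toPath.vertices → w.val = w'.val → w = w' := fun n w w' hw hw' hval =>
    vertex_eq_of_x_eq R.x_lt hw hw' (hRx w w' hval)
  have heinj : ∀ n (e e' : Quiver.Total (Named G.V)), e ∈ pathEdges (R.row n).toPath →
      e' ∈ pathEdges (R.row n).toPath → mapEdge Named.proj e = mapEdge Named.proj e' → e = e' := by
    intro n e e' he he' hl
    have hlt := R.x_lt e.hom
    have h₁ := hRx e.left e'.left (congrArg Quiver.Total.left hl)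
    have h₂ := hRx e.right e'.right (congrArg Quiver.Total.right hl)
    -- Both edges lie over the midpoint of the first one.
    refine edge_eq_of_between R.x_lt he he' (X := (R.x e.left + R.x e.right) / 2)
      ⟨by linarith, by linarith⟩ ⟨by linarith, by linarith⟩
  set A : Set H.InteriorFace := {F | kind (fe.symm F) = none} with hA
  have hmemA : ∀ i, fe i ∈ A ↔ kind i = none := fun i => by
    rw [hA, Set.mem_ofPred_eq, Equiv.symm_apply_apply]
  -- Edges of `G`.
  have hsurj : ∀ e : Quiver.Total G.V, ∃ e', mapEdge (ι ⋙q Named.proj) e' = e := by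
    have key : ∀ n ≤ M + 1, ∀ e ∈ pathEdges (row n).toPath,
        ∃ e', mapEdge (ι ⋙q Named.proj) e' = e := by
      intro n hn e hen
      rw [← hle n] at hen
      obtain ⟨e₁, he₁, rfl⟩ := List.mem_map.1 hen
      obtain ⟨e₂, rfl⟩ := (he e₁).2 ⟨n, hn, he₁⟩
      exact ⟨e₂, rfl⟩
    intro e
    rcases G.mem_dom_or_codom e with h₁ | ⟨F, h₁⟩
    · refine key 0 (Nat.zero_le _) e ?_
      rw [h.row_zero, G.extDom.2]
      exact h₁
    · obtain ⟨n, hn, hF⟩ := h.exists_kind F (hL F)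
      refine key (n + 1) hn e ?_
      obtain ⟨S, hS, -⟩ := h.step n hn
      refine S.mem_edges_codom ?_
      rw [← hcodom, ← hS F hF] at h₁
      exact h₁
  have hedgefresh : ∀ n < M + 1, ∀ F, kind n = some F → ∀ e ∈ pathEdges (G.bface F).codom.toPath,
      ∀ j ≤ n, e ∉ pathEdges (row j).toPath := by
    intro n hn F hF e heF j hj hej
    rw [hcodom] at heF
    obtain ⟨_, _, hu⟩ := G.backward_once e
    have h₁ := hu (some F) heF
    rcases h.edge_swept (by omega) hej with h₂ | ⟨m, hm, F', hF', h₂⟩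
    · rw [G.extDom.2] at h₂
      exact Option.some_ne_none _ (h₁.trans (hu none h₂).symm)
    · rw [hcodom] at h₂
      have h₃ : F = F' := Option.some_injective _ (h₁.trans (hu (some F') h₂).symm)
      have := h.kind_injective n m F hn (by omega) hF (h₃ ▸ hF')
      omega
  -- The identifications.
  have hobj : ∀ v v', (ι ⋙q Named.proj).obj v = (ι ⋙q Named.proj).obj v' ↔
      Relation.EqvGen (CollapseVertex H A) v v' := by
    intro v v'
    constructor
    · intro hvv'
      obtain ⟨j, hj, hvj⟩ := (hv (ι.obj v)).1 ⟨v, rfl⟩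
      obtain ⟨j', hj', hvj'⟩ := (hv (ι.obj v')).1 ⟨v', rfl⟩
      refine eqvGen_of_label (ι ⋙q Named.proj).obj (CollapseVertex H A)
        (fun n v => ι.obj v ∈ (R.row n).toPath.vertices) (M + 1)
        (fun n v v' h₁ h₂ h₃ => hιv (hvinj n _ _ h₁ h₂ h₃)) ?_ (M + 1) le_rfl j hj j' hj' v v'
        hvj hvj' hvv'
      intro n hn v hvn
      rcases (R.step ⟨n, hn⟩).vertex_cases R.x_lt hvn with hE | hP
      · cases hk : kind n with
        | none =>
          obtain ⟨k, w, hw, hDk, hEk, hlab⟩ := exists_getElem?_of_map_eq (hrv ⟨n, hn⟩ hk) hE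
          have hwn := (R.step ⟨n, hn⟩).mem_vertices_dom hw
          obtain ⟨w, rfl⟩ := (hv w).2 ⟨n, hn.le, hwn⟩
          exact Or.inl ⟨w, hwn, hlab, .rel _ _ ⟨fe ⟨n, hn⟩, (hmemA _).2 hk, k,
            getElem?_eq_some_of_map hιv (hDv _) hDk, getElem?_eq_some_of_map hιv (hEv _) hEk⟩⟩
        | some F =>
          by_cases hvr : ι.obj v ∈ (R.row n).toPath.vertices
          · exact Or.inl ⟨v, hvr, rfl, .refl _⟩
          refine Or.inr fun j hj w hw hlab => hvr ?_
          -- An old label on the codomain of a face of `G` is the label of its source or its sink.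
          have h₁ : (ι.obj v).val ∈ (G.bface F).codom.toPath.vertices := by
            rw [← hfacev ⟨n, hn⟩ F hk]
            exact List.mem_map_of_mem hE
          have h₂ : (ι.obj v).val ∈ (row j).toPath.vertices := by
            rw [← hlv j, ← show (ι.obj w).val = (ι.obj v).val from hlab]
            exact List.mem_map_of_mem hw
          have hpair := (hRstep ⟨n, hn⟩).1 F hk
          rcases h.fresh n F hn hk _ h₁ j hj h₂ with h₃ | h₃
          · rw [hvinj (n + 1) (ι.obj v) _ hvn ((R.step ⟨n, hn⟩).mem_vertices_codom
              (Quiver.Path.start_mem_vertices _)) (h₃.trans (congrArg ParBPath.src hpair).symm)]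
            exact (R.step ⟨n, hn⟩).left_mem_vertices_dom
          · rw [hvinj (n + 1) (ι.obj v) _ hvn ((R.step ⟨n, hn⟩).mem_vertices_codom
              (Quiver.Path.end_mem_vertices _)) (h₃.trans (congrArg ParBPath.snk hpair).symm)]
            exact (R.step ⟨n, hn⟩).right_mem_vertices_dom
      · exact Or.inl ⟨v, hP.1, rfl, .refl _⟩
    · intro hvv'
      induction hvv' with
      | rel v v' hc =>
        obtain ⟨F, hF, k, h₁, h₂⟩ := hc
        obtain ⟨i, rfl⟩ := fe.surjective F
        exact eq_of_map_getElem? (hDv i) (hEv i) (hrv i ((hmemA i).1 hF)) h₁ h₂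
      | refl => rfl
      | symm _ _ _ ih => exact ih.symm
      | trans _ _ _ _ _ ih₁ ih₂ => exact ih₁.trans ih₂
  have hedge : ∀ e e', mapEdge (ι ⋙q Named.proj) e = mapEdge (ι ⋙q Named.proj) e' ↔
      Relation.EqvGen (CollapseEdge H A) e e' := by
    intro e e'
    constructor
    · intro hee'
      obtain ⟨j, hj, hej⟩ := (he (mapEdge ι e)).1 ⟨e, rfl⟩
      obtain ⟨j', hj', hej'⟩ := (he (mapEdge ι e')).1 ⟨e', rfl⟩
      refine eqvGen_of_label (mapEdge (ι ⋙q Named.proj)) (CollapseEdge H A)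
        (fun n e => mapEdge ι e ∈ pathEdges (R.row n).toPath) (M + 1)
        (fun n e e' h₁ h₂ h₃ => hιe (heinj n _ _ h₁ h₂ h₃)) ?_ (M + 1) le_rfl j hj j' hj' e e'
        hej hej' hee'
      intro n hn e hen
      rcases (R.step ⟨n, hn⟩).edge_cases R.x_lt hen with hE | hP
      · cases hk : kind n with
        | none =>
          obtain ⟨k, f, hf, hDk, hEk, hlab⟩ := exists_getElem?_of_map_eq (hre ⟨n, hn⟩ hk) hE
          have hfn := (R.step ⟨n, hn⟩).mem_edges_dom hf
          obtain ⟨f, rfl⟩ := (he f).2 ⟨n, hn.le, hfn⟩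
          exact Or.inl ⟨f, hfn, hlab, .rel _ _ ⟨fe ⟨n, hn⟩, (hmemA _).2 hk, k,
            getElem?_eq_some_of_map hιe (hDe _) hDk, getElem?_eq_some_of_map hιe (hEe _) hEk⟩⟩
        | some F =>
          refine Or.inr fun j hj f hf hlab => hedgefresh n hn F hk
            (mapEdge (ι ⋙q Named.proj) e) ?_ j hj ?_
          · rw [← hfacee ⟨n, hn⟩ F hk]
            exact List.mem_map_of_mem hE
          · rw [← hlab, ← hle j]
            exact List.mem_map_of_mem hf
      · exact Or.inl ⟨e, hP.1, rfl, .refl _⟩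
    · intro hee'
      induction hee' with
      | rel e e' hc =>
        obtain ⟨F, hF, k, h₁, h₂⟩ := hc
        obtain ⟨i, rfl⟩ := fe.surjective F
        exact eq_of_map_getElem? (hDe i) (hEe i) (hre i ((hmemA i).1 hF)) h₁ h₂
      | refl => rfl
      | symm _ _ _ ih => exact ih.symm
      | trans _ _ _ _ _ ih₁ ih₂ => exact ih₁.trans ih₂
  -- The faces of `H` that are not collapsed.
  let toFace : {F : H.InteriorFace // F ∉ A} → G.InteriorFace := fun F =>
    (kind (fe.symm F.1)).get (Option.isSome_iff_ne_none.2 F.2)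
  have htoFace : ∀ F, kind (fe.symm F.1) = some (toFace F) := fun F => (Option.some_get _).symm
  have hbij : Function.Bijective toFace := by
    constructor
    · intro F F' hFF'
      have h₁ := htoFace F
      rw [hFF'] at h₁
      have := h.kind_injective _ _ _ (fe.symm F.1).2 (fe.symm F'.1).2 h₁ (htoFace F')
      exact Subtype.ext (fe.symm.injective (Fin.ext this))
    · intro F
      obtain ⟨n, hn, hF⟩ := h.exists_kind F (hL F)
      have hnA : fe ⟨n, hn⟩ ∉ A := fun hmem => by
        rw [hmemA] at hmem
        exact Option.some_ne_none _ (hF.symm.trans hmem)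
      refine ⟨⟨fe ⟨n, hn⟩, hnA⟩, ?_⟩
      have := htoFace ⟨fe ⟨n, hn⟩, hnA⟩
      rw [Equiv.symm_apply_apply] at this
      exact Option.some_injective _ (this.symm.trans hF)
  refine ⟨{
    H := H
    scheme := scheme
    A := A
    proper := fun hA' => ?_
    isAssociativity := fun F hF => ?_
    π := ι ⋙q Named.proj
    obj_surjective := fun v => ?_
    edge_surjective := hsurj
    obj_eq_iff := hobj
    edge_eq_iff := hedge
    faces := Equiv.ofBijective toFace hbij
    bface_eq := fun F => ?_
    bext_eq := ?_ }⟩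
  · obtain ⟨⟨F, hF⟩, -⟩ := hbij.2 F₀
    exact hF (hA' ▸ Set.mem_univ F)
  · obtain ⟨i, rfl⟩ := fe.surjective F
    refine isAssociativity_of_map (π := ι ⋙q Named.proj) ?_
    rw [ParBPath.map_comp, hbface]
    exact (hRstep i).2 ((hmemA i).1 hF)
  · -- Each vertex of a connected graph with two vertices is incident to an edge.
    obtain ⟨e, he⟩ := G.toGraph.exists_incident G.connected v
    obtain ⟨e', rfl⟩ := hsurj e
    rcases he with rfl | rfl
    · exact ⟨e'.left, rfl⟩
    · exact ⟨e'.right, rfl⟩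
  · rw [ParBPath.map_comp]
    obtain ⟨i, hi⟩ := fe.surjective F.1
    have := htoFace F
    rw [← hi, Equiv.symm_apply_apply] at this
    rw [← hi, hbface]
    exact (hRstep i).1 _ this
  · rw [ParBPath.map_comp, hbext]
    refine (hrow 0 (M + 1)).trans ?_
    rw [h.row_zero, h.row_eq _ le_rfl]
    rfl

/-- Every bracketed graph whose underlying anchored graph admits a pasting scheme presentation
admits a composition scheme extension. -/
theorem BracketedGraph.exists_compositionSchemeExtension (G : BracketedGraph)
    (hG : HasPastingSchemePresentation G.toAnchoredGraph) :
    Nonempty (CompositionSchemeExtension G) := by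
  obtain ⟨L, hLn, hne, hL, hs⟩ := hG.exists_sweep
  obtain ⟨F₀, -⟩ := List.exists_mem_of_ne_nil L hne
  obtain ⟨x, hx⟩ := hs.exists_increasing (G.isPath_dom none) (G.src_ne_snk none) (by
    intro d hd
    obtain ⟨F, -, rfl⟩ := List.mem_map.1 hd
    exact ⟨G.isPath_codom (some F), G.src_ne_snk (some F)⟩)
  obtain ⟨N, row, kind, h⟩ := hs.exists_bracketedSweep G.bface L hLn
    (List.map_congr_left fun F _ => (G.toParPath_bface F).symm) G.extDom.1 G.extDom.2
    G.extCodom.1 G.extCodom.2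
  refine h.exists_extension hL F₀ x fun {u v} e => hx ⟨u, v, e⟩ ?_
  rcases G.mem_dom_or_codom ⟨u, v, e⟩ with h | ⟨F, h⟩
  · exact Or.inl h
  · exact Or.inr ⟨_, List.mem_map_of_mem (hL F), h⟩

end Extension

end BicatPasting

theorem mainTheorem1 {B : Type*} [Bicategory B] (G : BicatPasting.BracketedGraph)
    (hG : BicatPasting.HasPastingSchemePresentation G.toAnchoredGraph)
    (φ : BicatPasting.Diagram G B) :
    Nonempty (BicatPasting.CompositionSchemeExtension G) ∧
      ∀ X X' : BicatPasting.CompositionSchemeExtension G, X.composite φ = X'.composite φ :=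
  ⟨G.exists_compositionSchemeExtension hG, fun X X' => X.composite_unique X' φ⟩
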